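/- **Circuits.** Let $\omega=e^{i\pi/4}$. A *CNOT-dihedral circuit* on $n\ge 0$ qubits is a term built, by horizontal composition (written as a product $CD$, with $C$ applied first) and vertical composition $C\otimes D$ ($C$ on the upper wires), from identities, instances of the symmetry (generalized $\mathrm{SWAP}$ gates), the scalar $\omega$ (a gate without wires), $X=\begin{pmatrix}0&1\\1&0\end{pmatrix}$, $T=\mathrm{diag}(1,\omega)$ and $\mathrm{CNOT}|x_1x_2\rangle=|x_1\,(x_1\oplus x_2)\rangle$. Wires are numbered $1,2,\dots$ from the top. $\mathrm{CNOT}_{i,j}$ has control $i$ and target $j$; indices on other gates name the wires on which they act; gates on non-adjacent wires are defined by conjugating with $\mathrm{SWAP}$ gates. The derived gates are $U_{1,2}=\mathrm{CNOT}_{1,2}\,T_2\,\mathrm{CNOT}_{1,2}$ and $V_{1,2,3}=\mathrm{CNOT}_{1,2}\,\mathrm{CNOT}_{2,3}\,T_3\,\mathrm{CNOT}_{2,3}\,\mathrm{CNOT}_{1,2}$. **Relations.** Write $C\approx D$ if $C$ can be rewritten into $D$ using the structural rules of a strict symmetric monoidal category (associativity, units, bifunctoriality, and naturality, self-inverseness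 and coherence of the symmetry) and the relations - $R_1$: $X^2=1$; $R_2$: $\mathrm{CNOT}_{1,2}X_2\mathrm{CNOT}_{1,2}=X_2$; $R_3$: $\mathrm{CNOT}_{1,2}X_1\mathrm{CNOT}_{1,2}=X_1X_2$; $R_4$: $\mathrm{CNOT}^2=1$; - $R_5$: $\mathrm{SWAP}=\mathrm{CNOT}\cdot\mathrm{SWAP}\cdot\mathrm{CNOT}\cdot\mathrm{SWAP}\cdot\mathrm{CNOT}$; $R_6$: $\mathrm{CNOT}_{1,3}=\mathrm{CNOT}_{2,3}\mathrm{CNOT}_{1,2}\mathrm{CNOT}_{2,3}\mathrm{CNOT}_{1,2}$; - $R_7$: $T^8=1$; $R_8$: $U^4=T_1^4T_2^4$; $R_9$: $V^2=T_1^6T_2^6T_3^6U_{1,2}^2U_{1,3}^2U_{2,3}^2$; $R_{10}$: $\omega^8=1$; - $R_{11}$: $XTX=\omega T^7$; $R_{12}$: $\mathrm{CNOT}_{1,2}T_1\mathrm{CNOT}_{1,2}=T_1$; - $R_{13}$: $\mathrm{CNOT}_{1,2}V_{2,3,4}\mathrm{CNOT}_{1,2}=\prod_{i}T_i^5\;\prod_{i<j}U_{i,j}^3\;\prod_{i<j<k}V_{i,j,k}$,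 where the products range over $\{1,2,3,4\}$ in lexicographical order. **Normal forms.** A *diagonal normal form* on $n$ qubits is a circuit $D=\omega^{k}\prod_iT_i^{a_i}\prod_{i<j}U_{i,j}^{b_{ij}}\prod_{i<j<k}V_{i,j,k}^{c_{ijk}}$ with the products in lexicographical order and exponents $0\le k,a_i\le 7$, $0\le b_{ij}\le 3$, $0\le c_{ijk}\le 1$. For $i\geq 1$ and $e\in\{0,1\}$ let $S_i^{e}=\mathrm{CNOT}_{i,i+1}^{e}\,\mathrm{SWAP}_{i,i+1}$. A *ladder* on $m\ge1$ qubits is a circuit $S_{m-1}^{e_{m-1}}\cdots S_2^{e_2}S_1^{e_1}\cdot S_1^{f_1}S_2^{f_2}\cdots S_{d}^{f_{d}}$ with $0\le d\le m-1$ and all $e_i,f_i\in\{0,1\}$ (an ascending stair to the top wire followed by a descending stair). An *affine normal form* on $n$ qubits is a circuit $A=L_1L_2\cdots L_n\cdot X_1^{g_1}\cdots X_n^{g_n}$, where $L_m$ is a ladder on the $m$ upper wires and $g_i\in\{0,1\}$. A *normal form* is a circuit $DA$ with $D$ a diagonal and $A$ an affine normal form; normal forms are identified with the data (exponents and stair lengths)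 that define them. **Proposition.** For every $n\ge0$ and every CNOT-dihedral circuit $C$ on $n$ qubits there is a normal form $DA$ with $C\approx DA$, and it is unique. Consequently the generators and $R_1$–$R_{13}$ present the CNOT-dihedral operators as a symmetric monoidal groupoid: every circuit $C$ has an inverse up to $\approx$ (a circuit $C'$ with $CC'\approx 1\approx C'C$), and two circuits $C,C'$ on $n$ qubits satisfy $C\approx C'$ if and only if they represent the same operator on $(\mathbb C^2)^{\otimes n}$. -/

import Mathlib

namespace CNOTDihedral

/-- Circuits over the gate set `{ω, X, T, CNOT}` on `n` qubits: the terms generated by the scalar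
`ω` (a gate without wires), the gates `X`, `T`, `CNOT` and all instances of the symmetry, under
horizontal composition `seq` (left factor applied first) and vertical composition `tensor`
(left factor on the upper wires). Wires are numbered from the top, starting with `0`. -/
inductive Circuit : ℕ → Type
  /-- The identity circuit. -/
  | wires (n : ℕ) : Circuit n
  | seq {n : ℕ} (C D : Circuit n) : Circuit n
  | tensor {m n : ℕ} (C : Circuit m) (D : Circuit n) : Circuit (m + n)
  /-- The symmetry, which exchanges the block of the upper `m` wires with the block of the
  lower `n` wires. -/
  | symm (m n : ℕ) : Circuit (m + n)
  | omega : Circuit 0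
  | X : Circuit 1
  | T : Circuit 1
  /-- Control on the upper wire, target on the lower wire. -/
  | CNOT : Circuit 2

infixl:70 " ⨾ " => Circuit.seq
infixl:75 " ⊠ " => Circuit.tensor

namespace Circuit

/-- Transport of a circuit along an equality of numbers of wires. -/
def cast {m n : ℕ} (h : m = n) (C : Circuit m) : Circuit n := h ▸ C

/-- The `k`-fold horizontal composition of `C` with itself. -/
def pow {n : ℕ} (C : Circuit n) : ℕ → Circuit n
  | 0 => wires n
  | k + 1 => pow C k ⨾ C

/-- Horizontal composition of a list of circuits, from left to right. -/
def seqList {n : ℕ} (l : List (Circuit n)) : Circuit n := l.foldr seq (wires n)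

/-- The scalar `s` placed in front of the circuit `C`. -/
def scalar {n : ℕ} (s : Circuit 0) (C : Circuit n) : Circuit n :=
  cast (Nat.zero_add n) (s ⊠ C)

/-- The two-qubit SWAP gate. -/
def SWAP : Circuit 2 := symm 1 1

/-- The derived gate `U`. -/
def U : Circuit 2 := CNOT ⨾ (wires 1 ⊠ T) ⨾ CNOT

/-- The derived gate `V`. -/
def V : Circuit 3 :=
  (CNOT ⊠ wires 1) ⨾ (wires 1 ⊠ CNOT) ⨾ (wires 2 ⊠ T) ⨾ (wires 1 ⊠ CNOT) ⨾ (CNOT ⊠ wires 1)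

/-- The circuit `g` on the `k` adjacent wires `i, …, i + k - 1` among `n` wires. -/
def place {k : ℕ} (n i : ℕ) (g : Circuit k) (h : i + k ≤ n) : Circuit n :=
  cast (Nat.add_sub_of_le h) (wires i ⊠ g ⊠ wires (n - (i + k)))

/-- The two-qubit circuit `g` on the wires `i < j`: wire `j` is moved up next to wire `i`,
`g` is applied, and the wire is moved back. -/
def onPair {n : ℕ} (i j : Fin n) (h : i < j) (g : Circuit 2) : Circuit n :=
  place n (i + 1) (symm (j - i - 1) 1) (by omega) ⨾
  place n i g (by omega) ⨾
  place n (i + 1) (symm 1 (j - i - 1)) (by omega)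

/-- The three-qubit circuit `g` on the wires `i < j < k`: the wires `j` and `k` are moved up next
to wire `i`, `g` is applied, and the wires are moved back. -/
def onTriple {n : ℕ} (i j k : Fin n) (h : i < j ∧ j < k) (g : Circuit 3) : Circuit n :=
  place n (i + 1) (symm (j - i - 1) 1) (by omega) ⨾
  place n (i + 2) (symm (k - i - 2) 1) (by omega) ⨾
  place n i g (by omega) ⨾
  place n (i + 2) (symm 1 (k - i - 2)) (by omega) ⨾
  place n (i + 1) (symm 1 (j - i - 1)) (by omega)

/-- A column of gates: the power `a i` of the one-qubit circuit `g` on each wire `i`. -/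
def layer (g : Circuit 1) : (n : ℕ) → (Fin n → ℕ) → Circuit n
  | 0, _ => wires 0
  | n + 1, a => layer g n (fun i => a i.castSucc) ⊠ pow g (a (Fin.last n))

end Circuit

open Circuit in
/-- The thirteen relations. -/
inductive Relation : {n : ℕ} → Circuit n → Circuit n → Prop
  | R1 : Relation (pow X 2) (wires 1)
  | R2 : Relation (CNOT ⨾ (wires 1 ⊠ X) ⨾ CNOT) (wires 1 ⊠ X)
  | R3 : Relation (CNOT ⨾ (X ⊠ wires 1) ⨾ CNOT) (X ⊠ X)
  | R4 : Relation (pow CNOT 2) (wires 2)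
  | R5 : Relation SWAP (CNOT ⨾ SWAP ⨾ CNOT ⨾ SWAP ⨾ CNOT)
  | R6 : Relation (onPair (n := 3) 0 2 (by decide) CNOT)
      ((wires 1 ⊠ CNOT) ⨾ (CNOT ⊠ wires 1) ⨾ (wires 1 ⊠ CNOT) ⨾ (CNOT ⊠ wires 1))
  | R7 : Relation (pow T 8) (wires 1)
  | R8 : Relation (pow U 4) (pow T 4 ⊠ pow T 4)
  | R9 : Relation (pow V 2)
      ((pow T 6 ⊠ pow T 6 ⊠ pow T 6 :) ⨾
        onPair (n := 3) 0 1 (by decide) (pow U 2) ⨾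
        onPair (n := 3) 0 2 (by decide) (pow U 2) ⨾
        onPair (n := 3) 1 2 (by decide) (pow U 2))
  | R10 : Relation (pow omega 8) (wires 0)
  | R11 : Relation (X ⨾ T ⨾ X) (scalar omega (pow T 7))
  | R12 : Relation (CNOT ⨾ (T ⊠ wires 1) ⨾ CNOT) (T ⊠ wires 1)
  | R13 : Relation ((CNOT ⊠ wires 2) ⨾ (wires 1 ⊠ V :) ⨾ (CNOT ⊠ wires 2))
      ((pow T 5 ⊠ pow T 5 ⊠ pow T 5 ⊠ pow T 5 :) ⨾
        onPair (n := 4) 0 1 (by decide) (pow U 3) ⨾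
        onPair (n := 4) 0 2 (by decide) (pow U 3) ⨾
        onPair (n := 4) 0 3 (by decide) (pow U 3) ⨾
        onPair (n := 4) 1 2 (by decide) (pow U 3) ⨾
        onPair (n := 4) 1 3 (by decide) (pow U 3) ⨾
        onPair (n := 4) 2 3 (by decide) (pow U 3) ⨾
        onTriple (n := 4) 0 1 2 (by decide) V ⨾
        onTriple (n := 4) 0 1 3 (by decide) V ⨾
        onTriple (n := 4) 0 2 3 (by decide) V ⨾
        onTriple (n := 4) 1 2 3 (by decide) V)

open Circuit in
/-- `Derivable C D`: the circuit `C` can be rewritten into `D` with the thirteen relations and the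
structural rules of a (strict) symmetric monoidal category. It is the least congruence for the
two compositions that contains the relations and the structural rules. -/
inductive Derivable : {n : ℕ} → Circuit n → Circuit n → Prop
  | refl {n : ℕ} (C : Circuit n) : Derivable C C
  | symm {n : ℕ} {C D : Circuit n} : Derivable C D → Derivable D C
  | trans {n : ℕ} {C D E : Circuit n} : Derivable C D → Derivable D E → Derivable C E
  | seq_congr {n : ℕ} {C C' D D' : Circuit n} :
      Derivable C C' → Derivable D D' → Derivable (C ⨾ D) (C' ⨾ D')
  | tensor_congr {m n : ℕ} {C C' : Circuit m} {D D' : Circuit n} :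
      Derivable C C' → Derivable D D' → Derivable (C ⊠ D) (C' ⊠ D')
  | seq_assoc {n : ℕ} (C D E : Circuit n) : Derivable (C ⨾ D ⨾ E) (C ⨾ (D ⨾ E))
  | id_seq {n : ℕ} (C : Circuit n) : Derivable (wires n ⨾ C) C
  | seq_id {n : ℕ} (C : Circuit n) : Derivable (C ⨾ wires n) C
  | tensor_assoc {m n k : ℕ} (C : Circuit m) (D : Circuit n) (E : Circuit k) :
      Derivable (C ⊠ D ⊠ E) (cast (Nat.add_assoc m n k).symm (C ⊠ (D ⊠ E)))
  | id_tensor {n : ℕ} (C : Circuit n) : Derivable (cast (Nat.zero_add n) (wires 0 ⊠ C)) C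
  | tensor_id {n : ℕ} (C : Circuit n) : Derivable (cast (Nat.add_zero n) (C ⊠ wires 0)) C
  | id_tensor_id (m n : ℕ) : Derivable (wires m ⊠ wires n) (wires (m + n))
  /-- The bifunctorial law. -/
  | interchange {m n : ℕ} (C C' : Circuit m) (D D' : Circuit n) :
      Derivable ((C ⨾ C') ⊠ (D ⨾ D')) ((C ⊠ D) ⨾ (C' ⊠ D'))
  /-- The symmetry is self-inverse. -/
  | symm_symm (m n : ℕ) :
      Derivable (Circuit.symm m n ⨾ cast (Nat.add_comm n m) (Circuit.symm n m)) (wires (m + n))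
  /-- Naturality of the symmetry. -/
  | naturality {m n : ℕ} (C : Circuit m) (D : Circuit n) :
      Derivable ((C ⊠ D) ⨾ Circuit.symm m n)
        (Circuit.symm m n ⨾ cast (Nat.add_comm n m) (D ⊠ C))
  /-- Coherence of the symmetry: moving past no wire. -/
  | symm_zero (m : ℕ) : Derivable (cast (Nat.add_zero m) (Circuit.symm m 0)) (wires m)
  /-- Coherence of the symmetry: moving past `n + k` wires is moving past `n` wires and then
  past `k` wires. -/
  | hexagon (m n k : ℕ) :
      Derivable (cast (Nat.add_assoc m n k).symm (Circuit.symm m (n + k)))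
        ((Circuit.symm m n ⊠ wires k) ⨾
          cast (show n + (m + k) = m + n + k by omega) (wires n ⊠ Circuit.symm m k))
  | rel {n : ℕ} {C D : Circuit n} : Relation C D → Derivable C D

/-- The operator represented by a circuit, as a matrix in the computational basis; the entry at
`(x, y)` is the coefficient of `|x⟩` in the image of `|y⟩`. -/
noncomputable def Circuit.operator :
    {n : ℕ} → Circuit n → Matrix (Fin n → Fin 2) (Fin n → Fin 2) ℂ
  | n, .wires _ => (1 : Matrix (Fin n → Fin 2) (Fin n → Fin 2) ℂ)
  | _, .seq C D => D.operator * C.operator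
  | _, .tensor (m := m) (n := n) C D => fun x y =>
      C.operator (fun i => x (Fin.castAdd n i)) (fun i => y (Fin.castAdd n i)) *
        D.operator (fun i => x (Fin.natAdd m i)) (fun i => y (Fin.natAdd m i))
  | _, .symm m n => fun x y =>
      if (fun i : Fin (n + m) => x (Fin.cast (Nat.add_comm n m) i)) =
          Fin.append (fun i : Fin n => y (Fin.natAdd m i)) (fun i : Fin m => y (Fin.castAdd n i))
      then 1 else 0
  | _, .omega => fun _ _ => Complex.exp (Real.pi * Complex.I / 4)
  | _, .X => fun x y => !![0, 1; 1, 0] (x 0) (y 0)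
  | _, .T => fun x y => !![1, 0; 0, Complex.exp (Real.pi * Complex.I / 4)] (x 0) (y 0)
  | _, .CNOT => fun x y => if x 0 = y 0 ∧ x 1 = y 0 + y 1 then 1 else 0

/-! Diagonal normal forms -/

/-- The degrees that determine a diagonal normal form on `n` qubits: one degree in `ℤ/8` for `ω`
and for each `T`-block, one in `ℤ/4` for each `U`-block and one in `ℤ/2` for each `V`-block. -/
structure DiagonalNF (n : ℕ) where
  omegaDeg : Fin 8
  tDeg : Fin n → Fin 8
  uDeg : {p : Fin n × Fin n // p.1 < p.2} → Fin 4
  vDeg : {p : Fin n × Fin n × Fin n // p.1 < p.2.1 ∧ p.2.1 < p.2.2} → Fin 2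

/-- The `U`-blocks on all pairs of wires `i < j`, in lexicographical order. -/
def uTriangle {n : ℕ} (b : {p : Fin n × Fin n // p.1 < p.2} → Fin 4) : Circuit n :=
  Circuit.seqList <|
    (List.finRange n).flatMap fun i => (List.finRange n).flatMap fun j =>
      if h : i < j then [Circuit.onPair i j h (Circuit.pow Circuit.U (b ⟨(i, j), h⟩))] else []

/-- The `V`-blocks on all triples of wires `i < j < k`, in lexicographical order. -/
def vTriangle {n : ℕ}
    (c : {p : Fin n × Fin n × Fin n // p.1 < p.2.1 ∧ p.2.1 < p.2.2} → Fin 2) : Circuit n :=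
  Circuit.seqList <|
    (List.finRange n).flatMap fun i => (List.finRange n).flatMap fun j =>
      (List.finRange n).flatMap fun k =>
        if h : i < j ∧ j < k then
          [Circuit.onTriple i j k h (Circuit.pow Circuit.V (c ⟨(i, j, k), h⟩))] else []

/-- A diagonal normal form: a power of `ω`, followed by a column of `T`-blocks, followed by the
`U`-blocks, followed by the `V`-blocks. -/
def DiagonalNF.circuit {n : ℕ} (N : DiagonalNF n) : Circuit n :=
  Circuit.scalar (Circuit.pow Circuit.omega N.omegaDeg)
    (Circuit.layer Circuit.T n (fun i => N.tDeg i) ⨾ uTriangle N.uDeg ⨾ vTriangle N.vDeg)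

/-! Affine normal forms -/

/-- One step of a stair on two adjacent wires: a `CNOT`-block of degree `0` or `1`, followed by a
SWAP gate. -/
def stairStep (e : Fin 2) : Circuit 2 := Circuit.pow Circuit.CNOT e ⨾ Circuit.SWAP

/-- An ascending stair on `m + 1` qubits: stair steps on the pairs of wires
`(m - 1, m), …, (1, 2), (0, 1)` in this order. -/
def ascendingStair : (m : ℕ) → (Fin m → Fin 2) → Circuit (m + 1)
  | 0, _ => Circuit.wires 1
  | m + 1, e =>
      (Circuit.wires m ⊠ stairStep (e (Fin.last m)) :) ⨾
        (ascendingStair m (fun i => e i.castSucc) ⊠ Circuit.wires 1)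

/-- A descending stair on `m + 1` qubits: stair steps on the pairs of wires
`(0, 1), (1, 2), …, (m - 1, m)` in this order. -/
def descendingStair : (m : ℕ) → (Fin m → Fin 2) → Circuit (m + 1)
  | 0, _ => Circuit.wires 1
  | m + 1, e =>
      (descendingStair m (fun i => e i.castSucc) ⊠ Circuit.wires 1) ⨾
        (Circuit.wires m ⊠ stairStep (e (Fin.last m)) :)

/-- The data of a ladder on `m + 1` qubits: the degrees of the ascending stair, and the number of
steps of the descending stair with their degrees. -/
structure Ladder (m : ℕ) where
  asc : Fin m → Fin 2
  steps : Fin (m + 1)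
  desc : Fin steps → Fin 2

/-- A ladder on `m + 1` qubits: an ascending stair from the bottom wire to the top wire, followed
by a descending stair which starts at the top wire and need not reach the bottom wire. -/
def Ladder.circuit {m : ℕ} (L : Ladder m) : Circuit (m + 1) :=
  ascendingStair m L.asc ⨾
    Circuit.cast (show (L.steps : ℕ) + 1 + (m - L.steps) = m + 1 by omega)
      (descendingStair L.steps L.desc ⊠ Circuit.wires (m - L.steps))

/-- The ladders on the upper `1, 2, …, n` wires, in this order. -/
def ladders : (n : ℕ) → ((i : Fin n) → Ladder i) → Circuit n
  | 0, _ => Circuit.wires 0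
  | n + 1, L => (ladders n (fun i => L i.castSucc) ⊠ Circuit.wires 1) ⨾ (L (Fin.last n)).circuit

/-- The data of an affine normal form on `n` qubits: a ladder on the upper `i + 1` wires for each
`i < n`, and the degrees of the `X`-blocks. -/
structure AffineNF (n : ℕ) where
  ladder : (i : Fin n) → Ladder i
  xDeg : Fin n → Fin 2

/-- An affine normal form: ladders of increasing size, followed by a column of `X`-blocks. -/
def AffineNF.circuit {n : ℕ} (N : AffineNF n) : Circuit n :=
  ladders n N.ladder ⨾ Circuit.layer Circuit.X n (fun i => N.xDeg i)

end CNOTDihedral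

/-! Every generator sends a basis vector to a power of `ω` times a basis vector. An operator is
therefore the same thing as a pair: a permutation `act` of bit vectors and a phase exponent `phase`
with values in ℤ/8. Soundness is a check on these pairs. All claims then follow from two facts:
every circuit is derivably equal to a normal form, and distinct normal forms have distinct pairs.

Existence is proved in the group `CircuitClass n` of circuits modulo derivability. Words in SWAP and
CNOT are normalised by a coset enumeration modelled on the general linear group over the field with
two elements. A descending stair records the image of the top basis vector, which can be any nonzero
vector. Appending a gate gives another descending stair, preceded by an element of `TopFixing`,
whose generators all fix the top basis vector (`desc_mul_gate`). The ascending stair absorbs such an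
element up to a circuit on one wire fewer (`asc_mul_topFixing`), so induction produces the sequence
of ladders; X gates are pushed to the end. Conversely, the degrees of the stairs can be read off
from the linear map. Hence SWAP, CNOT and X circuits with the same permutation are derivably equal
(`aff_ext`).

The bridge to phases is `IsRot.unique`: a `T` gate conjugated by an affine circuit depends only on
the affine Boolean function that controls its phase. It reduces to the fact that an affine circuit
preserving the last bit commutes with `T` on the last wire, which is visible on its normal form. So
each set `S` of wires has a well-defined gate `rot S` whose phase is the parity of the bits in `S`.
These gates commute, and `U` and `V` are the cases of two and three wires. Relation `R13` writes a
parity gate on four wires as a product of parity gates on at most three, so the diagonal circuits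
`Diag` are stable under conjugation by affine circuits, and every circuit has the form diagonal
times affine. Relations `R8` and `R9` reduce the exponents of `U` modulo 4 and of `V` modulo 2.

For uniqueness, diagonal circuits do not move basis states and affine circuits have no phase, so the
two factors separate. The phase of a diagonal normal form is a combination of parities over ℤ/8. The
third, second and first differences of a parity at the origin, along wires of its set, are 4, -2 and
1. This is exactly what recovers the degrees of `V` modulo 2, of `U` modulo 4 and of `T` modulo 8,
in this order. -/

namespace CNOTDihedral

open scoped Fin.CommRing

/-! ### Circuits as permutations of the computational basis with phases -/

namespace Circuit

/-- The permutation of the basis states induced by a circuit. -/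
def act : {n : ℕ} → Circuit n → (Fin n → Fin 2) → (Fin n → Fin 2)
  | _, .wires _, x => x
  | _, .seq C D, x => D.act (C.act x)
  | _, .tensor (m := m) (n := n) C D, x =>
      Fin.append (C.act fun i => x (Fin.castAdd n i)) (D.act fun i => x (Fin.natAdd m i))
  | _, .symm m n, x => fun i =>
      Fin.append (fun j : Fin n => x (Fin.natAdd m j)) (fun j : Fin m => x (Fin.castAdd n j))
        (Fin.cast (Nat.add_comm m n) i)
  | _, .omega, x => x
  | _, .X, x => fun _ => x 0 + 1
  | _, .T, x => x
  | _, .CNOT, x => ![x 0, x 0 + x 1]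

/-- The exponent of `ω` in the phase that a circuit applies to a basis state. -/
def phase : {n : ℕ} → Circuit n → (Fin n → Fin 2) → ZMod 8
  | _, .wires _, _ => 0
  | _, .seq C D, x => C.phase x + D.phase (C.act x)
  | _, .tensor (m := m) (n := n) C D, x =>
      C.phase (fun i => x (Fin.castAdd n i)) + D.phase (fun i => x (Fin.natAdd m i))
  | _, .symm _ _, _ => 0
  | _, .omega, _ => 1
  | _, .X, _ => 0
  | _, .T, x => ((x 0).val : ZMod 8)
  | _, .CNOT, _ => 0

/-- The primitive eighth root of unity. -/
noncomputable def omegaRoot : ℂ := Complex.exp (Real.pi * Complex.I / 4)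

lemma isPrimitiveRoot_omegaRoot : IsPrimitiveRoot omegaRoot 8 := by
  have h := Complex.isPrimitiveRoot_exp 8 (by norm_num)
  have : omegaRoot = Complex.exp (2 * Real.pi * Complex.I / (8 : ℕ)) := by
    unfold omegaRoot; congr 1; push_cast; ring
  rwa [this]

/-- The power of `ω` with exponent in `ℤ/8`. -/
noncomputable def omegaPow (k : ZMod 8) : ℂ := omegaRoot ^ k.val

lemma omegaPow_zero : omegaPow 0 = 1 := by simp [omegaPow]

lemma omegaPow_one : omegaPow 1 = omegaRoot := by
  have : (1 : ZMod 8).val = 1 := rfl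
  simp [omegaPow, this]

lemma omegaPow_add (a b : ZMod 8) : omegaPow (a + b) = omegaPow a * omegaPow b := by
  unfold omegaPow
  have h := pow_mod_orderOf omegaRoot (a.val + b.val)
  rw [← isPrimitiveRoot_omegaRoot.eq_orderOf] at h
  rw [← pow_add, ZMod.val_add, h]

lemma omegaPow_ne_zero (a : ZMod 8) : omegaPow a ≠ 0 := by
  unfold omegaPow omegaRoot; exact pow_ne_zero _ (Complex.exp_ne_zero _)

lemma omegaPow_injective : Function.Injective omegaPow := fun a b h =>
  ZMod.val_injective 8 (isPrimitiveRoot_omegaRoot.pow_inj (ZMod.val_lt a) (ZMod.val_lt b) h)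

lemma append_eq_iff {α : Type*} {m n : ℕ} (x : Fin (m + n) → α) (u : Fin m → α) (v : Fin n → α) :
    x = Fin.append u v ↔
      (fun i => x (Fin.castAdd n i)) = u ∧ (fun i => x (Fin.natAdd m i)) = v := by
  constructor
  · rintro rfl; exact ⟨by ext; simp, by ext; simp⟩
  · rintro ⟨rfl, rfl⟩; exact (Fin.append_castAdd_natAdd).symm

/-- Matrices with a single nonzero entry in each column, a power of `ω`, are closed under both
compositions and contain the generators. From here on operators are handled through `act` and
`phase` only. -/
lemma operator_apply {n : ℕ} (C : Circuit n) (x y : Fin n → Fin 2) :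
    C.operator x y = if x = C.act y then omegaPow (C.phase y) else 0 := by
  induction C with
  | wires n => simp [operator, act, phase, omegaPow_zero, Matrix.one_apply]
  | seq C D hC hD =>
    simp only [operator, Matrix.mul_apply, hC, hD, act, phase, omegaPow_add]
    rw [Finset.sum_eq_single (C.act y)]
    · by_cases h : x = D.act (C.act y)
      · simp [h, mul_comm]
      · simp only [h, if_false, zero_mul]
    · intro b _ hb; simp [hb]
    · simp
  | @tensor m n C D hC hD =>
    simp only [operator, act, phase, omegaPow_add, hC, hD]
    by_cases h1 : (fun i => x (Fin.castAdd n i)) = C.act (fun i => y (Fin.castAdd n i))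
    · by_cases h2 : (fun i => x (Fin.natAdd m i)) = D.act (fun i => y (Fin.natAdd m i))
      · rw [if_pos h1, if_pos h2, if_pos ((append_eq_iff _ _ _).2 ⟨h1, h2⟩)]
      · rw [if_neg h2, if_neg (fun h => h2 ((append_eq_iff _ _ _).1 h).2), mul_zero]
    · rw [if_neg h1, if_neg (fun h => h1 ((append_eq_iff _ _ _).1 h).1), zero_mul]
  | symm m n =>
    simp only [operator, act, phase, omegaPow_zero]
    congr 1
    apply propext
    constructor
    · intro h; ext i
      have := congrFun h (Fin.cast (Nat.add_comm m n) i)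
      simp only [Fin.cast_cast, Fin.cast_eq_self] at this
      rw [this]
    · intro h; subst h; rfl
  | omega =>
    simp only [operator, act, phase, omegaPow_one, omegaRoot]
    rw [if_pos (Subsingleton.elim _ _)]
  | X =>
    simp only [operator, act, phase, omegaPow_zero]
    have : (x = fun _ => y 0 + 1) ↔ x 0 = y 0 + 1 :=
      ⟨fun h => congrFun h 0, fun h => funext fun i => by rw [Subsingleton.elim i 0, h]⟩
    simp only [this]
    generalize x 0 = a
    generalize y 0 = b
    fin_cases a <;> fin_cases b <;> simp
  | T =>
    simp only [operator, act, phase, omegaPow]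
    have : (x = y) ↔ x 0 = y 0 :=
      ⟨fun h => congrFun h 0, fun h => funext fun i => by rw [Subsingleton.elim i 0, h]⟩
    simp only [this]
    generalize x 0 = a
    generalize y 0 = b
    have h1 : ZMod.val (1 : ZMod 8) = 1 := rfl
    fin_cases a <;> fin_cases b <;> simp [omegaRoot, h1]
  | CNOT =>
    simp only [operator, act, phase, omegaPow_zero]
    congr 1
    apply propext
    constructor
    · rintro ⟨h1, h2⟩; ext i; fin_cases i
      · exact congrArg _ h1
      · exact congrArg _ h2
    · intro h; exact ⟨congrFun h 0, congrFun h 1⟩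

/-- The position of the nonzero entry in a column determines `act`; its value determines `phase`
because `ω` has order exactly 8. -/
theorem operator_eq_iff {n : ℕ} (C D : Circuit n) :
    C.operator = D.operator ↔ C.act = D.act ∧ C.phase = D.phase := by
  constructor
  · intro h
    have key : ∀ y, C.act y = D.act y ∧ C.phase y = D.phase y := by
      intro y
      have := congrFun (congrFun h (C.act y)) y
      rw [operator_apply, operator_apply, if_pos rfl] at this
      split_ifs at this with h'
      · exact ⟨h', omegaPow_injective this⟩
      · exact absurd this (omegaPow_ne_zero _)
    exact ⟨funext fun y => (key y).1, funext fun y => (key y).2⟩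
  · rintro ⟨h1, h2⟩
    ext x y
    rw [operator_apply, operator_apply, h1, h2]

lemma act_cast {m n : ℕ} (h : m = n) (C : Circuit m) (x : Fin n → Fin 2) :
    (cast h C).act x = fun i => C.act (fun j => x (Fin.cast h j)) (Fin.cast h.symm i) := by
  subst h; rfl

lemma phase_cast {m n : ℕ} (h : m = n) (C : Circuit m) (x : Fin n → Fin 2) :
    (cast h C).phase x = C.phase (fun j => x (Fin.cast h j)) := by
  subst h; rfl

lemma act_seq {n : ℕ} (C D : Circuit n) (x : Fin n → Fin 2) :
    (C ⨾ D).act x = D.act (C.act x) := rfl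

lemma act_tensor {m n : ℕ} (C : Circuit m) (D : Circuit n) (x : Fin (m + n) → Fin 2)
    (i : Fin (m + n)) : (C ⊠ D).act x i =
      if h : (i : ℕ) < m then C.act (fun j => x ⟨j, by omega⟩) ⟨i, h⟩
      else D.act (fun j => x ⟨m + j, by omega⟩) ⟨i - m, by omega⟩ := by
  induction i using Fin.addCases with
  | left i => simp only [act, Fin.append_left, Fin.val_castAdd, i.2, dif_pos]; rfl
  | right i =>
    simp only [act, Fin.append_right, Fin.val_natAdd, not_lt.2 (Nat.le_add_right m i), dif_neg,
      not_false_eq_true]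
    congr 1
    ext; simp

lemma act_symm {m n : ℕ} (x : Fin (m + n) → Fin 2) (i : Fin (m + n)) :
    (symm m n).act x i =
      if h : (i : ℕ) < n then x ⟨m + i, by omega⟩ else x ⟨i - n, by omega⟩ := by
  obtain ⟨j, rfl⟩ : ∃ j, i = Fin.cast (Nat.add_comm n m) j := ⟨Fin.cast (Nat.add_comm m n) i, rfl⟩
  simp only [act, Fin.cast_cast, Fin.cast_eq_self]
  induction j using Fin.addCases with
  | left i => simp only [Fin.append_left, Fin.val_castAdd, Fin.val_cast, i.2, dif_pos]; rfl
  | right i =>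
    simp only [Fin.append_right, Fin.val_natAdd, Fin.val_cast, not_lt.2 (Nat.le_add_right n i),
      dif_neg, not_false_eq_true]
    congr 1
    ext; simp

end Circuit

open Circuit

/-! ### Soundness of the relations and of the structural rules -/

lemma Relation.sound {n : ℕ} {C D : Circuit n} (h : Relation C D) :
    ∀ x, C.act x = D.act x ∧ C.phase x = D.phase x := by
  -- Each relation involves at most four wires, so both sides can be evaluated on all basis states.
  cases h <;> decide +kernel

theorem Derivable.sound {n : ℕ} {C D : Circuit n} (h : Derivable C D) :
    ∀ x, C.act x = D.act x ∧ C.phase x = D.phase x := by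
  induction h with
  | refl C => exact fun x => ⟨rfl, rfl⟩
  | symm _ ih => exact fun x => ⟨(ih x).1.symm, (ih x).2.symm⟩
  | trans _ _ ih₁ ih₂ => exact fun x => ⟨(ih₁ x).1.trans (ih₂ x).1, (ih₁ x).2.trans (ih₂ x).2⟩
  | seq_congr _ _ ih₁ ih₂ =>
    intro x; simp only [act, phase, (ih₁ x).1, (ih₁ x).2, (ih₂ _).1, (ih₂ _).2, and_self]
  | tensor_congr _ _ ih₁ ih₂ =>
    intro x; simp only [act, phase, (ih₁ _).1, (ih₁ _).2, (ih₂ _).1, (ih₂ _).2, and_self]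
  | seq_assoc C D E => intro x; simp only [act, phase, add_assoc, and_self]
  | id_seq C => intro x; simp only [act, phase, zero_add, and_self]
  | seq_id C => intro x; simp only [act, phase, add_zero, and_self]
  | @tensor_assoc m n k C D E =>
    intro x
    refine ⟨funext fun i => ?_, ?_⟩
    · simp only [act_cast, act_tensor, Fin.val_cast]
      by_cases h1 : (i : ℕ) < m
      · have h2 : (i : ℕ) < m + n := by omega
        simp only [h1, h2, dif_pos]; rfl
      · by_cases h2 : (i : ℕ) < m + n
        · have h3 : (i : ℕ) - m < n := by omega
          simp only [h1, h2, h3, dif_pos, dif_neg, not_false_eq_true]; rfl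
        · have h3 : ¬ (i : ℕ) - m < n := by omega
          simp only [h1, h2, h3, dif_neg, not_false_eq_true, Nat.sub_sub, Fin.cast_mk,
            Nat.add_assoc]
    · simp only [phase_cast, phase, add_assoc]
      congr 3
      funext i; congr 1; ext; simp [Nat.add_assoc]
  | id_tensor C =>
    intro x
    refine ⟨funext fun i => ?_, ?_⟩
    · simp [act_cast, act_tensor]
    · simp only [phase_cast, phase, zero_add]
      congr 1; funext i; congr 1; ext; simp
  | tensor_id C =>
    intro x
    refine ⟨funext fun i => ?_, ?_⟩
    · simp [act_cast, act_tensor]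
    · simp only [phase_cast, phase, add_zero]; rfl
  | id_tensor_id m n =>
    intro x
    refine ⟨funext fun i => ?_, by simp [phase]⟩
    simp only [act_tensor]
    split_ifs with h
    · rfl
    · simp only [act]; congr 1; ext; simp; omega
  | interchange C C' D D' =>
    intro x
    simp only [act, phase, Fin.append_left, Fin.append_right, true_and]
    ring
  | symm_symm m n =>
    intro x
    refine ⟨funext fun i => ?_, by simp [phase, phase_cast]⟩
    simp only [act_seq, act_cast, act_symm, Fin.val_cast]
    split_ifs <;> first | omega | skip
    all_goals simp only [act]; congr 1; ext; simp only; omega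
  | @naturality m n C D =>
    intro x
    refine ⟨funext fun i => ?_, ?_⟩
    · simp only [act_seq, act_cast, act_symm, act_tensor, Fin.val_cast]
      split_ifs with h h' h'
      · omega
      · simp only [Nat.add_sub_cancel_left, Fin.is_lt, dif_pos]
      · simp only [Nat.add_sub_cancel_left, Nat.not_lt.2 (Nat.le_add_right _ _),
          dif_neg, not_false_eq_true]
      · omega
    · simp only [phase, phase_cast, add_zero, zero_add]
      rw [add_comm]
      congr 2 <;> funext i <;> simp [act_symm] <;> rfl
  | symm_zero m =>
    intro x
    refine ⟨funext fun i => ?_, by simp [phase, phase_cast]⟩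
    simp only [act_cast, act_symm]
    simp [act]
  | hexagon m n k =>
    intro x
    refine ⟨funext fun i => ?_, by simp [phase, phase_cast]⟩
    simp only [act_seq, act_cast, act_symm, act_tensor, Fin.val_cast, Fin.cast_mk]
    split_ifs <;> first | omega | skip
    all_goals try simp only [act]
    all_goals try (congr 1; ext; simp only; omega)
    split_ifs
    · rfl
    · omega
  | rel h => exact h.sound

/-! ### Circuits modulo derivability and the placement of gates among wires -/

/-- Derivability as an equivalence relation. -/
instance derivableSetoid (n : ℕ) : Setoid (Circuit n) where
  r := Derivable
  iseqv := ⟨Derivable.refl, Derivable.symm, Derivable.trans⟩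

/-- Circuits on `n` qubits up to derivability. -/
def CircuitClass (n : ℕ) : Type := Quotient (derivableSetoid n)

namespace CircuitClass

/-- The class of a circuit. -/
def mk {n : ℕ} (C : Circuit n) : CircuitClass n := Quotient.mk _ C

lemma mk_eq_mk {n : ℕ} {C D : Circuit n} : mk C = mk D ↔ Derivable C D := Quotient.eq

lemma mk_surjective {n : ℕ} (a : CircuitClass n) : ∃ C, mk C = a := Quotient.exists_rep a

instance (n : ℕ) : Monoid (CircuitClass n) where
  mul := Quotient.map₂ seq fun _ _ h _ _ h' => Derivable.seq_congr h h'
  one := mk (wires n)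
  mul_assoc := by
    rintro ⟨a⟩ ⟨b⟩ ⟨c⟩; exact mk_eq_mk.2 (.seq_assoc a b c)
  one_mul := by rintro ⟨a⟩; exact mk_eq_mk.2 (.id_seq a)
  mul_one := by rintro ⟨a⟩; exact mk_eq_mk.2 (.seq_id a)

lemma mk_seq {n : ℕ} (C D : Circuit n) : mk (C ⨾ D) = mk C * mk D := rfl

lemma mk_wires (n : ℕ) : mk (wires n) = 1 := rfl

lemma mk_pow {n : ℕ} (C : Circuit n) (k : ℕ) : mk (Circuit.pow C k) = mk C ^ k := by
  induction k with
  | zero => rfl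
  | succ k ih => rw [Circuit.pow, mk_seq, ih, pow_succ]

lemma mk_seqList {n : ℕ} (l : List (Circuit n)) : mk (seqList l) = (l.map mk).prod := by
  induction l with
  | nil => rfl
  | cons C l ih =>
    rw [List.map_cons, List.prod_cons, ← ih]; rfl

/-- Vertical composition of classes. -/
def ten {m n : ℕ} : CircuitClass m → CircuitClass n → CircuitClass (m + n) :=
  Quotient.map₂ tensor fun _ _ h _ _ h' => Derivable.tensor_congr h h'

lemma mk_tensor {m n : ℕ} (C : Circuit m) (D : Circuit n) : mk (C ⊠ D) = ten (mk C) (mk D) := rfl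

lemma ten_mul {m n : ℕ} (a a' : CircuitClass m) (b b' : CircuitClass n) :
    ten (a * a') (b * b') = ten a b * ten a' b' := by
  induction a using Quotient.inductionOn; induction a' using Quotient.inductionOn
  induction b using Quotient.inductionOn; induction b' using Quotient.inductionOn
  exact mk_eq_mk.2 (.interchange _ _ _ _)

lemma ten_one (m n : ℕ) : ten (1 : CircuitClass m) (1 : CircuitClass n) = 1 :=
  mk_eq_mk.2 (.id_tensor_id m n)

/-- Transport along an equality of numbers of wires. -/
def castHom {m n : ℕ} (h : m = n) : CircuitClass m →* CircuitClass n where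
  toFun a := h ▸ a
  map_one' := by subst h; rfl
  map_mul' := by subst h; intros; rfl

lemma mk_cast {m n : ℕ} (h : m = n) (C : Circuit m) : mk (Circuit.cast h C) = castHom h (mk C) := by
  subst h; rfl

lemma castHom_rfl {n : ℕ} (a : CircuitClass n) (h : n = n) : castHom h a = a := rfl

lemma castHom_castHom {m n k : ℕ} (h : m = n) (h' : n = k) (a : CircuitClass m) :
    castHom h' (castHom h a) = castHom (h.trans h') a := by subst h h'; rfl

/-- Casts between equal numbers of wires vanish in the sigma type. Identities whose sides have the
same number of wires only up to arithmetic are proved there, in the monoid of vertical composition,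
and brought back with `eq_of_sigma`. -/
lemma sigma_castHom {m n : ℕ} (h : m = n) (a : CircuitClass m) :
    (⟨n, castHom h a⟩ : Σ n, CircuitClass n) = ⟨m, a⟩ := by subst h; rfl

lemma eq_of_sigma {n : ℕ} {a b : CircuitClass n}
    (h : (⟨n, a⟩ : Σ n, CircuitClass n) = ⟨n, b⟩) : a = b := by
  simpa using h

lemma eq_castHom_of_sigma {m n : ℕ} {a : CircuitClass n} {b : CircuitClass m} (h : m = n)
    (h' : (⟨n, a⟩ : Σ n, CircuitClass n) = ⟨m, b⟩) : a = castHom h b :=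
  eq_of_sigma (h'.trans (sigma_castHom h b).symm)

/-- Circuits with any number of wires form a monoid under vertical composition. -/
instance : Monoid (Σ n, CircuitClass n) where
  mul a b := ⟨a.1 + b.1, ten a.2 b.2⟩
  one := ⟨0, 1⟩
  mul_assoc := by
    rintro ⟨m, ⟨a⟩⟩ ⟨n, ⟨b⟩⟩ ⟨k, ⟨c⟩⟩
    have := mk_eq_mk.2 (Derivable.tensor_assoc a b c)
    rw [mk_cast] at this
    exact (congrArg (Sigma.mk _) this).trans (sigma_castHom _ _)
  one_mul := by
    rintro ⟨n, ⟨a⟩⟩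
    have := mk_eq_mk.2 (Derivable.id_tensor a)
    rw [mk_cast] at this
    exact (sigma_castHom (Nat.zero_add n) _).symm.trans (congrArg (Sigma.mk _) this)
  mul_one := by
    rintro ⟨n, ⟨a⟩⟩
    have := mk_eq_mk.2 (Derivable.tensor_id a)
    rw [mk_cast] at this
    exact (sigma_castHom (Nat.add_zero n) _).symm.trans (congrArg (Sigma.mk _) this)

lemma sigma_mul {m n : ℕ} (a : CircuitClass m) (b : CircuitClass n) :
    (⟨m, a⟩ * ⟨n, b⟩ : Σ n, CircuitClass n) = ⟨m + n, ten a b⟩ := rfl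

lemma sigma_zero : (⟨0, 1⟩ : Σ n, CircuitClass n) = 1 := rfl

lemma sigma_one_mul_one (m n : ℕ) :
    (⟨m, 1⟩ * ⟨n, 1⟩ : Σ n, CircuitClass n) = ⟨m + n, 1⟩ := by
  rw [sigma_mul, ten_one]

/-- The class `g` on the wires `i, …, i + k - 1`, with `r` wires below. -/
def pl {k n : ℕ} (i r : ℕ) (h : i + k + r = n) : CircuitClass k →* CircuitClass n where
  toFun g := castHom h (ten (ten 1 g) 1)
  map_one' := by rw [ten_one, ten_one, map_one]
  map_mul' a b := by
    rw [← map_mul, ← ten_mul, ← ten_mul, one_mul, one_mul]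

lemma sigma_pl {k n : ℕ} (i r : ℕ) (h : i + k + r = n) (g : CircuitClass k) :
    (⟨n, pl i r h g⟩ : Σ n, CircuitClass n) = ⟨i, 1⟩ * ⟨k, g⟩ * ⟨r, 1⟩ :=
  sigma_castHom _ _

lemma pl_pl {k m n : ℕ} (i r j s : ℕ) (h : i + m + r = n) (h' : j + k + s = m)
    (g : CircuitClass k) :
    pl i r h (pl j s h' g) = pl (i + j) (s + r) (by omega) g := by
  apply eq_of_sigma
  rw [sigma_pl, sigma_pl, sigma_pl, ← sigma_one_mul_one, ← sigma_one_mul_one]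
  simp only [mul_assoc]

lemma pl_congr {k n : ℕ} {i r i' r' : ℕ} (h : i + k + r = n) (h' : i' + k + r' = n)
    (hi : i = i') (g : CircuitClass k) : pl i r h g = pl i' r' h' g := by
  subst hi
  obtain rfl : r = r' := by omega
  rfl

lemma pl_self {n : ℕ} (h : 0 + n + 0 = n) (g : CircuitClass n) : pl 0 0 h g = g := by
  apply eq_of_sigma
  rw [sigma_pl, sigma_zero, one_mul, mul_one]

lemma castHom_pl {k n m : ℕ} (i r : ℕ) (h : i + k + r = n) (h' : n = m) (g : CircuitClass k) :
    castHom h' (pl i r h g) = pl i r (h.trans h') g := by subst h'; rfl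

lemma ten_one_right {m n : ℕ} (a : CircuitClass m) :
    ten a (1 : CircuitClass n) = pl 0 n (by omega) a := by
  apply eq_of_sigma
  rw [sigma_pl, sigma_zero, one_mul, sigma_mul]

lemma ten_one_left {m n : ℕ} (a : CircuitClass n) :
    ten (1 : CircuitClass m) a = pl m 0 (by omega) a := by
  apply eq_of_sigma
  rw [sigma_pl, sigma_zero, mul_one, sigma_mul]

lemma ten_eq {m n : ℕ} (a : CircuitClass m) (b : CircuitClass n) :
    ten a b = pl 0 n (by omega) a * pl m 0 (by omega) b := by
  rw [← ten_one_left, ← ten_one_right, ← ten_mul, mul_one, one_mul]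

/-- Both gates are rewritten over the same division of the wires into blocks of sizes `i`, `k`, `q`,
`k'`, `r'`, where `q` is the gap between them. Bifunctoriality then multiplies block by block. -/
lemma pl_comm {k k' n : ℕ} {i r i' r' : ℕ} (h : i + k + r = n) (h' : i' + k' + r' = n)
    (hi : i + k ≤ i') (a : CircuitClass k) (b : CircuitClass k') :
    Commute (pl i r h a) (pl i' r' h' b) := by
  obtain ⟨q, rfl⟩ := Nat.exists_eq_add_of_le hi
  have ha : pl i r h a = castHom (show i + k + q + k' + r' = n by omega)
      (ten (ten (ten (ten 1 a) 1) 1) 1) := by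
    apply eq_castHom_of_sigma
    obtain rfl : r = q + k' + r' := by omega
    simp only [sigma_pl, ← sigma_one_mul_one, ← sigma_mul, mul_assoc]
  have hb : pl (i + k + q) r' h' b = castHom (show i + k + q + k' + r' = n by omega)
      (ten (ten (ten (ten 1 1) 1) b) 1) := by
    apply eq_castHom_of_sigma
    simp only [sigma_pl, ← sigma_one_mul_one, ← sigma_mul, mul_assoc]
  rw [ha, hb, Commute, SemiconjBy, ← map_mul, ← map_mul]
  simp only [← ten_mul, one_mul, mul_one]

/-- The class of the symmetry. -/
def sym (m n : ℕ) : CircuitClass (m + n) := mk (Circuit.symm m n)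

/-- The class of the gate `ω`. -/
def w : CircuitClass 0 := mk omega
/-- The class of the gate `X`. -/
def gX : CircuitClass 1 := mk X
/-- The class of the gate `T`. -/
def gT : CircuitClass 1 := mk T
/-- The class of the gate `CNOT`. -/
def gC : CircuitClass 2 := mk CNOT
/-- The class of the gate `SWAP`. -/
def gS : CircuitClass 2 := mk SWAP

lemma sym_sym (m n : ℕ) : sym m n * castHom (Nat.add_comm n m) (sym n m) = 1 := by
  have := mk_eq_mk.2 (Derivable.symm_symm m n)
  rwa [mk_seq, mk_cast, mk_wires] at this

lemma ten_mul_sym {m n : ℕ} (a : CircuitClass m) (b : CircuitClass n) :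
    ten a b * sym m n = sym m n * castHom (Nat.add_comm n m) (ten b a) := by
  obtain ⟨C, rfl⟩ := mk_surjective a
  obtain ⟨D, rfl⟩ := mk_surjective b
  have := mk_eq_mk.2 (Derivable.naturality C D)
  rwa [mk_seq, mk_seq, mk_cast] at this

lemma sym_zero (m : ℕ) : sym m 0 = 1 := by
  have := mk_eq_mk.2 (Derivable.symm_zero m)
  rwa [mk_cast] at this

lemma sym_add (m n k : ℕ) (h : m + (n + k) = m + n + k) :
    castHom h (sym m (n + k)) =
      pl 0 k (by omega) (sym m n) * pl n 0 (by omega) (sym m k) := by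
  have := mk_eq_mk.2 (Derivable.hexagon m n k)
  rw [mk_cast, mk_seq, mk_tensor, mk_cast, mk_tensor, mk_wires, mk_wires, ten_one_left,
    ten_one_right, castHom_pl] at this
  exact this

lemma gX_sq : gX * gX = 1 := by
  have := mk_eq_mk.2 (Derivable.rel .R1)
  rwa [mk_pow, pow_two] at this

lemma gC_sq : gC * gC = 1 := by
  have := mk_eq_mk.2 (Derivable.rel .R4)
  rwa [mk_pow, pow_two] at this

lemma gS_sq : gS * gS = 1 := sym_sym 1 1

lemma gT_pow : gT ^ 8 = 1 := by
  have := mk_eq_mk.2 (Derivable.rel .R7)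
  rwa [mk_pow] at this

lemma w_pow : w ^ 8 = 1 := by
  have := mk_eq_mk.2 (Derivable.rel .R10)
  rwa [mk_pow] at this

/-! ### The group of circuit classes and its action on basis states -/

/-- The gates have finite order by `R1`, `R4`, `R7` and `R10`, symmetries are inverted by
symmetries, and invertibility passes to both compositions. -/
lemma exists_inverse {n : ℕ} (a : CircuitClass n) : ∃ b, a * b = 1 ∧ b * a = 1 := by
  obtain ⟨C, rfl⟩ := mk_surjective a
  induction C with
  | wires n => exact ⟨1, one_mul 1, one_mul 1⟩
  | seq C D hC hD =>
    obtain ⟨c, hc, hc'⟩ := hC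
    obtain ⟨d, hd, hd'⟩ := hD
    refine ⟨d * c, ?_, ?_⟩
    · rw [mk_seq, mul_assoc, ← mul_assoc _ d, hd, one_mul, hc]
    · rw [mk_seq, mul_assoc, ← mul_assoc c, hc', one_mul, hd']
  | tensor C D hC hD =>
    obtain ⟨c, hc, hc'⟩ := hC
    obtain ⟨d, hd, hd'⟩ := hD
    refine ⟨ten c d, ?_, ?_⟩
    · rw [mk_tensor, ← ten_mul, hc, hd, ten_one]
    · rw [mk_tensor, ← ten_mul, hc', hd', ten_one]
  | symm m n =>
    refine ⟨castHom (Nat.add_comm n m) (sym n m), sym_sym m n, ?_⟩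
    have := congrArg (castHom (Nat.add_comm n m)) (sym_sym n m)
    rwa [map_mul, map_one, castHom_castHom, castHom_rfl] at this
  | omega => exact ⟨w ^ 7, (pow_succ' w 7).symm.trans w_pow, (pow_succ w 7).symm.trans w_pow⟩
  | X => exact ⟨gX, gX_sq, gX_sq⟩
  | T => exact ⟨gT ^ 7, (pow_succ' gT 7).symm.trans gT_pow, (pow_succ gT 7).symm.trans gT_pow⟩
  | CNOT => exact ⟨gC, gC_sq, gC_sq⟩

noncomputable instance (n : ℕ) : Group (CircuitClass n) where
  inv a := (exists_inverse a).choose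
  inv_mul_cancel a := (exists_inverse a).choose_spec.2

/-- The permutation of the basis states induced by a class of circuits. -/
def act {n : ℕ} (a : CircuitClass n) : (Fin n → Fin 2) → (Fin n → Fin 2) :=
  Quotient.lift Circuit.act (fun _ _ h => funext fun x => (h.sound x).1) a

/-- The exponent of `ω` in the phase that a class of circuits applies to a basis state. -/
def phase {n : ℕ} (a : CircuitClass n) : (Fin n → Fin 2) → ZMod 8 :=
  Quotient.lift Circuit.phase (fun _ _ h => funext fun x => (h.sound x).2) a

lemma act_mul {n : ℕ} (a b : CircuitClass n) (x : Fin n → Fin 2) :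
    act (a * b) x = act b (act a x) := by
  obtain ⟨C, rfl⟩ := mk_surjective a
  obtain ⟨D, rfl⟩ := mk_surjective b
  rfl

lemma phase_mul {n : ℕ} (a b : CircuitClass n) (x : Fin n → Fin 2) :
    phase (a * b) x = phase a x + phase b (act a x) := by
  obtain ⟨C, rfl⟩ := mk_surjective a
  obtain ⟨D, rfl⟩ := mk_surjective b
  rfl

@[simp] lemma act_one {n : ℕ} (x : Fin n → Fin 2) : act 1 x = x := rfl

@[simp] lemma phase_one {n : ℕ} (x : Fin n → Fin 2) : phase 1 x = 0 := rfl

@[simp] lemma act_act_inv {n : ℕ} (a : CircuitClass n) (x : Fin n → Fin 2) :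
    act a (act a⁻¹ x) = x := by rw [← act_mul, inv_mul_cancel, act_one]

@[simp] lemma act_inv_act {n : ℕ} (a : CircuitClass n) (x : Fin n → Fin 2) :
    act a⁻¹ (act a x) = x := by rw [← act_mul, mul_inv_cancel, act_one]

lemma act_ten {m n : ℕ} (a : CircuitClass m) (b : CircuitClass n) (x : Fin (m + n) → Fin 2)
    (i : Fin (m + n)) : act (ten a b) x i =
      if h : (i : ℕ) < m then act a (fun j => x ⟨j, by omega⟩) ⟨i, h⟩
      else act b (fun j => x ⟨m + j, by omega⟩) ⟨i - m, by omega⟩ := by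
  obtain ⟨C, rfl⟩ := mk_surjective a
  obtain ⟨D, rfl⟩ := mk_surjective b
  exact act_tensor C D x i

lemma phase_ten {m n : ℕ} (a : CircuitClass m) (b : CircuitClass n) (x : Fin (m + n) → Fin 2) :
    phase (ten a b) x =
      phase a (fun i => x (Fin.castAdd n i)) + phase b (fun i => x (Fin.natAdd m i)) := by
  obtain ⟨C, rfl⟩ := mk_surjective a
  obtain ⟨D, rfl⟩ := mk_surjective b
  rfl

lemma act_pl {k n : ℕ} (i r : ℕ) (h : i + k + r = n) (g : CircuitClass k) (x : Fin n → Fin 2)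
    (j : Fin n) : act (pl i r h g) x j =
      if h' : i ≤ (j : ℕ) ∧ (j : ℕ) < i + k then
        act g (fun t => x ⟨i + t, by omega⟩) ⟨j - i, by omega⟩
      else x j := by
  subst h
  change act (ten (ten 1 g) 1) x j = _
  rw [act_ten]
  split_ifs with h1 h2 h2
  · rw [act_ten, dif_neg (by simp only; omega)]
  · rw [act_ten, dif_pos (by simp only; omega)]; rfl
  · omega
  · rw [act_one]; congr 1; ext; simp only; omega

lemma phase_pl {k n : ℕ} (i r : ℕ) (h : i + k + r = n) (g : CircuitClass k) (x : Fin n → Fin 2) :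
    phase (pl i r h g) x = phase g (fun t => x ⟨i + t, by omega⟩) := by
  subst h
  change phase (ten (ten 1 g) 1) x = _
  rw [phase_ten, phase_ten, phase_one, phase_one, zero_add, add_zero]
  rfl

/-- The class `g` on the wires `i, …, i + k - 1`. -/
def on {k n : ℕ} (i : ℕ) (h : i + k ≤ n) : CircuitClass k →* CircuitClass n :=
  pl i (n - (i + k)) (by omega)

lemma pl_eq_on {k n : ℕ} (i r : ℕ) (h : i + k + r = n) (g : CircuitClass k) :
    pl i r h g = on i (by omega) g := pl_congr _ _ rfl _

lemma on_on {k m n : ℕ} {i j : ℕ} (h : i + m ≤ n) (h' : j + k ≤ m) (g : CircuitClass k) :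
    on i h (on j h' g) = on (i + j) (by omega) g :=
  (pl_pl _ _ _ _ _ _ g).trans (pl_congr _ _ rfl _)

lemma on_congr {k n : ℕ} {i i' : ℕ} (hi : i = i') (h : i + k ≤ n) (g : CircuitClass k) :
    on i h g = on i' (hi ▸ h) g := by subst hi; rfl

lemma on_comm {k k' n : ℕ} {i i' : ℕ} (h : i + k ≤ n) (h' : i' + k' ≤ n)
    (hi : i + k ≤ i') (a : CircuitClass k) (b : CircuitClass k') :
    Commute (on i h a) (on i' h' b) := pl_comm _ _ hi a b

lemma on_self {n : ℕ} (h : 0 + n ≤ n) (g : CircuitClass n) : on 0 h g = g :=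
  (pl_congr _ (by omega) rfl g).trans (pl_self (by omega) g)

lemma ten_eq_on {m n : ℕ} (a : CircuitClass m) (b : CircuitClass n) :
    ten a b = on 0 (by omega) a * on m (by omega) b := by
  rw [ten_eq, pl_eq_on, pl_eq_on]

lemma ten_one_eq_on {m n : ℕ} (a : CircuitClass m) :
    ten a (1 : CircuitClass n) = on 0 (by omega) a := by
  rw [ten_one_right, pl_eq_on]

lemma one_ten_eq_on {m n : ℕ} (a : CircuitClass n) :
    ten (1 : CircuitClass m) a = on m (by omega) a := by
  rw [ten_one_left, pl_eq_on]

lemma castHom_on {k n m : ℕ} (i : ℕ) (h : i + k ≤ n) (h' : n = m) (g : CircuitClass k) :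
    castHom h' (on i h g) = on i (h' ▸ h) g := by subst h'; rfl

lemma castHom_eq_on {n m : ℕ} (h' : n = m) (g : CircuitClass n) :
    castHom h' g = on 0 (by omega) g := by subst h'; exact (on_self _ g).symm

lemma mk_place {k : ℕ} (n i : ℕ) (g : Circuit k) (h : i + k ≤ n) :
    mk (place n i g h) = on i h (mk g) := by
  rw [place, mk_cast, mk_tensor, mk_tensor]; rfl

lemma act_on {k n : ℕ} (i : ℕ) (h : i + k ≤ n) (g : CircuitClass k) (x : Fin n → Fin 2)
    (j : Fin n) : act (on i h g) x j =
      if h' : i ≤ (j : ℕ) ∧ (j : ℕ) < i + k then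
        act g (fun t => x ⟨i + t, by omega⟩) ⟨j - i, by omega⟩
      else x j := act_pl _ _ _ g x j

lemma phase_on {k n : ℕ} (i : ℕ) (h : i + k ≤ n) (g : CircuitClass k) (x : Fin n → Fin 2) :
    phase (on i h g) x = phase g (fun t => x ⟨i + t, by omega⟩) := phase_pl _ _ _ g x

end CircuitClass

/-! ### The calculus of SWAP and CNOT on three wires -/

/-- The relations between SWAP and CNOT gates on three consecutive wires. -/
structure StairRelations {G : Type*} [Group G] (s₀ s₁ c₀ c₁ : G) : Prop where
  ss₀ : s₀ * s₀ = 1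
  ss₁ : s₁ * s₁ = 1
  cc₀ : c₀ * c₀ = 1
  cc₁ : c₁ * c₁ = 1
  braid : s₁ * s₀ * s₁ = s₀ * s₁ * s₀
  slide : c₁ * s₀ * s₁ = s₀ * s₁ * c₀
  long : s₁ * c₀ * s₁ = c₁ * c₀ * c₁ * c₀

lemma pow_fin_two_add {G : Type*} [Group G] {c : G} (h : c * c = 1) (e f : Fin 2) :
    c ^ ((e + f : Fin 2) : ℕ) = c ^ (e : ℕ) * c ^ (f : ℕ) := by
  fin_cases e <;> fin_cases f <;> simp [h]

lemma mul_self_cancel_left {G : Type*} [Group G] {a : G} (h : a * a = 1) (b : G) :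
    a * (a * b) = b := by rw [← mul_assoc, h, one_mul]

namespace StairRelations

variable {G : Type*} [Group G] {s₀ s₁ c₀ c₁ : G}

lemma long_symm (R : StairRelations s₀ s₁ c₀ c₁) : s₁ * c₀ * s₁ = c₀ * c₁ * c₀ * c₁ := by
  have h := congrArg (·⁻¹) R.long
  simp only [mul_inv_rev, inv_eq_of_mul_eq_one_right R.ss₁, inv_eq_of_mul_eq_one_right R.cc₀,
    inv_eq_of_mul_eq_one_right R.cc₁] at h
  simpa only [mul_assoc] using h

/-- The gate `s₁ * c₀ * s₁` is the CNOT from the first to the third wire. It equals both alternating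
words of length four in `c₀` and `c₁`, and `c₀ * (c₁ * c₀ * c₁ * c₀)` and `(c₀ * c₁ * c₀ * c₁) * c₀`
are the same word. The same argument proves `comm₁`. -/
lemma comm₀ (R : StairRelations s₀ s₁ c₀ c₁) : Commute c₀ (s₁ * c₀ * s₁) := by
  rw [Commute, SemiconjBy]
  nth_rw 1 [R.long]
  rw [R.long_symm]
  simp only [mul_assoc]

lemma comm₁ (R : StairRelations s₀ s₁ c₀ c₁) : Commute c₁ (s₁ * c₀ * s₁) := by
  rw [Commute, SemiconjBy]
  nth_rw 2 [R.long]
  rw [R.long_symm]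
  simp only [mul_assoc]

lemma swap₁₀ (R : StairRelations s₀ s₁ c₀ c₁) : c₁ * c₀ = c₀ * c₁ * (s₁ * c₀ * s₁) := by
  rw [R.long]
  simp only [mul_assoc, mul_self_cancel_left R.cc₀, mul_self_cancel_left R.cc₁]

lemma swap₀₁ (R : StairRelations s₀ s₁ c₀ c₁) : c₀ * c₁ = c₁ * c₀ * (s₁ * c₀ * s₁) := by
  rw [R.long_symm]
  simp only [mul_assoc, mul_self_cancel_left R.cc₀, mul_self_cancel_left R.cc₁]

lemma slide_symm (R : StairRelations s₀ s₁ c₀ c₁) : s₁ * s₀ * c₁ = c₀ * s₁ * s₀ := by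
  have h := congrArg (·⁻¹) R.slide
  simp only [mul_inv_rev, inv_eq_of_mul_eq_one_right R.ss₁, inv_eq_of_mul_eq_one_right R.cc₀,
    inv_eq_of_mul_eq_one_right R.ss₀, inv_eq_of_mul_eq_one_right R.cc₁] at h
  simpa only [mul_assoc] using h

/-- Conjugating `CNOT₁,₂` by `SWAP₀,₁` and `CNOT₀,₁` by `SWAP₁,₂` gives the same gate. -/
lemma conj_eq (R : StairRelations s₀ s₁ c₀ c₁) : s₀ * c₁ * s₀ = s₁ * c₀ * s₁ := by
  have h := R.slide_symm
  have h2 : s₁ * (s₁ * s₀ * c₁) * s₀ = s₁ * (c₀ * s₁ * s₀) * s₀ := by rw [h]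
  simpa only [mul_assoc, mul_self_cancel_left R.ss₁, R.ss₀, mul_one] using h2

lemma s₀_c₁ (R : StairRelations s₀ s₁ c₀ c₁) : SemiconjBy s₀ c₁ (s₁ * c₀ * s₁) := by
  rw [SemiconjBy, ← R.conj_eq]; simp only [mul_assoc, R.ss₀, mul_one]

lemma s₁_c₀ (R : StairRelations s₀ s₁ c₀ c₁) : SemiconjBy s₁ c₀ (s₁ * c₀ * s₁) := by
  rw [SemiconjBy]; simp only [mul_assoc, R.ss₁, mul_one]

lemma s₀_long (R : StairRelations s₀ s₁ c₀ c₁) : SemiconjBy s₀ (s₁ * c₀ * s₁) c₁ := by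
  rw [SemiconjBy, ← R.conj_eq]; simp only [mul_assoc, mul_self_cancel_left R.ss₀]

lemma s₁_long (R : StairRelations s₀ s₁ c₀ c₁) : SemiconjBy s₁ (s₁ * c₀ * s₁) c₀ := by
  rw [SemiconjBy]; simp only [mul_assoc, mul_self_cancel_left R.ss₁]

/-- Moving the second CNOT to the left past `s₀` turns it into the long gate `s₁ * c₀ * s₁`, which
shares its control with `c₀` and commutes with it. After the braid relation, `s₁` exchanges the two
gates, and so the two degrees are interchanged. -/
theorem desc_swap (R : StairRelations s₀ s₁ c₀ c₁) (f f' : ℕ) :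
    (c₀ ^ f * s₀) * (c₁ ^ f' * s₁) * s₀ = s₁ * ((c₀ ^ f' * s₀) * (c₁ ^ f * s₁)) := by
  calc (c₀ ^ f * s₀) * (c₁ ^ f' * s₁) * s₀ = c₀ ^ f * (s₀ * c₁ ^ f') * s₁ * s₀ := by
        simp only [mul_assoc]
    _ = (s₁ * c₀ * s₁) ^ f' * c₀ ^ f * (s₀ * s₁ * s₀) := by
        rw [(R.s₀_c₁.pow_right f').eq, ← mul_assoc (c₀ ^ f), (R.comm₀.pow_pow f f').eq]
        simp only [mul_assoc]
    _ = (s₁ * c₀ * s₁) ^ f' * (s₁ * ((s₁ * c₀ * s₁) ^ f)) * s₀ * s₁ := by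
        rw [← R.braid, (R.s₁_long.pow_right f).eq]; simp only [mul_assoc]
    _ = (s₁ * c₀ ^ f') * (s₀ * c₁ ^ f) * s₁ := by
        rw [(R.s₁_c₀.pow_right f').eq, (R.s₀_c₁.pow_right f).eq]; simp only [mul_assoc]
    _ = _ := by simp only [mul_assoc]

/-- The CNOT slides through the SWAPs to become `c₁`. Moving it to the front past `c₀ ^ f` creates
`f` copies of the long gate by `swap₀₁`, and these merge with the `f'` copies contributed by the
second step. -/
theorem desc_cnot (R : StairRelations s₀ s₁ c₀ c₁) (f f' : Fin 2) :
    (c₀ ^ (f : ℕ) * s₀) * (c₁ ^ (f' : ℕ) * s₁) * c₀ =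
      c₁ * ((c₀ ^ (f : ℕ) * s₀) * (c₁ ^ ((f + f' : Fin 2) : ℕ) * s₁)) := by
  have h : c₀ ^ (f : ℕ) * c₁ = c₁ * (c₀ ^ (f : ℕ) * (s₁ * c₀ * s₁) ^ (f : ℕ)) := by
    fin_cases f
    · simp
    · simpa [mul_assoc] using R.swap₀₁
  calc (c₀ ^ (f : ℕ) * s₀) * (c₁ ^ (f' : ℕ) * s₁) * c₀
      = c₀ ^ (f : ℕ) * (s₀ * c₁ ^ (f' : ℕ)) * s₁ * c₀ := by simp only [mul_assoc]
    _ = c₀ ^ (f : ℕ) * (s₁ * c₀ * s₁) ^ (f' : ℕ) * (s₀ * s₁ * c₀) := by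
        rw [(R.s₀_c₁.pow_right _).eq]; simp only [mul_assoc]
    _ = (c₀ ^ (f : ℕ) * c₁) * (s₁ * c₀ * s₁) ^ (f' : ℕ) * (s₀ * s₁) := by
        rw [← R.slide, mul_assoc (c₀ ^ (f : ℕ)) c₁, (R.comm₁.pow_right _).eq]
        simp only [mul_assoc]
    _ = c₁ * (c₀ ^ (f : ℕ) * ((s₁ * c₀ * s₁) ^ (f : ℕ) * (s₁ * c₀ * s₁) ^ (f' : ℕ) * s₀)) * s₁ := by
        rw [h]; simp only [mul_assoc]
    _ = c₁ * (c₀ ^ (f : ℕ) * (s₀ * c₁ ^ ((f + f' : Fin 2) : ℕ))) * s₁ := by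
        rw [pow_fin_two_add R.cc₁, ((R.s₀_c₁.pow_right _).mul_right (R.s₀_c₁.pow_right _)).eq]
    _ = _ := by simp only [mul_assoc]

/-- The mirror image of `desc_swap`: the two commuting gates are now `c₁` and the long gate, which
share their target and are exchanged by `s₀`. -/
theorem asc_swap (R : StairRelations s₀ s₁ c₀ c₁) (e e' : ℕ) :
    (c₁ ^ e * s₁) * (c₀ ^ e' * s₀) * s₁ = s₀ * ((c₁ ^ e' * s₁) * (c₀ ^ e * s₀)) := by
  calc (c₁ ^ e * s₁) * (c₀ ^ e' * s₀) * s₁ = c₁ ^ e * (s₁ * c₀ ^ e') * s₀ * s₁ := by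
        simp only [mul_assoc]
    _ = (s₁ * c₀ * s₁) ^ e' * c₁ ^ e * (s₁ * s₀ * s₁) := by
        rw [(R.s₁_c₀.pow_right e').eq, ← mul_assoc (c₁ ^ e), (R.comm₁.pow_pow e e').eq]
        simp only [mul_assoc]
    _ = (s₁ * c₀ * s₁) ^ e' * (s₀ * ((s₁ * c₀ * s₁) ^ e)) * s₁ * s₀ := by
        rw [R.braid, (R.s₀_long.pow_right e).eq]; simp only [mul_assoc]
    _ = (s₀ * c₁ ^ e') * (s₁ * c₀ ^ e) * s₀ := by
        rw [(R.s₀_c₁.pow_right e').eq, (R.s₁_c₀.pow_right e).eq]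
        simp only [← mul_assoc]
    _ = _ := by simp only [mul_assoc]

theorem asc_cnot (R : StairRelations s₀ s₁ c₀ c₁) (e e' : Fin 2) :
    (c₁ ^ (e : ℕ) * s₁) * (c₀ ^ (e' : ℕ) * s₀) * c₁ =
      c₀ * ((c₁ ^ (e : ℕ) * s₁) * (c₀ ^ ((e + e' : Fin 2) : ℕ) * s₀)) := by
  have h : c₁ ^ (e : ℕ) * c₀ = c₀ * (c₁ ^ (e : ℕ) * (s₁ * c₀ * s₁) ^ (e : ℕ)) := by
    fin_cases e
    · simp
    · simpa [mul_assoc] using R.swap₁₀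
  calc (c₁ ^ (e : ℕ) * s₁) * (c₀ ^ (e' : ℕ) * s₀) * c₁
      = c₁ ^ (e : ℕ) * (s₁ * c₀ ^ (e' : ℕ)) * s₀ * c₁ := by simp only [mul_assoc]
    _ = c₁ ^ (e : ℕ) * (s₁ * c₀ * s₁) ^ (e' : ℕ) * (s₁ * s₀ * c₁) := by
        rw [(R.s₁_c₀.pow_right _).eq]; simp only [mul_assoc]
    _ = (c₁ ^ (e : ℕ) * c₀) * (s₁ * c₀ * s₁) ^ (e' : ℕ) * (s₁ * s₀) := by
        rw [R.slide_symm, mul_assoc (c₁ ^ (e : ℕ)) c₀, (R.comm₀.pow_right _).eq]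
        simp only [mul_assoc]
    _ = c₀ * (c₁ ^ (e : ℕ) * ((s₁ * c₀ * s₁) ^ (e : ℕ) * (s₁ * c₀ * s₁) ^ (e' : ℕ) * s₁)) * s₀ := by
        rw [h]; simp only [mul_assoc]
    _ = c₀ * (c₁ ^ (e : ℕ) * (s₁ * c₀ ^ ((e + e' : Fin 2) : ℕ))) * s₀ := by
        rw [pow_fin_two_add R.cc₀, ((R.s₁_c₀.pow_right _).mul_right (R.s₁_c₀.pow_right _)).eq]
    _ = _ := by simp only [mul_assoc]

/-- Moving an upside-down CNOT gate on the lower two wires past a descending stair step. -/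
theorem desc_reverse (R : StairRelations s₀ s₁ c₀ c₁) (f : Fin 2) :
    (c₀ ^ (f : ℕ) * s₀) * (s₁ * c₁ * s₁) =
      (s₁ * (s₀ * c₀ * s₀) * s₁) * (s₁ * c₁ * s₁) ^ (f : ℕ) * (c₀ ^ (f : ℕ) * s₀) := by
  -- Conjugation by this cyclic shift of the wires carries `c₁` to `c₀`, `c₀` to the CNOT from the
  -- third to the first wire, and the long gate to the CNOT from the third to the second wire. The
  -- relations `swap₁₀` and `comm₁` thereby become the required relations for upside-down gates.
  have conj : ∀ a b, s₁ * s₀ * (a * b) * (s₀ * s₁) =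
      (s₁ * s₀ * a * (s₀ * s₁)) * (s₁ * s₀ * b * (s₀ * s₁)) := by
    intro a b
    simp only [mul_assoc, mul_self_cancel_left R.ss₁, mul_self_cancel_left R.ss₀]
  have h1 : s₁ * s₀ * c₁ * (s₀ * s₁) = c₀ := by
    rw [R.slide_symm]
    simp only [mul_assoc, mul_self_cancel_left R.ss₀, R.ss₁, mul_one]
  have h0 : s₁ * s₀ * c₀ * (s₀ * s₁) = s₁ * (s₀ * c₀ * s₀) * s₁ := by simp only [mul_assoc]
  have h01 : s₀ * (s₁ * c₁ * s₁) * s₀ = s₁ * (s₀ * c₀ * s₀) * s₁ := by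
    have : c₁ = s₀ * (s₁ * c₀ * s₁) * s₀ := by
      rw [← R.conj_eq]; simp only [mul_assoc, mul_self_cancel_left R.ss₀, R.ss₀, mul_one]
    calc s₀ * (s₁ * c₁ * s₁) * s₀ = (s₀ * s₁ * s₀) * s₁ * c₀ * s₁ * (s₀ * s₁ * s₀) := by
          conv_lhs => rw [this]
          simp only [mul_assoc]
      _ = _ := by
          rw [← R.braid]
          simp only [mul_assoc, mul_self_cancel_left R.ss₁]
  have h2 : s₁ * s₀ * (s₁ * c₀ * s₁) * (s₀ * s₁) = s₁ * c₁ * s₁ := by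
    rw [← R.conj_eq]; simp only [mul_assoc, mul_self_cancel_left R.ss₀]
  have e1 := congrArg (fun g => s₁ * s₀ * g * (s₀ * s₁)) R.swap₁₀
  have e2 := congrArg (fun g => s₁ * s₀ * g * (s₀ * s₁)) R.comm₁.eq
  simp only [conj c₁ c₀, conj (c₀ * c₁), conj c₀ c₁, conj c₁ (s₁ * c₀ * s₁),
    conj (s₁ * c₀ * s₁) c₁, h2, h0, h1] at e1 e2
  have h3 : s₀ * (s₁ * c₁ * s₁) = (s₁ * (s₀ * c₀ * s₀) * s₁) * s₀ := by
    rw [← h01]; simp only [mul_assoc, R.ss₀, mul_one]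
  have h4 : c₀ ^ (f : ℕ) * (s₁ * (s₀ * c₀ * s₀) * s₁) =
      (s₁ * (s₀ * c₀ * s₀) * s₁) * (s₁ * c₁ * s₁) ^ (f : ℕ) * c₀ ^ (f : ℕ) := by
    generalize s₁ * (s₀ * c₀ * s₀) * s₁ = p at *
    generalize s₁ * c₁ * s₁ = q at *
    fin_cases f
    · simp
    · change c₀ ^ 1 * p = p * q ^ 1 * c₀ ^ 1
      rw [pow_one, pow_one, e1, mul_assoc, e2, mul_assoc]
  rw [mul_assoc, h3, ← mul_assoc, h4, mul_assoc]

end StairRelations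

/-! ### Ladder decomposition of SWAP and CNOT circuits -/

namespace CircuitClass

lemma sym_one_two : sym 1 2 = on 0 (by omega) gS * on 1 (by omega) gS := by
  have := sym_add 1 1 1 rfl
  rwa [castHom_rfl, pl_eq_on, pl_eq_on] at this

lemma slide_on (g : CircuitClass 2) :
    (on 1 (by omega) g * on 0 (by omega) gS * on 1 (by omega) gS : CircuitClass 3) =
      on 0 (by omega) gS * on 1 (by omega) gS * on 0 (by omega) g := by
  have := ten_mul_sym (1 : CircuitClass 1) g
  rw [castHom_rfl, one_ten_eq_on, ten_one_eq_on, sym_one_two, ← mul_assoc] at this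
  exact this

lemma gS_eq : gS = gC * gS * gC * gS * gC := mk_eq_mk.2 (.rel .R5)

lemma mk_onPair {n : ℕ} (i j : Fin n) (h : i < j) (g : Circuit 2) :
    mk (onPair i j h g) = on (i + 1) (by omega) (sym (j - i - 1) 1) * on i (by omega) (mk g) *
      on (i + 1) (by omega) (sym 1 (j - i - 1)) := by
  rw [onPair, mk_seq, mk_seq, mk_place, mk_place, mk_place]; rfl

lemma stairRelations_three : StairRelations (G := CircuitClass 3) (on 0 (by omega) gS)
    (on 1 (by omega) gS) (on 0 (by omega) gC) (on 1 (by omega) gC) where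
  ss₀ := by rw [← map_mul, gS_sq, map_one]
  ss₁ := by rw [← map_mul, gS_sq, map_one]
  cc₀ := by rw [← map_mul, gC_sq, map_one]
  cc₁ := by rw [← map_mul, gC_sq, map_one]
  braid := slide_on gS
  slide := slide_on gC
  long := by
    have := mk_eq_mk.2 (Derivable.rel .R6)
    rw [mk_onPair] at this
    simp only [mk_seq, mk_tensor, mk_wires, one_ten_eq_on, ten_one_eq_on] at this
    exact this

lemma stairRelations_on {n : ℕ} (i : ℕ) (h : i + 3 ≤ n) :
    StairRelations (G := CircuitClass n) (on i (by omega) gS)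
      (on (i + 1) (by omega) gS) (on i (by omega) gC) (on (i + 1) (by omega) gC) := by
  have R := stairRelations_three
  have e : ∀ (j : ℕ) (hj : j + 2 ≤ 3) (g : CircuitClass 2),
      (on (i + j) (by omega) g : CircuitClass n) = on i h (on j hj g) :=
    fun j hj g => (on_on _ _ _).symm
  have e0 := e 0 (by omega)
  have e1 := e 1 (by omega)
  simp only [add_zero] at e0
  simp only [e0, e1]
  constructor
  · rw [← map_mul, R.ss₀, map_one]
  · rw [← map_mul, R.ss₁, map_one]
  · rw [← map_mul, R.cc₀, map_one]
  · rw [← map_mul, R.cc₁, map_one]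
  · simp only [← map_mul, R.braid]
  · simp only [← map_mul, R.slide]
  · simp only [← map_mul, R.long]

lemma mul_comm_left_of_eq {G : Type*} [Group G] {d x y g g' z : G} (key : x * y * g = g' * z)
    (comm : d * g' = g' * d) : d * x * y * g = g' * (d * z) := by
  rw [← mul_assoc, ← comm, mul_assoc d, mul_assoc d, mul_assoc d, key]

lemma mul_comm_right_of_eq {G : Type*} [Group G] {d x y g g' z : G} (key : x * y * g = g' * z)
    (comm : d * g = g * d) : x * y * d * g = g' * (z * d) := by
  rw [mul_assoc _ d, comm, ← mul_assoc, key, mul_assoc]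

/-- The class of a stair step. -/
noncomputable def stair (e : Fin 2) : CircuitClass 2 := gC ^ (e : ℕ) * gS

/-- The class of a descending stair. -/
noncomputable def desc : (m : ℕ) → (Fin m → Fin 2) → CircuitClass (m + 1)
  | 0, _ => 1
  | m + 1, e =>
      on 0 (by omega) (desc m fun i => e i.castSucc) * on m (by omega) (stair (e (Fin.last m)))

/-- The class of an ascending stair. -/
noncomputable def asc : (m : ℕ) → (Fin m → Fin 2) → CircuitClass (m + 1)
  | 0, _ => 1
  | m + 1, e =>
      on m (by omega) (stair (e (Fin.last m))) * on 0 (by omega) (asc m fun i => e i.castSucc)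

/-- The class of the CNOT gate with the control on the lower wire. -/
noncomputable def gR : CircuitClass 2 := gS * gC * gS

/-- The classes of SWAP and CNOT gates. -/
noncomputable def linGates : Set (CircuitClass 2) := {gS, gC}

/-- The classes of circuits that consist of SWAP and CNOT gates on adjacent wires. -/
noncomputable def Lin (n : ℕ) : Submonoid (CircuitClass n) :=
  Submonoid.closure {a | ∃ (i : ℕ) (h : i + 2 ≤ n), ∃ g ∈ linGates, a = on i h g}

/-- The classes of circuits that consist of SWAP and CNOT gates on adjacent wires below the top
wire and CNOT gates from the second wire to the top wire. -/
noncomputable def TopFixing (n : ℕ) : Submonoid (CircuitClass (n + 1)) :=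
  Submonoid.closure ({a | ∃ (i : ℕ) (h : i + 1 + 2 ≤ n + 1), ∃ g ∈ linGates, a = on (i + 1) h g} ∪
    {a | ∃ h : 0 + 2 ≤ n + 1, a = on 0 h gR})

/-- This is `R5` with a CNOT cancelled at both ends. -/
lemma gS_gC_gS : gS * gC * gS = gC * gS * gC := by
  have h := gS_eq
  have : gC * gS * gC = gC * (gC * gS * gC * gS * gC) * gC := by rw [← h]
  rw [this]
  simp only [mul_assoc, mul_self_cancel_left gC_sq, gC_sq, mul_one]

/-- A CNOT behind a descending stair is traded for one more step of degree 1, at the price of an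
upside-down CNOT that can be carried to the front of the stair. -/
lemma gC_eq_gR_mul : gC = gR * stair 1 := by
  rw [gR, gS_gC_gS, stair, Fin.val_one, pow_one]
  simp only [mul_assoc, mul_self_cancel_left gC_sq, gS_sq, mul_one]

lemma stair_zero : stair 0 = gS := by simp [stair]

lemma stair_one : stair 1 = gC * gS := by simp [stair]

lemma gS_gC : gS * gC = gR * gS := by
  rw [gR]; simp only [mul_assoc, gS_sq, mul_one]

lemma on_mem_lin {n : ℕ} {i : ℕ} (h : i + 2 ≤ n) {g : CircuitClass 2} (hg : g ∈ linGates) :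
    on i h g ∈ Lin n := Submonoid.subset_closure ⟨i, h, g, hg, rfl⟩

lemma on_lin {k n : ℕ} {i : ℕ} (h : i + k ≤ n) {a : CircuitClass k} (ha : a ∈ Lin k) :
    on i h a ∈ Lin n := by
  induction ha using Submonoid.closure_induction with
  | mem x hx =>
    obtain ⟨j, hj, g, hg, rfl⟩ := hx
    rw [on_on]; exact on_mem_lin _ hg
  | one => rw [map_one]; exact one_mem _
  | mul x y _ _ hx hy => rw [map_mul]; exact mul_mem hx hy

lemma on_mem_topFixing {n : ℕ} {i : ℕ} (h : i + 2 ≤ n + 1) (hi : 0 < i) {g : CircuitClass 2}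
    (hg : g ∈ linGates) : on i h g ∈ TopFixing n := by
  obtain ⟨i, rfl⟩ := Nat.exists_eq_succ_of_ne_zero hi.ne'
  exact Submonoid.subset_closure (Or.inl ⟨i, h, g, hg, rfl⟩)

lemma on_gR_mem_topFixing {n : ℕ} {i : ℕ} (h : i + 2 ≤ n + 1) : on i h gR ∈ TopFixing n := by
  rcases Nat.eq_zero_or_pos i with rfl | hi
  · exact Submonoid.subset_closure (Or.inr ⟨h, rfl⟩)
  · rw [gR, map_mul, map_mul]
    exact mul_mem (mul_mem (on_mem_topFixing h hi (Or.inl rfl))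
      (on_mem_topFixing h hi (Or.inr rfl)))
      (on_mem_topFixing h hi (Or.inl rfl))

lemma desc_snoc (m : ℕ) (f : Fin m → Fin 2) (e : Fin 2) :
    desc (m + 1) (Fin.snoc (α := fun _ => Fin 2) f e) =
      on 0 (by omega) (desc m f) * on m (by omega) (stair e) := by
  simp only [desc, Fin.snoc_castSucc, Fin.snoc_last]

lemma asc_snoc (m : ℕ) (f : Fin m → Fin 2) (e : Fin 2) :
    asc (m + 1) (Fin.snoc (α := fun _ => Fin 2) f e) =
      on m (by omega) (stair e) * on 0 (by omega) (asc m f) := by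
  simp only [asc, Fin.snoc_castSucc, Fin.snoc_last]

lemma on_zero_desc_mul_stair {n d : ℕ} (h : 0 + (d + 1) ≤ n) (h' : d + 2 ≤ n)
    (f : Fin d → Fin 2) (e : Fin 2) :
    on 0 h (desc d f) * on d h' (stair e) =
      on 0 (by omega) (desc (d + 1) (Fin.snoc (α := fun _ => Fin 2) f e)) := by
  rw [desc_snoc, map_mul, on_on, on_on, on_congr (Nat.zero_add d)]

lemma desc_cons (m : ℕ) (f : Fin (m + 1) → Fin 2) :
    desc (m + 1) f =
      on 0 (by omega) (stair (f 0)) * on 1 (by omega) (desc m fun i => f i.succ) := by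
  induction m with
  | zero => simp [desc]
  | succ m ih =>
    rw [desc, ih, desc, map_mul, map_mul, on_on, on_on, on_on, on_on, mul_assoc,
      on_congr (Nat.add_comm 1 m)]
    rfl

lemma asc_cons (m : ℕ) (f : Fin (m + 1) → Fin 2) :
    asc (m + 1) f =
      on 1 (by omega) (asc m fun i => f i.succ) * on 0 (by omega) (stair (f 0)) := by
  induction m with
  | zero => simp [asc]
  | succ m ih =>
    rw [asc, ih, asc, map_mul, map_mul, on_on, on_on, on_on, on_on, ← mul_assoc,
      on_congr (Nat.add_comm 1 m)]
    rfl

/-- The only generator of `p` that meets the stair step is the upside-down CNOT from wire 2 to wire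
1. By `desc_reverse` it becomes the CNOT from wire 2 to wire 0, followed by a CNOT from wire 2 to
wire 1 if `e = 1`. None of these is controlled by the top wire, and all lie in `TopFixing`. -/
lemma stair_mul_topFixing {n : ℕ} (e : Fin 2) {p : CircuitClass (n + 1)} (hp : p ∈ TopFixing n) :
    ∃ p' ∈ TopFixing (n + 1), on 0 (by omega) (stair e) * on 1 (by omega) p =
      p' * on 0 (Nat.le_add_left 2 n) (stair e) := by
  induction hp using Submonoid.closure_induction with
  | mem x hx =>
    rcases hx with ⟨i, h, g, hg, rfl⟩ | ⟨h, rfl⟩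
    · refine ⟨on (1 + (i + 1)) (by omega) g, on_mem_topFixing _ (by omega) hg, ?_⟩
      rw [on_on]
      exact (on_comm _ _ (by omega) _ _).eq
    · have R := stairRelations_on (n := n + 1 + 1) 0 (by omega)
      have e2 := R.desc_reverse e
      have h1 : on (0 + 1) (by omega) gS ∈ TopFixing (n + 1) :=
        on_mem_topFixing (by omega) (by omega) (Or.inl rfl)
      have h2 : on (0 + 1) (by omega) gC ∈ TopFixing (n + 1) :=
        on_mem_topFixing (by omega) (by omega) (Or.inr rfl)
      have h3 : on 0 (by omega) gR ∈ TopFixing (n + 1) := on_gR_mem_topFixing (by omega)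
      rw [gR, map_mul, map_mul] at h3
      refine ⟨_, mul_mem (mul_mem (mul_mem h1 h3) h1) (pow_mem (mul_mem (mul_mem h1 h2) h1) e), ?_⟩
      rw [on_on, gR, stair]
      simp only [map_mul, map_pow]
      exact e2
  | one => exact ⟨1, one_mem _, by rw [map_one, mul_one, one_mul]⟩
  | mul x y _ _ hx hy =>
    obtain ⟨x', hx', ex⟩ := hx
    obtain ⟨y', hy', ey⟩ := hy
    exact ⟨x' * y', mul_mem hx' hy', by rw [map_mul, ← mul_assoc, ex, mul_assoc, ey, mul_assoc]⟩

/-- Induction on the stair with its top step split off: the gate first passes the remaining steps,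
becoming a top-fixing circuit on the wires below the top one, and `stair_mul_topFixing` then carries
that circuit past the top step. -/
lemma desc_mul_gR_aux (d : ℕ) (f : Fin d → Fin 2) :
    ∃ p ∈ TopFixing (d + 1), on 0 (by omega) (desc d f) * on d (by omega) gR =
      p * on 0 (by omega) (desc d f) := by
  induction d with
  | zero => exact ⟨on 0 (by omega) gR, on_gR_mem_topFixing _, by simp [desc]⟩
  | succ d ih =>
    obtain ⟨p, hp, e⟩ := ih (fun i => f i.succ)
    obtain ⟨p', hp', e'⟩ := stair_mul_topFixing (f 0) hp
    refine ⟨p', hp', ?_⟩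
    have e2 := congrArg (on (n := d + 1 + 1 + 1) 1 (by omega)) e
    rw [map_mul, map_mul, on_on, on_on, on_congr (Nat.add_comm 1 d)] at e2
    rw [desc_cons, map_mul, on_on, on_on, mul_assoc]
    simp only [zero_add, add_zero] at e2 ⊢
    rw [e2, ← mul_assoc, e', mul_assoc]

lemma on_topFixing {k n : ℕ} (h : 0 + (k + 1) ≤ n + 1) {p : CircuitClass (k + 1)}
    (hp : p ∈ TopFixing k) : on 0 h p ∈ TopFixing n := by
  induction hp using Submonoid.closure_induction with
  | mem x hx =>
    rcases hx with ⟨i, h, g, hg, rfl⟩ | ⟨h, rfl⟩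
    · rw [on_on]; exact on_mem_topFixing _ (by omega) hg
    · rw [on_on]; exact on_gR_mem_topFixing _
  | one => rw [map_one]; exact one_mem _
  | mul x y _ _ hx hy => rw [map_mul]; exact mul_mem hx hy

lemma desc_mul_gR {n d : ℕ} (h : d + 2 ≤ n + 1) (f : Fin d → Fin 2) :
    ∃ p ∈ TopFixing n, on 0 (by omega) (desc d f) * on d h gR = p * on 0 (by omega) (desc d f) := by
  obtain ⟨p, hp, e⟩ := desc_mul_gR_aux d f
  refine ⟨on 0 (by omega) p, on_topFixing (by omega) hp, ?_⟩
  have e2 := congrArg (on (n := n + 1) 0 (by omega)) e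
  rw [map_mul, map_mul, on_on, on_on, on_congr (Nat.zero_add d)] at e2
  exact e2

/-- The gate commutes with the steps further down and meets two consecutive steps, where `desc_swap`
or `desc_cnot` applies. It emerges one wire lower, disjoint from the steps above, because a
descending stair shifts the wires it passes up by one. -/
lemma desc_mul_inner (d : ℕ) (f : Fin d → Fin 2) (i : ℕ) (h : i + 2 ≤ d) {g : CircuitClass 2}
    (hg : g ∈ linGates) :
    ∃ f', desc d f * on i (by omega) g = on (i + 1) (by omega) g * desc d f' := by
  induction d with
  | zero => omega
  | succ d ih =>
    by_cases hd : i + 2 ≤ d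
    · obtain ⟨f', e⟩ := ih (fun j => f j.castSucc) hd
      refine ⟨Fin.snoc (α := fun _ => Fin 2) f' (f (Fin.last d)), ?_⟩
      have e2 := congrArg (on (n := d + 1 + 1) 0 (by omega)) e
      rw [map_mul, map_mul, on_on, on_on, on_congr (Nat.zero_add i),
        on_congr (Nat.zero_add (i + 1))] at e2
      rw [desc_snoc, desc, mul_assoc, ← (on_comm _ _ hd g _).eq, ← mul_assoc, e2, mul_assoc]
    · obtain ⟨d, rfl⟩ : ∃ k, d = k + 1 := ⟨d - 1, by omega⟩
      obtain rfl : i = d := by omega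
      have R := stairRelations_on (n := i + 1 + 1 + 1) i (by omega)
      have comm : on 0 (by omega) (desc i fun j => f j.castSucc.castSucc) * on (i + 1) (by omega) g =
          on (i + 1) (by omega) g *
            on (n := i + 1 + 1 + 1) 0 (by omega) (desc i fun j => f j.castSucc.castSucc) :=
        (on_comm _ _ (by omega) _ _).eq
      have key : ∃ a b, on i (by omega) (stair (f (Fin.last i).castSucc)) *
          on (i + 1) (by omega) (stair (f (Fin.last _))) * on i (by omega) g =
          on (n := i + 1 + 1 + 1) (i + 1) (by omega) g *
            (on i (by omega) (stair a) * on (i + 1) (by omega) (stair b)) := by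
        simp only [stair, map_mul, map_pow]
        rcases hg with rfl | rfl
        · exact ⟨_, _, R.desc_swap _ _⟩
        · exact ⟨_, _, R.desc_cnot _ _⟩
      obtain ⟨a, b, key⟩ := key
      refine ⟨Fin.snoc (α := fun _ => Fin 2)
        (Fin.snoc (α := fun _ => Fin 2) (fun j => f j.castSucc.castSucc) a) b, ?_⟩
      rw [desc_snoc, desc_snoc, desc, desc, map_mul, map_mul, on_on, on_on, on_on]
      simp only [add_zero, zero_add]
      rw [mul_comm_left_of_eq key comm, ← mul_assoc (on 0 _ _)]

/-- A descending stair followed by a gate is a circuit that fixes the top wire followed by a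
descending stair. -/
theorem desc_mul_gate {n d : ℕ} (h : d ≤ n) (f : Fin d → Fin 2) {i : ℕ} (hi : i + 2 ≤ n + 1)
    {g : CircuitClass 2} (hg : g ∈ linGates) :
    ∃ p ∈ TopFixing n, ∃ (d' : ℕ) (h' : d' ≤ n) (f' : Fin d' → Fin 2),
      on 0 (by omega) (desc d f) * on i hi g = p * on 0 (by omega) (desc d' f') := by
  have hC : ∀ {d : ℕ} (h : d + 2 ≤ n + 1) (f : Fin d → Fin 2), ∃ p ∈ TopFixing n,
      on 0 (by omega) (desc d f) * on d h gC =
        p * on 0 (by omega) (desc (d + 1) (Fin.snoc (α := fun _ => Fin 2) f 1)) := by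
    intro d h f
    obtain ⟨p, hp, e⟩ := desc_mul_gR h f
    refine ⟨p, hp, ?_⟩
    rw [gC_eq_gR_mul, map_mul, ← mul_assoc, e, mul_assoc, on_zero_desc_mul_stair]
  -- The gate can lie inside the stair, on its last step, at its open end, or entirely below it.
  rcases lt_trichotomy i d with hid | rfl | hid
  · by_cases hid' : i + 2 ≤ d
    · obtain ⟨f', e⟩ := desc_mul_inner d f i hid' hg
      have e2 := congrArg (on (n := n + 1) 0 (by omega)) e
      rw [map_mul, map_mul, on_on, on_on, on_congr (Nat.zero_add i),
        on_congr (Nat.zero_add (i + 1))] at e2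
      exact ⟨_, on_mem_topFixing _ (by omega) hg, d, h, f', e2⟩
    · obtain rfl : d = i + 1 := by omega
      obtain ⟨f, e, rfl⟩ : ∃ (f₀ : Fin i → Fin 2) (e : Fin 2),
          f = Fin.snoc (α := fun _ => Fin 2) f₀ e :=
        ⟨fun j => f j.castSucc, f (Fin.last i), (Fin.snoc_init_self (α := fun _ => Fin 2) f).symm⟩
      simp only [← on_zero_desc_mul_stair (n := n + 1) (d := i) (by omega) (by omega) f e]
      rw [mul_assoc, ← map_mul]
      -- The last step followed by a gate is `1`, `gC`, `gR * gS` or `gR`. The stair loses its last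
      -- step or keeps its length, and each upside-down CNOT is carried to the front by
      -- `desc_mul_gR`.
      rcases hg with rfl | rfl
      · fin_cases e
        · refine ⟨1, one_mem _, i, by omega, f, ?_⟩
          change _ * on i hi (stair 0 * gS) = _
          rw [stair_zero, gS_sq, map_one, mul_one, one_mul]
        · obtain ⟨p, hp, e⟩ := hC hi f
          refine ⟨p, hp, i + 1, h, Fin.snoc (α := fun _ => Fin 2) f 1, ?_⟩
          change _ * on i hi (stair 1 * gS) = _
          rw [stair_one, mul_assoc, gS_sq, mul_one, e]
      · obtain ⟨p, hp, e'⟩ := desc_mul_gR hi f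
        fin_cases e
        · refine ⟨p, hp, i + 1, h, Fin.snoc (α := fun _ => Fin 2) f 0, ?_⟩
          change _ * on i hi (stair 0 * gC) = _
          rw [stair_zero, gS_gC, map_mul, ← mul_assoc, e', ← stair_zero, mul_assoc,
            on_zero_desc_mul_stair]
        · refine ⟨p, hp, i, by omega, f, ?_⟩
          change _ * on i hi (stair 1 * gC) = _
          rw [stair_one, ← gS_gC_gS, ← e']; rfl
  · rcases hg with rfl | rfl
    · refine ⟨1, one_mem _, i + 1, by omega, Fin.snoc (α := fun _ => Fin 2) f 0, ?_⟩
      rw [one_mul, ← on_zero_desc_mul_stair (by omega) hi, stair_zero]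
    · obtain ⟨p, hp, e⟩ := hC hi f
      exact ⟨p, hp, i + 1, by omega, _, e⟩
  · exact ⟨_, on_mem_topFixing hi (by omega) hg, d, h, f, (on_comm _ _ (by omega) _ _).eq⟩

/-- An ascending stair shifts all wires but the bottom one down by one, so a gate below the top wire
emerges in front one wire higher, clear of the bottom wire. -/
lemma asc_mul_inner (n : ℕ) (f : Fin n → Fin 2) (i : ℕ) (h : i + 1 + 2 ≤ n + 1)
    {g : CircuitClass 2} (hg : g ∈ linGates) :
    ∃ f', asc n f * on (i + 1) h g = on i (by omega) g * asc n f' := by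
  induction n with
  | zero => omega
  | succ d ih =>
    by_cases hd : i + 1 + 2 ≤ d + 1
    · obtain ⟨f', e⟩ := ih (fun j => f j.castSucc) hd
      refine ⟨Fin.snoc (α := fun _ => Fin 2) f' (f (Fin.last d)), ?_⟩
      have e2 := congrArg (on (n := d + 1 + 1) 0 (by omega)) e
      rw [map_mul, map_mul, on_on, on_on, on_congr (Nat.zero_add i),
        on_congr (Nat.zero_add (i + 1))] at e2
      rw [asc_snoc, asc, mul_assoc, e2, ← mul_assoc, ← mul_assoc,
        (on_comm _ _ (by omega : i + 2 ≤ d) g _).eq]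
    · obtain ⟨d, rfl⟩ : ∃ k, d = k + 1 := ⟨d - 1, by omega⟩
      obtain rfl : i = d := by omega
      have R := stairRelations_on (n := i + 1 + 1 + 1) i (by omega)
      have comm : on 0 (by omega) (asc i fun j => f j.castSucc.castSucc) * on (i + 1) (by omega) g =
          on (i + 1) (by omega) g *
            on (n := i + 1 + 1 + 1) 0 (by omega) (asc i fun j => f j.castSucc.castSucc) :=
        (on_comm _ _ (by omega) _ _).eq
      have key : ∃ a b, on (i + 1) (by omega) (stair (f (Fin.last _))) *
          on i (by omega) (stair (f (Fin.last i).castSucc)) * on (i + 1) (by omega) g =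
          on (n := i + 1 + 1 + 1) i (by omega) g *
            (on (i + 1) (by omega) (stair b) * on i (by omega) (stair a)) := by
        simp only [stair, map_mul, map_pow]
        rcases hg with rfl | rfl
        · exact ⟨_, _, R.asc_swap _ _⟩
        · exact ⟨_, _, R.asc_cnot _ _⟩
      obtain ⟨a, b, key⟩ := key
      refine ⟨Fin.snoc (α := fun _ => Fin 2)
        (Fin.snoc (α := fun _ => Fin 2) (fun j => f j.castSucc.castSucc) a) b, ?_⟩
      rw [asc_snoc, asc_snoc, asc, asc, map_mul, map_mul, on_on, on_on, on_on]
      simp only [add_zero, zero_add]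
      rw [← mul_assoc, mul_comm_right_of_eq key comm, mul_assoc (on (i + 1) _ _)]

/-- The SWAP of the step cancels against the first SWAP of `gR`. This is how the last, topmost step
of an ascending stair absorbs the generator of `TopFixing` that touches the top wire. -/
lemma stair_mul_gR (e : Fin 2) : stair e * gR = stair (e + 1) := by
  rw [stair, stair, gR, pow_fin_two_add gC_sq, Fin.val_one, pow_one]
  simp only [mul_assoc, mul_self_cancel_left gS_sq]

/-- An ascending stair followed by a circuit that fixes the top wire is a circuit on all but the
bottom wire followed by an ascending stair. -/
theorem asc_mul_topFixing {n : ℕ} (f : Fin n → Fin 2) {p : CircuitClass (n + 1)}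
    (hp : p ∈ TopFixing n) : ∃ a ∈ Lin n, ∃ f', asc n f * p = ten a 1 * asc n f' := by
  induction hp using Submonoid.closure_induction generalizing f with
  | mem x hx =>
    rcases hx with ⟨i, h, g, hg, rfl⟩ | ⟨h, rfl⟩
    · obtain ⟨f', e⟩ := asc_mul_inner n f i h hg
      refine ⟨on i (by omega) g, on_mem_lin _ hg, f', ?_⟩
      rw [e, ten_one_eq_on, on_on, on_congr (Nat.zero_add i)]
    · obtain ⟨n, rfl⟩ : ∃ k, n = k + 1 := ⟨n - 1, by omega⟩
      refine ⟨1, one_mem _, Fin.cons (α := fun _ => Fin 2) (f 0 + 1) (fun i => f i.succ), ?_⟩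
      rw [asc_cons, asc_cons, mul_assoc, ← map_mul, stair_mul_gR, ten_one, one_mul]
      rfl
  | one => exact ⟨1, one_mem _, f, by rw [ten_one, one_mul, mul_one]⟩
  | mul x y _ _ hx hy =>
    obtain ⟨a, ha, f', e⟩ := hx f
    obtain ⟨b, hb, f'', e'⟩ := hy f'
    refine ⟨a * b, mul_mem ha hb, f'', ?_⟩
    rw [← mul_assoc, e, mul_assoc, e', ← mul_assoc, ← ten_mul, mul_one]

lemma asc_zero_mul_desc_zero (n : ℕ) : asc n 0 * desc n 0 = 1 := by
  induction n with
  | zero => exact mul_one 1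
  | succ n ih =>
    change on n _ (stair 0) * on 0 _ (asc n 0) * (on 0 _ (desc n 0) * on n _ (stair 0)) = 1
    rw [mul_assoc, ← mul_assoc (on 0 _ _), ← map_mul, ih, map_one, one_mul, ← map_mul, stair_zero,
      gS_sq, map_one]

/-- A circuit of SWAP and CNOT gates is a circuit on all but the bottom wire followed by a
ladder. -/
theorem exists_ladder {n : ℕ} {a : CircuitClass (n + 1)} (ha : a ∈ Lin (n + 1)) :
    ∃ b ∈ Lin n, ∃ (e : Fin n → Fin 2) (d : ℕ) (h : d ≤ n) (f : Fin d → Fin 2),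
      a = ten b 1 * (asc n e * on 0 (by omega) (desc d f)) := by
  induction ha using Submonoid.closure_induction_right with
  | one =>
    -- The identity is the ladder that goes all the way up and all the way down with plain SWAPs.
    refine ⟨1, one_mem _, 0, n, le_rfl, 0, ?_⟩
    rw [on_self, asc_zero_mul_desc_zero, ten_one, mul_one]
  | mul_right x hx y hy ih =>
    obtain ⟨i, hi, g, hg, rfl⟩ := hy
    obtain ⟨b, hb, e, d, h, f, rfl⟩ := ih
    obtain ⟨p, hp, d', h', f', E⟩ := desc_mul_gate h f hi hg
    obtain ⟨c, hc, e', E'⟩ := asc_mul_topFixing e hp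
    refine ⟨b * c, mul_mem hb hc, e', d', h', f', ?_⟩
    rw [mul_assoc, mul_assoc, E, ← mul_assoc (asc n e), E', ← mul_one (1 : CircuitClass 1), ten_mul]
    simp only [mul_assoc, mul_one]

/-- The class of a ladder. -/
noncomputable def ladder {m : ℕ} (L : Ladder m) : CircuitClass (m + 1) :=
  asc m L.asc * on 0 (by omega) (desc L.steps L.desc)

/-- The class of a sequence of ladders of increasing size. -/
noncomputable def ladderSeq : (n : ℕ) → ((i : Fin n) → Ladder i) → CircuitClass n
  | 0, _ => 1
  | n + 1, L => ten (ladderSeq n fun i => L i.castSucc) 1 * ladder (L (Fin.last n))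

theorem exists_ladderSeq {n : ℕ} {a : CircuitClass n} (ha : a ∈ Lin n) :
    ∃ L, a = ladderSeq n L := by
  induction n with
  | zero =>
    refine ⟨fun i => i.elim0, ?_⟩
    induction ha using Submonoid.closure_induction with
    | mem x hx => obtain ⟨i, h, _⟩ := hx; omega
    | one => rfl
    | mul x y _ _ hx hy => rw [hx, hy]; exact one_mul 1
  | succ n ih =>
    obtain ⟨b, hb, e, d, h, f, rfl⟩ := exists_ladder ha
    obtain ⟨L, rfl⟩ := ih hb
    let L' : Ladder n := ⟨e, ⟨d, by omega⟩, f⟩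
    refine ⟨Fin.snoc (α := fun i => Ladder i) L L', ?_⟩
    rw [ladderSeq]
    simp only [Fin.snoc_castSucc, Fin.snoc_last]
    rfl

lemma mk_stairStep (e : Fin 2) : mk (stairStep e) = stair e := by
  rw [stairStep, mk_seq, mk_pow]; rfl

lemma mk_descendingStair (m : ℕ) (f : Fin m → Fin 2) : mk (descendingStair m f) = desc m f := by
  induction m with
  | zero => rfl
  | succ m ih =>
    rw [descendingStair, mk_seq, mk_tensor, mk_tensor, ih, mk_stairStep, mk_wires, mk_wires,
      ten_one_eq_on, one_ten_eq_on]; rfl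

lemma mk_ascendingStair (m : ℕ) (f : Fin m → Fin 2) : mk (ascendingStair m f) = asc m f := by
  induction m with
  | zero => rfl
  | succ m ih =>
    rw [ascendingStair, mk_seq, mk_tensor, mk_tensor, ih, mk_stairStep, mk_wires, mk_wires,
      ten_one_eq_on, one_ten_eq_on]; rfl

lemma mk_ladder {m : ℕ} (L : Ladder m) : mk L.circuit = ladder L := by
  rw [Ladder.circuit, mk_seq, mk_cast, mk_tensor, mk_ascendingStair, mk_descendingStair, mk_wires,
    ten_one_eq_on, castHom_on]; rfl

lemma mk_ladders (n : ℕ) (L : (i : Fin n) → Ladder i) : mk (ladders n L) = ladderSeq n L := by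
  induction n with
  | zero => rfl
  | succ n ih => rw [ladders, mk_seq, mk_tensor, ih, mk_ladder]; rfl

/-! ### Recovering the ladders from the linear map -/

lemma act_gS (x : Fin 2 → Fin 2) : act gS x = ![x 1, x 0] := by
  change (Circuit.symm 1 1).act x = _
  ext i; fin_cases i <;> simp [act_symm]

lemma act_gC (x : Fin 2 → Fin 2) : act gC x = ![x 0, x 0 + x 1] := rfl

lemma act_gX (x : Fin 1 → Fin 2) : act gX x = fun _ => x 0 + 1 := rfl

lemma act_gT (x : Fin 1 → Fin 2) : act gT x = x := rfl

lemma act_stair (e : Fin 2) (x : Fin 2 → Fin 2) : act (stair e) x = ![e * x 0 + x 1, x 0] := by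
  rw [stair, act_mul, act_gS]
  fin_cases e
  · simp
  · simp [act_gC]

lemma act_bijective {n : ℕ} (a : CircuitClass n) : Function.Bijective (act a) :=
  ⟨Function.LeftInverse.injective (act_inv_act a), Function.RightInverse.surjective (act_act_inv a)⟩

lemma act_lin_add {n : ℕ} {a : CircuitClass n} (ha : a ∈ Lin n) (x y : Fin n → Fin 2) :
    act a (x + y) = act a x + act a y := by
  induction ha using Submonoid.closure_induction generalizing x y with
  | mem a ha =>
    obtain ⟨i, h, g, hg, rfl⟩ := ha
    ext j : 1
    simp only [Pi.add_apply, act_on]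
    split_ifs with h'
    · have key : ∀ x y : Fin 2 → Fin 2, act g (fun t => x t + y t) = act g x + act g y := by
        rcases hg with rfl | rfl
        · intro x y; rw [act_gS, act_gS, act_gS]; ext i; fin_cases i <;> rfl
        · intro x y; rw [act_gC, act_gC, act_gC]; ext i; fin_cases i
          · rfl
          · simp; ring_nf
      exact congrFun (key _ _) _
    · rfl
  | one => rfl
  | mul a b _ _ ha hb => rw [act_mul, act_mul, act_mul, ha, hb]

lemma act_lin_zero {n : ℕ} {a : CircuitClass n} (ha : a ∈ Lin n) : act a 0 = 0 := by
  have := act_lin_add ha 0 0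
  simpa using this

lemma act_on_two {n i : ℕ} (h : i + 2 ≤ n) (g : CircuitClass 2) (x : Fin n → Fin 2) (j : Fin n) :
    act (on i h g) x j =
      if (j : ℕ) = i then act g ![x ⟨i, by omega⟩, x ⟨i + 1, by omega⟩] 0
      else if (j : ℕ) = i + 1 then act g ![x ⟨i, by omega⟩, x ⟨i + 1, by omega⟩] 1
      else x j := by
  have e : (fun t : Fin 2 => x ⟨i + t, by omega⟩) = ![x ⟨i, by omega⟩, x ⟨i + 1, by omega⟩] := by
    ext t; fin_cases t <;> rfl
  rw [act_on]
  split_ifs with h1 h2 h3 h3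
  · rw [e]; congr 1; ext; simp; omega
  · rw [e]; congr 1; ext; simp; omega
  · omega
  · omega
  · omega
  · rfl

/-- The degrees of an ascending stair are the coefficients of a linear form in the new top bit,
while the other bits are only shifted. -/
lemma act_asc (n : ℕ) (e : Fin n → Fin 2) (x : Fin (n + 1) → Fin 2) :
    act (asc n e) x = Fin.cons (α := fun _ => Fin 2) (x (Fin.last n) + ∑ i, e i * x i.castSucc)
      (fun i => x i.castSucc) := by
  induction n with
  | zero =>
    ext j : 1
    obtain rfl : j = 0 := Fin.ext (by omega)
    simp [asc]
  | succ n ih =>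
    ext j : 1
    rw [asc, act_mul, act_on]
    induction j using Fin.cases with
    | zero =>
      rw [dif_pos (by simp), ih]
      simp [act_on_two, act_stair, Fin.sum_univ_castSucc (n := n)]
      rw [Finset.sum_congr rfl (g := fun i => e i.castSucc * x i.castSucc.castSucc)]
      · simp only [Fin.last, Fin.castSucc_mk]; ring
      · intro i _
        rw [if_neg (by omega), if_neg (by omega)]; rfl
    | succ i =>
      simp only [Fin.cons_succ]
      split_ifs with h'
      · rw [ih]
        obtain ⟨k, rfl⟩ : ∃ k : Fin n, i = k.castSucc := ⟨⟨i, by simp at h'; omega⟩, rfl⟩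
        have : (⟨(k.castSucc.succ : Fin (n + 1 + 1)) - 0, by simp⟩ : Fin (n + 1)) = k.succ := rfl
        rw [this, Fin.cons_succ, act_on_two, if_neg (by simp; omega), if_neg (by simp; omega)]
        simp only [Nat.zero_add]; rfl
      · obtain rfl : i = Fin.last n := by ext; simp at h' ⊢; omega
        rw [act_on_two, if_neg (by simp), if_pos (by simp), act_stair]
        rfl

/-- The basis vector with index `k`. -/
def unitVec (n k : ℕ) : Fin n → Fin 2 := fun j => if (j : ℕ) = k then 1 else 0

lemma unitVec_offset_zero {k n : ℕ} (h : 0 + k ≤ n) :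
    (fun t : Fin k => unitVec n 0 ⟨0 + t, by omega⟩) = unitVec k 0 := by
  ext t; simp [unitVec]

/-- The formula on exactly `d + 1` wires is a hypothesis so that the lemma can serve inside the
induction that proves that formula. -/
lemma act_on_desc_of {n d : ℕ} (h : 0 + (d + 1) ≤ n) (f : Fin d → Fin 2)
    (hf : ∀ j, act (desc d f) (unitVec (d + 1) 0) j = if h : (j : ℕ) < d then f ⟨j, h⟩ else 1)
    (j : Fin n) :
    act (on 0 h (desc d f)) (unitVec n 0) j =
      if h : (j : ℕ) < d then f ⟨j, h⟩ else if (j : ℕ) = d then 1 else 0 := by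
  rw [act_on, unitVec_offset_zero (by omega)]
  simp only [hf, Nat.sub_zero, unitVec]
  split_ifs <;> omega

lemma act_desc_unitVec (d : ℕ) (f : Fin d → Fin 2) (j : Fin (d + 1)) :
    act (desc d f) (unitVec (d + 1) 0) j = if h : (j : ℕ) < d then f ⟨j, h⟩ else 1 := by
  induction d with
  | zero =>
    obtain rfl : j = 0 := Fin.ext (by omega)
    simp [desc, unitVec]
  | succ d ih =>
    rw [show desc (d + 1) f = on 0 (by omega) (desc d fun i => f i.castSucc) *
      on d (by omega) (stair (f (Fin.last d))) from rfl, act_mul, act_on_two, act_stair]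
    simp only [act_on_desc_of _ _ (ih fun i => f i.castSucc)]
    have hj := j.2
    by_cases h1 : (j : ℕ) = d
    · rw [if_pos h1, dif_pos (by omega : (j : ℕ) < d + 1),
        show (⟨j, by omega⟩ : Fin (d + 1)) = Fin.last d from Fin.ext h1]
      simp
    · by_cases h2 : (j : ℕ) = d + 1
      · rw [if_neg h1, if_pos h2, dif_neg (by omega : ¬ (j : ℕ) < d + 1)]
        simp
      · rw [if_neg h1, if_neg h2, dif_pos (by omega : (j : ℕ) < d),
          dif_pos (by omega : (j : ℕ) < d + 1)]
        rfl

lemma act_on_desc_unitVec {n d : ℕ} (h : 0 + (d + 1) ≤ n) (f : Fin d → Fin 2) (j : Fin n) :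
    act (on 0 h (desc d f)) (unitVec n 0) j =
      if h : (j : ℕ) < d then f ⟨j, h⟩ else if (j : ℕ) = d then 1 else 0 :=
  act_on_desc_of h f (act_desc_unitVec d f) j

lemma stair_mem_lin (e : Fin 2) : stair e ∈ Lin 2 := by
  have h : ∀ g ∈ linGates, g ∈ Lin 2 := fun g hg => by
    rw [← on_self (by omega) g]; exact on_mem_lin _ hg
  exact mul_mem (pow_mem (h _ (Or.inr rfl)) _) (h _ (Or.inl rfl))

lemma asc_mem_lin (n : ℕ) (e : Fin n → Fin 2) : asc n e ∈ Lin (n + 1) := by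
  induction n with
  | zero => exact one_mem _
  | succ n ih => exact mul_mem (on_lin _ (stair_mem_lin _)) (on_lin _ (ih _))

lemma desc_mem_lin (n : ℕ) (e : Fin n → Fin 2) : desc n e ∈ Lin (n + 1) := by
  induction n with
  | zero => exact one_mem _
  | succ n ih => exact mul_mem (on_lin _ (ih _)) (on_lin _ (stair_mem_lin _))

lemma ladder_mem_lin {m : ℕ} (L : Ladder m) : ladder L ∈ Lin (m + 1) :=
  mul_mem (asc_mem_lin _ _) (on_lin _ (desc_mem_lin _ _))

lemma ladderSeq_mem_lin (n : ℕ) (L : (i : Fin n) → Ladder i) : ladderSeq n L ∈ Lin n := by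
  induction n with
  | zero => exact one_mem _
  | succ n ih =>
    rw [ladderSeq, ten_one_eq_on]
    exact mul_mem (on_lin _ (ih _)) (ladder_mem_lin _)

lemma act_ten_one_castSucc {n : ℕ} (a : CircuitClass n) (x : Fin (n + 1) → Fin 2) (j : Fin n) :
    act (ten a 1) x j.castSucc = act a (fun i => x i.castSucc) j := by
  rw [act_ten, dif_pos (by simp)]; rfl

lemma act_ten_one_last {n : ℕ} (a : CircuitClass n) (x : Fin (n + 1) → Fin 2) :
    act (ten a 1) x (Fin.last n) = x (Fin.last n) := by
  rw [act_ten, dif_neg (by simp), act_one]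
  congr 1; ext; simp

/-- The last basis vector is fixed by `ten a 1` and sent to the top one by the ascending stair, so
its final image is `f` followed by a 1 and zeros: the last nonzero entry gives `d`, the earlier ones
`f`. Once the descending stair is cancelled, the lower output bits give `a` and the top bit gives
`e`. -/
lemma act_ten_ladder_injective {n : ℕ} {a b : CircuitClass n} (ha : a ∈ Lin n) (hb : b ∈ Lin n)
    {L M : Ladder n} (h : act (ten a 1 * ladder L) = act (ten b 1 * ladder M)) :
    act a = act b ∧ L = M := by
  obtain ⟨e, ⟨d, hd⟩, f⟩ := L
  obtain ⟨e', ⟨d', hd'⟩, f'⟩ := M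
  have last : ∀ {a : CircuitClass n} (ha : a ∈ Lin n) (e : Fin n → Fin 2),
      act (asc n e) (act (ten a 1) (unitVec (n + 1) n)) = unitVec (n + 1) 0 := by
    intro a ha e
    have h0 : (fun i : Fin n => unitVec (n + 1) n i.castSucc) = 0 := by
      ext i; simp [unitVec]; omega
    rw [act_asc]
    ext j : 1
    induction j using Fin.cases with
    | zero =>
      simp only [act_ten_one_castSucc, act_ten_one_last, h0, act_lin_zero ha, Fin.cons_zero]
      simp [unitVec]
    | succ i =>
      simp only [act_ten_one_castSucc, h0, act_lin_zero ha, Fin.cons_succ]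
      simp [unitVec]
  have hv : ∀ j : Fin (n + 1),
      (if h : (j : ℕ) < d then f ⟨j, h⟩ else if (j : ℕ) = d then 1 else 0) =
      (if h : (j : ℕ) < d' then f' ⟨j, h⟩ else if (j : ℕ) = d' then 1 else 0) := by
    intro j
    have := congrFun (congrFun h (unitVec (n + 1) n)) j
    rw [act_mul, act_mul, ladder, ladder, act_mul, act_mul, last ha, last hb,
      act_on_desc_unitVec, act_on_desc_unitVec] at this
    exact this
  obtain rfl : d = d' := by
    rcases lt_trichotomy d d' with hlt | heq | hlt
    · have := hv ⟨d', hd'⟩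
      simp [hlt.not_gt, hlt.ne'] at this
    · exact heq
    · have := hv ⟨d, hd⟩
      simp [hlt.not_gt, hlt.ne'] at this
  obtain rfl : f = f' := by
    ext1 i
    have := hv ⟨i, by have := i.2; simp only at this; omega⟩
    simpa using this
  have h' : ∀ x, act (asc n e) (act (ten a 1) x) = act (asc n e') (act (ten b 1) x) := by
    intro x
    have := congrFun h x
    rw [act_mul, act_mul, ladder, ladder, act_mul, act_mul] at this
    exact (act_bijective _).1 this
  have hab : act a = act b := by
    ext1 x
    have := h' (Fin.snoc (α := fun _ => Fin 2) x 0)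
    rw [act_asc, act_asc] at this
    ext1 j
    have := congrFun this j.succ
    simpa [act_ten_one_castSucc] using this
  refine ⟨hab, ?_⟩
  obtain rfl : e = e' := by
    ext1 i
    -- On this input the ascending stair receives the `i`-th basis vector, so the top output bit is
    -- `e i`.
    obtain ⟨z, hz⟩ := (act_bijective a).2 (Pi.single i 1)
    have := h' (Fin.snoc (α := fun _ => Fin 2) z 0)
    rw [act_asc, act_asc] at this
    have := congrFun this 0
    simpa [act_ten_one_castSucc, act_ten_one_last, ← hab, hz, Pi.single_apply] using this
  rfl

theorem act_ladderSeq_injective {n : ℕ} {L M : (i : Fin n) → Ladder i}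
    (h : act (ladderSeq n L) = act (ladderSeq n M)) : L = M := by
  induction n with
  | zero => ext1 i; exact i.elim0
  | succ n ih =>
    rw [ladderSeq, ladderSeq] at h
    obtain ⟨h1, h2⟩ := act_ten_ladder_injective (ladderSeq_mem_lin _ _) (ladderSeq_mem_lin _ _) h
    have h3 := ih h1
    ext1 i
    induction i using Fin.lastCases with
    | last => exact h2
    | cast i => exact congrFun h3 i

/-! ### Symmetries, X gates and affine circuits -/

lemma sym_one_mem_lin (n : ℕ) : sym 1 n ∈ Lin (1 + n) := by
  induction n with
  | zero => rw [sym_zero]; exact one_mem _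
  | succ n ih =>
    have := sym_add 1 n 1 rfl
    rw [castHom_rfl, pl_eq_on, pl_eq_on] at this
    rw [this]
    refine mul_mem (on_lin _ ih) ?_
    exact on_mem_lin _ (Or.inl rfl)

lemma inv_mem_of_closure {G : Type*} [Group G] {s : Set G} (hs : ∀ g ∈ s, g * g = 1) {a : G}
    (ha : a ∈ Submonoid.closure s) : a⁻¹ ∈ Submonoid.closure s := by
  induction ha using Submonoid.closure_induction with
  | mem x hx => rw [inv_eq_of_mul_eq_one_right (hs x hx)]; exact Submonoid.subset_closure hx
  | one => rw [inv_one]; exact one_mem _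
  | mul x y _ _ hx hy => rw [mul_inv_rev]; exact mul_mem hy hx

lemma linGates_sq {g : CircuitClass 2} (hg : g ∈ linGates) : g * g = 1 := by
  rcases hg with rfl | rfl
  · exact gS_sq
  · exact gC_sq

lemma inv_mem_lin {n : ℕ} {a : CircuitClass n} (ha : a ∈ Lin n) : a⁻¹ ∈ Lin n := by
  refine inv_mem_of_closure ?_ ha
  rintro _ ⟨i, h, g, hg, rfl⟩
  rw [← map_mul, linGates_sq hg, map_one]

/-- The hexagon splits the lower block into single wires. The symmetry `sym m 1` is the inverse of
`sym 1 m`, and `Lin` is closed under inverses because its generators are involutions. -/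
lemma sym_mem_lin (m n : ℕ) : sym m n ∈ Lin (m + n) := by
  induction n with
  | zero => rw [sym_zero]; exact one_mem _
  | succ n ih =>
    have := sym_add m n 1 rfl
    rw [castHom_rfl, pl_eq_on, pl_eq_on] at this
    rw [this]
    refine mul_mem (on_lin _ ih) (on_lin _ ?_)
    have h := sym_sym m 1
    rw [castHom_eq_on] at h
    rw [eq_inv_of_mul_eq_one_left h]
    exact inv_mem_lin (on_lin _ (sym_one_mem_lin m))

/-- The classes of circuits that consist of SWAP, CNOT and X gates. -/
noncomputable def Aff (n : ℕ) : Submonoid (CircuitClass n) :=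
  Submonoid.closure ({a | ∃ (i : ℕ) (h : i + 2 ≤ n), ∃ g ∈ linGates, a = on i h g} ∪
    {a | ∃ (i : ℕ) (h : i + 1 ≤ n), a = on i h gX})

/-- The classes of circuits that consist of X gates. -/
noncomputable def XGates (n : ℕ) : Submonoid (CircuitClass n) :=
  Submonoid.closure {a | ∃ (i : ℕ) (h : i + 1 ≤ n), a = on i h gX}

lemma lin_le_aff (n : ℕ) : Lin n ≤ Aff n := Submonoid.closure_mono Set.subset_union_left

lemma xGates_le_aff (n : ℕ) : XGates n ≤ Aff n := Submonoid.closure_mono Set.subset_union_right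

lemma on_gX_mem_xGates {n i : ℕ} (h : i + 1 ≤ n) : on i h gX ∈ XGates n :=
  Submonoid.subset_closure ⟨i, h, rfl⟩

lemma on_gX_mem_aff {n i : ℕ} (h : i + 1 ≤ n) : on i h gX ∈ Aff n :=
  xGates_le_aff n (on_gX_mem_xGates h)

lemma inv_mem_aff {n : ℕ} {a : CircuitClass n} (ha : a ∈ Aff n) : a⁻¹ ∈ Aff n := by
  refine inv_mem_of_closure ?_ ha
  rintro _ (⟨i, h, g, hg, rfl⟩ | ⟨i, h, rfl⟩)
  · rw [← map_mul, linGates_sq hg, map_one]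
  · rw [← map_mul, gX_sq, map_one]

lemma on_aff {k n : ℕ} {i : ℕ} (h : i + k ≤ n) {a : CircuitClass k} (ha : a ∈ Aff k) :
    on i h a ∈ Aff n := by
  induction ha using Submonoid.closure_induction with
  | mem x hx =>
    rcases hx with ⟨j, hj, g, hg, rfl⟩ | ⟨j, hj, rfl⟩
    · rw [on_on]; exact lin_le_aff _ (on_mem_lin _ hg)
    · rw [on_on]; exact on_gX_mem_aff _
  | one => rw [map_one]; exact one_mem _
  | mul x y _ _ hx hy => rw [map_mul]; exact mul_mem hx hy

lemma mul_eq_of_conj_eq {G : Type*} [Group G] {c a b : G} (hc : c * c = 1) (h : c * a * c = b) :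
    a * c = c * b := by
  rw [← h, mul_assoc, mul_self_cancel_left hc]

lemma on_zero_mul_gS (g : CircuitClass 1) :
    on 0 (by omega) g * gS = gS * on 1 (by omega) g := by
  have := ten_mul_sym g (1 : CircuitClass 1)
  rw [castHom_rfl, one_ten_eq_on, ten_one_eq_on] at this
  exact this

lemma on_one_mul_gS (g : CircuitClass 1) :
    on 1 (by omega) g * gS = gS * on 0 (by omega) g := by
  have := ten_mul_sym (1 : CircuitClass 1) g
  rw [castHom_rfl, one_ten_eq_on, ten_one_eq_on] at this
  exact this

lemma on_one_gX_mul_gC : on 1 (by omega) gX * gC = gC * on 1 (by omega) gX := by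
  have := mk_eq_mk.2 (Derivable.rel .R2)
  simp only [mk_seq, mk_tensor, mk_wires, one_ten_eq_on] at this
  change gC * on 1 (by omega) gX * gC = on 1 (by omega) gX at this
  exact mul_eq_of_conj_eq gC_sq this

lemma on_zero_gX_mul_gC :
    on 0 (by omega) gX * gC = gC * (on 0 (by omega) gX * on 1 (by omega) gX) := by
  have := mk_eq_mk.2 (Derivable.rel .R3)
  simp only [mk_seq, mk_tensor, mk_wires, ten_one_eq_on] at this
  rw [ten_eq_on] at this
  change gC * on 0 (by omega) gX * gC = on 0 (by omega) gX * on 1 (by omega) gX at this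
  exact mul_eq_of_conj_eq gC_sq this

lemma on_zero_gT_mul_gC : on 0 (by omega) gT * gC = gC * on 0 (by omega) gT := by
  have := mk_eq_mk.2 (Derivable.rel .R12)
  simp only [mk_seq, mk_tensor, mk_wires, ten_one_eq_on] at this
  change gC * on 0 (by omega) gT * gC = on 0 (by omega) gT at this
  exact mul_eq_of_conj_eq gC_sq this

/-- SWAP and CNOT normalise the X gates, by naturality of the symmetry and by `R2` and `R3`; all X
gates can therefore be collected at the end. -/
lemma xGates_mul_gate {n : ℕ} {x : CircuitClass n} (hx : x ∈ XGates n) {i : ℕ} (h : i + 2 ≤ n)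
    {g : CircuitClass 2} (hg : g ∈ linGates) : ∃ x' ∈ XGates n, x * on i h g = on i h g * x' := by
  induction hx using Submonoid.closure_induction with
  | mem x hx =>
    obtain ⟨j, hj, rfl⟩ := hx
    have key : ∀ (k : ℕ) (hk : k + 1 ≤ 2), ∃ x' ∈ XGates 2, on k hk gX * g = g * x' := by
      intro k hk
      have h0 : on 0 (by omega) gX ∈ XGates 2 := on_gX_mem_xGates _
      have h1 : on 1 (by omega) gX ∈ XGates 2 := on_gX_mem_xGates _
      obtain rfl | rfl : k = 0 ∨ k = 1 := by omega
      · rcases hg with rfl | rfl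
        · exact ⟨_, h1, on_zero_mul_gS _⟩
        · exact ⟨_, mul_mem h0 h1, on_zero_gX_mul_gC⟩
      · rcases hg with rfl | rfl
        · exact ⟨_, h0, on_one_mul_gS _⟩
        · exact ⟨_, h1, on_one_gX_mul_gC⟩
    have incl : ∀ x' ∈ XGates 2, on i h x' ∈ XGates n := by
      intro x' hx'
      induction hx' using Submonoid.closure_induction with
      | mem x hx => obtain ⟨k, hk, rfl⟩ := hx; rw [on_on]; exact on_gX_mem_xGates _
      | one => rw [map_one]; exact one_mem _
      | mul x y _ _ hx hy => rw [map_mul]; exact mul_mem hx hy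
    by_cases hj1 : j < i
    · exact ⟨_, on_gX_mem_xGates hj, (on_comm _ _ (by omega) _ _).eq⟩
    · by_cases hj2 : j < i + 2
      · obtain ⟨k, rfl⟩ := Nat.exists_eq_add_of_le (not_lt.1 hj1)
        obtain ⟨x', hx', e⟩ := key k (by omega)
        refine ⟨_, incl x' hx', ?_⟩
        rw [← map_mul, ← e, map_mul, on_on]
      · exact ⟨_, on_gX_mem_xGates hj, (on_comm h hj (by omega) _ _).eq.symm⟩
  | one => exact ⟨1, one_mem _, by rw [one_mul, mul_one]⟩
  | mul x y _ _ hx hy =>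
    obtain ⟨x', hx', ex⟩ := hx
    obtain ⟨y', hy', ey⟩ := hy
    exact ⟨x' * y', mul_mem hx' hy', by rw [mul_assoc, ey, ← mul_assoc, ex, mul_assoc]⟩

lemma exists_lin_mul_xGates {n : ℕ} {a : CircuitClass n} (ha : a ∈ Aff n) :
    ∃ l ∈ Lin n, ∃ x ∈ XGates n, a = l * x := by
  induction ha using Submonoid.closure_induction_right with
  | one => exact ⟨1, one_mem _, 1, one_mem _, (mul_one 1).symm⟩
  | mul_right a _ y hy ih =>
    obtain ⟨l, hl, x, hx, rfl⟩ := ih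
    rcases hy with ⟨i, h, g, hg, rfl⟩ | ⟨i, h, rfl⟩
    · obtain ⟨x', hx', e⟩ := xGates_mul_gate hx h hg
      exact ⟨_, mul_mem hl (on_mem_lin h hg), x', hx', by rw [mul_assoc, e, mul_assoc]⟩
    · exact ⟨l, hl, _, mul_mem hx (on_gX_mem_xGates h), mul_assoc _ _ _⟩

/-- The class of a column of one-qubit gates. -/
noncomputable def lay (g : CircuitClass 1) : (n : ℕ) → (Fin n → ℕ) → CircuitClass n
  | 0, _ => 1
  | n + 1, a => ten (lay g n fun i => a i.castSucc) (g ^ a (Fin.last n))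

lemma mk_layer (g : Circuit 1) (n : ℕ) (a : Fin n → ℕ) : mk (layer g n a) = lay (mk g) n a := by
  induction n with
  | zero => rfl
  | succ n ih => rw [layer, mk_tensor, ih, mk_pow]; rfl

lemma lay_eq_prod (g : CircuitClass 1) (n : ℕ) (a : Fin n → ℕ) :
    lay g n a = ((List.finRange n).map fun i : Fin n => on (i : ℕ) i.2 g ^ a i).prod := by
  induction n with
  | zero => rfl
  | succ n ih =>
    rw [lay, ih, List.finRange_succ_last, ten_eq_on, List.map_append, List.prod_append,
      map_list_prod, List.map_map, List.map_map]
    simp only [List.map_cons, List.map_nil, List.prod_cons, List.prod_nil, mul_one, map_pow]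
    congr 3
    ext i : 1
    simp only [Function.comp, map_pow, on_on]
    congr 1
    exact on_congr (Nat.zero_add _) _ _

/-- The class of a column of X gates. -/
noncomputable def xLayer (n : ℕ) (f : Fin n → Fin 2) : CircuitClass n := lay gX n fun i => f i

lemma xLayer_zero (n : ℕ) : xLayer n 0 = 1 := by
  rw [xLayer, lay_eq_prod]; simp

lemma xLayer_mul_on (n : ℕ) (f : Fin n → Fin 2) (i : ℕ) (h : i + 1 ≤ n) :
    xLayer n f * on i h gX = xLayer n (Function.update f ⟨i, h⟩ (f ⟨i, h⟩ + 1)) := by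
  induction n with
  | zero => omega
  | succ n ih =>
    rw [xLayer, xLayer, lay, lay]
    by_cases hi : i < n
    · have e : on i h gX = ten (on i (by omega) gX) (1 : CircuitClass 1) := by
        rw [ten_one_eq_on, on_on, on_congr (Nat.zero_add i)]
      rw [e, ← ten_mul, mul_one]
      have := ih (fun i => f i.castSucc) hi
      rw [xLayer, xLayer] at this
      rw [this, Function.update_of_ne (by simp [Fin.ext_iff]; omega)]
      congr 2
      ext j : 1
      by_cases hj : (j : ℕ) = i
      · obtain rfl : j = ⟨i, hi⟩ := Fin.ext hj
        simp
      · rw [Function.update_of_ne (by simpa [Fin.ext_iff] using hj),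
          Function.update_of_ne (by simpa [Fin.ext_iff] using hj)]
    · obtain rfl : i = n := by omega
      have e : on i h gX = ten (1 : CircuitClass i) gX := (one_ten_eq_on _).symm
      rw [e, ← ten_mul, mul_one]
      congr 1
      · congr 1
        ext j : 1
        rw [Function.update_of_ne (by simp [Fin.ext_iff]; omega)]
      · have : (⟨i, h⟩ : Fin (i + 1)) = Fin.last i := rfl
        rw [this, Function.update_self, pow_fin_two_add gX_sq]
        simp

lemma exists_xLayer {n : ℕ} {x : CircuitClass n} (hx : x ∈ XGates n) : ∃ f, x = xLayer n f := by
  induction hx using Submonoid.closure_induction_right with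
  | one => exact ⟨0, (xLayer_zero n).symm⟩
  | mul_right a _ y hy ih =>
    obtain ⟨f, rfl⟩ := ih
    obtain ⟨i, h, rfl⟩ := hy
    exact ⟨_, xLayer_mul_on n f i h⟩

/-- Circuits of SWAP, CNOT and X gates have affine normal forms. -/
theorem exists_affineNF {n : ℕ} {a : CircuitClass n} (ha : a ∈ Aff n) :
    ∃ (L : (i : Fin n) → Ladder i) (f : Fin n → Fin 2), a = ladderSeq n L * xLayer n f := by
  obtain ⟨l, hl, x, hx, rfl⟩ := exists_lin_mul_xGates ha
  obtain ⟨L, rfl⟩ := exists_ladderSeq hl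
  obtain ⟨f, rfl⟩ := exists_xLayer hx
  exact ⟨L, f, rfl⟩

lemma act_xLayer (n : ℕ) (f : Fin n → Fin 2) (x : Fin n → Fin 2) : act (xLayer n f) x = x + f := by
  induction n with
  | zero => ext i; exact i.elim0
  | succ n ih =>
    ext j : 1
    rw [xLayer, lay, act_ten]
    induction j using Fin.lastCases with
    | last =>
      rw [dif_neg (by simp)]
      have e : x ⟨n + 0, by omega⟩ = x (Fin.last n) := rfl
      generalize hf : f (Fin.last n) = c
      fin_cases c
      · simp [hf]; exact e
      · simp [hf, act_gX]; exact e
    | cast i =>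
      rw [dif_pos (by simp)]
      exact congrFun (ih (fun i => f i.castSucc) fun i => x i.castSucc) i

/-- The ladders act linearly, so the image of the zero vector is the translation part; removing it
leaves the linear part. -/
theorem act_affine_injective {n : ℕ} {L M : (i : Fin n) → Ladder i} {f g : Fin n → Fin 2}
    (h : act (ladderSeq n L * xLayer n f) = act (ladderSeq n M * xLayer n g)) : L = M ∧ f = g := by
  have hfg : f = g := by
    have := congrFun h 0
    rwa [act_mul, act_mul, act_xLayer, act_xLayer, act_lin_zero (ladderSeq_mem_lin _ _),
      act_lin_zero (ladderSeq_mem_lin _ _), zero_add, zero_add] at this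
  refine ⟨act_ladderSeq_injective ?_, hfg⟩
  subst hfg
  ext1 x
  have := congrFun h x
  rw [act_mul, act_mul] at this
  exact (act_bijective _).1 this

/-- Circuits of SWAP, CNOT and X gates that induce the same permutation are equal. -/
theorem aff_ext {n : ℕ} {a b : CircuitClass n} (ha : a ∈ Aff n) (hb : b ∈ Aff n)
    (h : ∀ x, act a x = act b x) : a = b := by
  obtain ⟨L, f, rfl⟩ := exists_affineNF ha
  obtain ⟨M, g, rfl⟩ := exists_affineNF hb
  obtain ⟨rfl, rfl⟩ := act_affine_injective (funext h)
  rfl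

/-! ### `T` gates conjugated by affine circuits -/

/-- The `T` gate on the wire `i`. -/
def tg {n : ℕ} (i : Fin n) : CircuitClass n := on (i : ℕ) i.2 gT

/-- The scalar `ω` as a circuit on `n` wires. -/
def wg (n : ℕ) : CircuitClass n := on 0 (by omega) w

lemma wg_comm {n : ℕ} (a : CircuitClass n) : Commute (wg n) a := by
  -- The scalar occupies no wire, so even at position 0 it counts as lying above a gate that starts
  -- at wire 0.
  have := on_comm (n := n) (i := 0) (i' := 0) (by omega) (by omega) (by omega) w a
  rwa [on_self] at this

lemma tg_comm {n : ℕ} (i j : Fin n) : Commute (tg i) (tg j) := by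
  rcases lt_trichotomy (i : ℕ) j with h | h | h
  · exact on_comm _ _ (by omega) _ _
  · rw [Fin.ext h]
  · exact (on_comm _ _ (by omega) _ _).symm

lemma act_on_gS {n i : ℕ} (h : i + 2 ≤ n) (x : Fin n → Fin 2) :
    act (on i h gS) x = x ∘ Equiv.swap ⟨i, by omega⟩ ⟨i + 1, by omega⟩ := by
  ext j : 1
  rw [act_on_two, act_gS, Function.comp]
  split_ifs with h1 h2
  · rw [show j = ⟨i, by omega⟩ from Fin.ext h1, Equiv.swap_apply_left]; rfl
  · rw [show j = ⟨i + 1, by omega⟩ from Fin.ext h2, Equiv.swap_apply_right]; rfl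
  · rw [Equiv.swap_apply_of_ne_of_ne] <;> simpa [Fin.ext_iff]

lemma on_gS_mul_tg {n i : ℕ} (h : i + 2 ≤ n) (j : Fin n) :
    on i h gS * tg j = tg (Equiv.swap ⟨i, by omega⟩ ⟨i + 1, by omega⟩ j) * on i h gS := by
  by_cases h1 : (j : ℕ) = i
  · rw [show j = ⟨i, by omega⟩ from Fin.ext h1, Equiv.swap_apply_left]
    have := congrArg (on i h) (on_one_mul_gS gT)
    rw [map_mul, map_mul, on_on, on_on] at this
    exact this.symm
  · by_cases h2 : (j : ℕ) = i + 1
    · rw [show j = ⟨i + 1, by omega⟩ from Fin.ext h2, Equiv.swap_apply_right]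
      have := congrArg (on i h) (on_zero_mul_gS gT)
      rw [map_mul, map_mul, on_on, on_on] at this
      exact this.symm
    · rw [Equiv.swap_apply_of_ne_of_ne (by simpa [Fin.ext_iff]) (by simpa [Fin.ext_iff])]
      by_cases h3 : (j : ℕ) < i
      · exact (on_comm _ _ (by omega) _ _).eq.symm
      · exact (on_comm _ _ (by omega) _ _).eq

/-- Every permutation of the wires is induced by a circuit. -/
lemma exists_perm {n : ℕ} (σ : Equiv.Perm (Fin n)) :
    ∃ P ∈ Lin n, (∀ x, act P x = x ∘ σ) ∧ ∀ j, P * tg j = tg (σ j) * P := by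
  cases n with
  | zero => exact ⟨1, one_mem _, fun x => by ext i; exact i.elim0, fun j => j.elim0⟩
  | succ n =>
    have hσ : σ ∈ (⊤ : Submonoid (Equiv.Perm (Fin (n + 1)))) := trivial
    rw [← Equiv.Perm.mclosure_swap_castSucc_succ] at hσ
    induction hσ using Submonoid.closure_induction with
    | mem τ hτ =>
      obtain ⟨i, rfl⟩ := hτ
      have h : (i : ℕ) + 2 ≤ n + 1 := by omega
      exact ⟨on i h gS, on_mem_lin _ (Or.inl rfl), act_on_gS h, on_gS_mul_tg h⟩
    | one => exact ⟨1, one_mem _, fun x => rfl, fun j => by rw [one_mul, mul_one]; rfl⟩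
    | mul σ τ _ _ hσ hτ =>
      obtain ⟨P, hP, aP, tP⟩ := hσ
      obtain ⟨Q, hQ, aQ, tQ⟩ := hτ
      refine ⟨P * Q, mul_mem hP hQ, fun x => ?_, fun j => ?_⟩
      · rw [act_mul, aP, aQ]; rfl
      · rw [mul_assoc, tQ, ← mul_assoc, tP, mul_assoc]; rfl

lemma act_desc_last (n : ℕ) (f : Fin n → Fin 2) (y : Fin (n + 1) → Fin 2) :
    act (desc n f) y (Fin.last n) = y 0 := by
  induction n with
  | zero => rfl
  | succ n ih =>
    rw [desc, act_mul, act_on_two, if_neg (by simp), if_pos (by simp), act_stair]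
    simp only [Matrix.cons_val_one, Matrix.cons_val_zero]
    change act _ y ⟨n, by omega⟩ = _
    rw [act_on, dif_pos (by simp)]
    exact (ih _ _).trans rfl

lemma stair_mul_tg (e : Fin 2) : stair e * on 1 (by omega) gT = on 0 (by omega) gT * stair e := by
  rw [stair, mul_assoc, ← on_zero_mul_gS, ← mul_assoc, ← mul_assoc]
  congr 1
  exact ((show Commute (on 0 (by omega) gT) gC from on_zero_gT_mul_gC).pow_right _).symm.eq

lemma desc_mul_tg (n : ℕ) (f : Fin n → Fin 2) :
    desc n f * tg (Fin.last n) = tg 0 * desc n f := by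
  induction n with
  | zero => rw [desc, one_mul, mul_one]; rfl
  | succ n ih =>
    have h1 := congrArg (on (n := n + 1 + 1) n (by omega)) (stair_mul_tg (f (Fin.last n)))
    rw [map_mul, map_mul, on_on, on_on] at h1
    have h2 := congrArg (on (n := n + 1 + 1) 0 (by omega)) (ih fun i => f i.castSucc)
    rw [map_mul, map_mul, tg, tg, on_on, on_on] at h2
    rw [desc, mul_assoc]
    refine (congrArg _ h1).trans ?_
    rw [← mul_assoc, ← mul_assoc]
    congr 1
    rw [on_congr (show n + 0 = 0 + n by omega)]
    exact h2

lemma asc_zero_mul_tg (n : ℕ) : asc n 0 * tg 0 = tg (Fin.last n) * asc n 0 := by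
  have h := asc_zero_mul_desc_zero n
  rw [eq_inv_of_mul_eq_one_left h, inv_mul_eq_iff_eq_mul, ← mul_assoc, desc_mul_tg, mul_assoc,
    mul_inv_cancel, mul_one]

/-- Preserving the last bit forces the descending stair to reach the bottom and the ascending stair
to consist of plain SWAPs. The `T` gate then travels along both stairs, meeting CNOTs only on their
control, where `R12` applies. -/
lemma commute_ladder_tg_last {n : ℕ} (L : Ladder n)
    (h : ∀ x, act (ladder L) x (Fin.last n) = x (Fin.last n)) :
    Commute (ladder L) (tg (Fin.last n)) := by
  obtain ⟨e, ⟨d, hd⟩, f⟩ := L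
  simp only [ladder] at h ⊢
  obtain rfl : d = n := by
    by_contra hne
    obtain ⟨n, rfl⟩ : ∃ m, n = m + 1 := ⟨n - 1, by omega⟩
    -- A shorter descending stair leaves on the bottom wire the input bit of the wire just above it,
    -- which vanishes on the last basis vector.
    have := h (unitVec (n + 1 + 1) (n + 1))
    rw [act_mul, act_on, dif_neg (by simp; omega), act_asc] at this
    change unitVec (n + 1 + 1) (n + 1) (Fin.last n).castSucc = _ at this
    simp [unitVec] at this
  rw [on_self] at h ⊢
  obtain rfl : e = 0 := by
    ext1 i
    have := h (unitVec (d + 1) i)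
    rw [act_mul, act_desc_last, act_asc, Fin.cons_zero] at this
    rw [Finset.sum_eq_single i] at this
    · simpa [unitVec] using this
    · intro j _ hj
      simp [unitVec, Fin.val_ne_of_ne hj]
    · simp
  rw [Commute, SemiconjBy, mul_assoc, desc_mul_tg, ← mul_assoc, asc_zero_mul_tg, mul_assoc]

/-- A circuit of SWAP, CNOT and X gates that preserves the last bit commutes with the `T` gate on
the last wire. -/
lemma commute_tg_last {n : ℕ} {a : CircuitClass (n + 1)} (ha : a ∈ Aff (n + 1))
    (h : ∀ x, act a x (Fin.last n) = x (Fin.last n)) : Commute a (tg (Fin.last n)) := by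
  obtain ⟨L, g, rfl⟩ := exists_affineNF ha
  have hg : g (Fin.last n) = 0 := by
    have := h 0
    rwa [act_mul, act_xLayer, act_lin_zero (ladderSeq_mem_lin _ _), zero_add] at this
  have hX : Commute (xLayer (n + 1) g) (tg (Fin.last n)) := by
    have e : xLayer (n + 1) g = on 0 (by omega) (xLayer n fun i => g i.castSucc) := by
      rw [← ten_one_eq_on, xLayer, lay, hg]; rfl
    rw [e]
    exact on_comm _ _ (by simp) _ _
  have h1 : ∀ x, act (ladderSeq (n + 1) L) x (Fin.last n) = x (Fin.last n) := by
    intro x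
    have := h x
    rwa [act_mul, act_xLayer, Pi.add_apply, hg, add_zero] at this
  refine Commute.mul_left (Commute.mul_left ?_ (commute_ladder_tg_last _ fun x => ?_)) hX
  · rw [ten_one_eq_on]
    exact on_comm _ _ (by simp) _ _
  · obtain ⟨y, rfl⟩ := (act_bijective (ten (ladderSeq n fun i => L i.castSucc)
      (1 : CircuitClass 1))).2 x
    exact ((congrFun (act_mul _ _ y).symm _).trans (h1 y)).trans (act_ten_one_last _ _).symm

/-- The class `g` is a `T` gate conjugated by a circuit of SWAP, CNOT and X gates; the Boolean
function `r` is the exponent of `ω`. -/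
def IsRot {n : ℕ} (g : CircuitClass n) (r : (Fin n → Fin 2) → Fin 2) : Prop :=
  ∃ a ∈ Aff n, ∃ i : Fin n, g = a * tg i * a⁻¹ ∧ ∀ x, act a x i = r x

lemma IsRot.exists_last {n : ℕ} {g : CircuitClass (n + 1)} {r : (Fin (n + 1) → Fin 2) → Fin 2}
    (h : IsRot g r) :
    ∃ a ∈ Aff (n + 1), g = a * tg (Fin.last n) * a⁻¹ ∧ ∀ x, act a x (Fin.last n) = r x := by
  obtain ⟨a, ha, i, rfl, hr⟩ := h
  obtain ⟨P, hP, aP, tP⟩ := exists_perm (Equiv.swap i (Fin.last n))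
  refine ⟨a * P, mul_mem ha (lin_le_aff _ hP), ?_, fun x => ?_⟩
  · have := tP (Fin.last n)
    rw [Equiv.swap_apply_right] at this
    rw [mul_assoc a P, this]
    group
  · rw [act_mul, aP, Function.comp, Equiv.swap_apply_right, hr]

/-- With both `T` gates moved to the last wire, the affine circuits `a` and `b` compute the same
last bit, so `a⁻¹ * b` preserves it and commutes with `T` there. The two conjugates therefore agree.
-/
theorem IsRot.unique {n : ℕ} {g g' : CircuitClass n} {r : (Fin n → Fin 2) → Fin 2}
    (h : IsRot g r) (h' : IsRot g' r) : g = g' := by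
  cases n with
  | zero => obtain ⟨_, _, i, _⟩ := h; exact i.elim0
  | succ n =>
    obtain ⟨a, ha, rfl, hr⟩ := h.exists_last
    obtain ⟨b, hb, rfl, hr'⟩ := h'.exists_last
    have := commute_tg_last (mul_mem (inv_mem_aff ha) hb) (fun x => by
      rw [act_mul, hr', ← hr, act_act_inv])
    rw [mul_inv_eq_iff_eq_mul]
    have e := this.eq
    rw [mul_assoc, inv_mul_eq_iff_eq_mul] at e
    rw [mul_assoc _ _ a, ← inv_inv a, ← mul_inv_rev, inv_inv, eq_mul_inv_iff_mul_eq, mul_assoc, ← e]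

lemma isRot_tg {n : ℕ} (i : Fin n) : IsRot (tg i) fun x => x i :=
  ⟨1, one_mem _, i, by group, fun _ => rfl⟩

lemma IsRot.conj {n : ℕ} {g : CircuitClass n} {r : (Fin n → Fin 2) → Fin 2} (h : IsRot g r)
    {a : CircuitClass n} (ha : a ∈ Aff n) : IsRot (a * g * a⁻¹) fun x => r (act a x) := by
  obtain ⟨b, hb, i, rfl, hr⟩ := h
  exact ⟨a * b, mul_mem ha hb, i, by group, fun x => by rw [act_mul, hr]⟩

lemma IsRot.map_on {k n : ℕ} {g : CircuitClass k} {r : (Fin k → Fin 2) → Fin 2} (h : IsRot g r)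
    {i : ℕ} (hi : i + k ≤ n) : IsRot (on i hi g) fun x => r fun t => x ⟨i + t, by omega⟩ := by
  obtain ⟨b, hb, j, rfl, hr⟩ := h
  refine ⟨on i hi b, on_aff _ hb, ⟨i + j, by omega⟩, ?_, fun x => ?_⟩
  · rw [map_mul, map_mul, map_inv, tg, on_on]; rfl
  · rw [act_on, dif_pos (by simp)]
    refine Eq.trans ?_ (hr _)
    congr 1; ext; simp

lemma commute_tg {n : ℕ} {a : CircuitClass n} (ha : a ∈ Aff n) {i : Fin n}
    (h : ∀ x, act a x i = x i) : Commute a (tg i) := by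
  have h1 := (isRot_tg i).conj ha
  simp only [h] at h1
  have := h1.unique (isRot_tg i)
  rwa [mul_inv_eq_iff_eq_mul] at this

/-- A CNOT on the top two wires is conjugated by a permutation that matches these wires with `j` and
`k`. -/
lemma exists_cnot {n : ℕ} {j k : Fin n} (h : j ≠ k) :
    ∃ c ∈ Lin n, ∀ x, act c x = Function.update x k (x k + x j) := by
  have hn : 2 ≤ n := by
    have := j.2; have := k.2
    have := Fin.val_ne_of_ne h
    omega
  obtain ⟨σ, hσ⟩ := Equiv.Perm.exists_extending_pair (α := Fin 2) (β := Fin n)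
    (Fin.castLE hn) ![j, k] (Fin.castLE_injective hn) (by
      intro a b hab
      fin_cases a <;> fin_cases b <;> simp_all [eq_comm])
  have h0 : σ ⟨0, by omega⟩ = j := hσ 0
  have h1 : σ ⟨1, by omega⟩ = k := hσ 1
  obtain ⟨P, hP, aP, -⟩ := exists_perm σ
  refine ⟨P * on 0 (by omega) gC * P⁻¹, mul_mem (mul_mem hP (on_mem_lin _ (Or.inr rfl)))
    (inv_mem_lin hP), fun x => ?_⟩
  apply (act_bijective P).1
  rw [act_mul, act_act_inv, act_mul, aP, aP]
  ext t : 1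
  rw [act_on_two, act_gC]
  simp only [Function.comp, zero_add, h0, h1]
  split_ifs with h2 h3
  · rw [show t = ⟨0, by omega⟩ from Fin.ext h2, h0, Function.update_of_ne h]; rfl
  · rw [show t = ⟨1, by omega⟩ from Fin.ext h3, h1, Function.update_self, add_comm]; rfl
  · rw [Function.update_of_ne]
    rw [← h1]
    exact fun h => h3 (congrArg Fin.val (σ.injective h))

/-- An affine function that depends on bit `k` can thus be computed on wire `k` without changing any
other bit. This choice of circuit is what makes commutation with gates on the other wires visible.
-/
lemma exists_add {n : ℕ} (k : Fin n) (S : Finset (Fin n)) (hk : k ∉ S) (ε : Fin 2) :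
    ∃ c ∈ Aff n, ∀ x, act c x = Function.update x k (x k + (∑ j ∈ S, x j) + ε) := by
  induction S using Finset.induction_on with
  | empty =>
    fin_cases ε
    · exact ⟨1, one_mem _, fun x => by simp⟩
    · refine ⟨on k k.2 gX, on_gX_mem_aff _, fun x => ?_⟩
      ext j : 1
      rw [act_on]
      split_ifs with h
      · obtain rfl : j = k := by ext; omega
        simp [act_gX]
      · rw [Function.update_of_ne]
        rintro rfl; exact h ⟨le_rfl, by omega⟩
  | insert j S hj ih =>
    rw [Finset.mem_insert, not_or] at hk
    obtain ⟨c, hc, ac⟩ := ih hk.2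
    obtain ⟨d, hd, ad⟩ := exists_cnot (Ne.symm hk.1)
    refine ⟨d * c, mul_mem (lin_le_aff _ hd) hc, fun x => ?_⟩
    rw [act_mul, ad, ac, Function.update_idem, Finset.sum_insert hj, Function.update_self]
    congr 2
    rw [Finset.sum_congr rfl fun i hi =>
      Function.update_of_ne (ne_of_mem_of_not_mem hi hk.2) (x k + x j) x]
    ring

lemma exists_affine_row {n : ℕ} {a : CircuitClass n} (ha : a ∈ Aff n) (j : Fin n) :
    ∃ (S : Finset (Fin n)) (ε : Fin 2), ∀ x, act a x j = (∑ k ∈ S, x k) + ε := by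
  suffices h : ∃ (v : Fin n → Fin 2) (ε : Fin 2), ∀ x, act a x j = (∑ k, v k * x k) + ε by
    obtain ⟨v, ε, h⟩ := h
    refine ⟨Finset.univ.filter fun k => v k = 1, ε, fun x => ?_⟩
    rw [h, Finset.sum_filter]
    congr 1
    refine Finset.sum_congr rfl fun k _ => ?_
    generalize v k = c
    fin_cases c <;> simp
  induction ha using Submonoid.closure_induction_right generalizing j with
  | one => exact ⟨Pi.single j 1, 0, fun x => by simp [Pi.single_apply]⟩
  | mul_right a _ y hy ih =>
    rcases hy with ⟨i, h, g, hg, rfl⟩ | ⟨i, h, rfl⟩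
    · obtain ⟨v, ε, h1⟩ := ih ⟨i, by omega⟩
      obtain ⟨v', ε', h2⟩ := ih ⟨i + 1, by omega⟩
      obtain ⟨v₃, ε₃, h3⟩ := ih j
      simp only [act_mul, act_on_two, h1, h2, h3]
      rcases hg with rfl | rfl <;> simp only [act_gS, act_gC] <;> split_ifs
      · exact ⟨v', ε', fun x => rfl⟩
      · exact ⟨v, ε, fun x => rfl⟩
      · exact ⟨v₃, ε₃, fun x => rfl⟩
      · exact ⟨v, ε, fun x => rfl⟩
      · refine ⟨v + v', ε + ε', fun x => ?_⟩
        simp only [Matrix.cons_val_one, Matrix.cons_val_zero, Pi.add_apply, add_mul,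
          Finset.sum_add_distrib]
        ring
      · exact ⟨v₃, ε₃, fun x => rfl⟩
    · obtain ⟨v₃, ε₃, h3⟩ := ih j
      simp only [act_mul, act_on]
      split_ifs with h'
      · obtain rfl : i = j := by omega
        refine ⟨v₃, ε₃ + 1, fun x => ?_⟩
        simp only [act_gX]
        rw [← add_assoc, ← h3]; rfl
      · exact ⟨v₃, ε₃, h3⟩

lemma gX_mul_gT_mul_gX : gX * gT * gX = wg 1 * gT ^ 7 := by
  have := mk_eq_mk.2 (Derivable.rel .R11)
  rw [scalar, mk_cast, mk_tensor, mk_pow, ten_eq_on, map_mul, castHom_on, castHom_on, on_self]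
    at this
  exact this

/-- Naturality of the symmetry with no wires, which is the identity, lets the scalar pass any number
of wires. -/
lemma on_w {n i : ℕ} (h : i + 0 ≤ n) : on i h w = wg n := by
  have h1 := ten_mul_sym (1 : CircuitClass i) w
  rw [sym_zero, mul_one, one_mul] at h1
  have h2 : (⟨i, 1⟩ * ⟨0, w⟩ : Σ n, CircuitClass n) = ⟨0, w⟩ * ⟨i, 1⟩ :=
    (congrArg (Sigma.mk _) h1).trans (sigma_castHom _ _)
  apply eq_of_sigma
  refine (sigma_pl _ _ _ _).trans ((sigma_pl _ _ _ _).trans ?_).symm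
  rw [h2, sigma_zero, one_mul, mul_assoc, sigma_one_mul_one,
    show i + (n - (i + 0)) = n - (0 + 0) by omega]

lemma on_wg {k n i : ℕ} (h : i + k ≤ n) : on i h (wg k) = wg n := by
  rw [wg, on_on]; exact on_w _

lemma gX_conj_tg {n : ℕ} (i : Fin n) :
    on (i : ℕ) i.2 gX * tg i * (on (i : ℕ) i.2 gX)⁻¹ = wg n * tg i ^ 7 := by
  rw [← map_inv, inv_eq_of_mul_eq_one_right gX_sq, tg, ← map_mul, ← map_mul, gX_mul_gT_mul_gX,
    map_mul, map_pow, on_wg]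

/-- Conjugation reduces to `g = tg i`. If the other function depends on some bit `k ≠ i`, uniqueness
allows it to be computed on wire `k` by a circuit that preserves bit `i` and hence commutes with `tg
i`. Otherwise it is `x i` or its negation, and the gate is `tg i` or `wg n * tg i ^ 7`. -/
theorem IsRot.commute {n : ℕ} {g g' : CircuitClass n} {r r' : (Fin n → Fin 2) → Fin 2}
    (h : IsRot g r) (h' : IsRot g' r') : Commute g g' := by
  obtain ⟨a, ha, i, rfl, -⟩ := h
  suffices key : ∀ {h : CircuitClass n} {s}, IsRot h s → Commute (tg i) h by
    have h2 := key (h'.conj (inv_mem_aff ha))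
    have e := congrArg (fun b => a * b * a⁻¹) h2.eq
    rw [Commute, SemiconjBy]
    convert e using 1 <;> group
  intro h s ⟨b, hb, j, e, hs⟩
  obtain ⟨S, ε, hS⟩ := exists_affine_row hb j
  by_cases hk : ∃ k ∈ S, k ≠ i
  · obtain ⟨k, hk, hki⟩ := hk
    obtain ⟨c, hc, ac⟩ := exists_add k (S.erase k) (Finset.notMem_erase k S) ε
    have h1 : IsRot h fun x => (∑ k ∈ S, x k) + ε := ⟨b, hb, j, e, hS⟩
    have h2 : IsRot (c * tg k * c⁻¹) fun x => (∑ k ∈ S, x k) + ε :=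
      ⟨c, hc, k, rfl, fun x => by rw [ac, Function.update_self, Finset.add_sum_erase S x hk]⟩
    rw [h1.unique h2]
    have h3 : Commute (tg i) c :=
      (commute_tg hc fun x => by rw [ac, Function.update_of_ne hki.symm]).symm
    exact (h3.mul_right (tg_comm i k)).mul_right h3.inv_right
  · push Not at hk
    rcases Finset.subset_singleton_iff.1 (fun k hkS => Finset.mem_singleton.2 (hk k hkS) : S ⊆ {i})
      with rfl | rfl
    -- With `S` empty the bit would be constantly `ε`, which is impossible for a coordinate of a
    -- bijection.
    · obtain ⟨x, hx⟩ := (act_bijective b).2 fun _ => ε + 1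
      have := hS x
      rw [hx] at this
      simp at this
    · simp only [Finset.sum_singleton] at hS
      fin_cases ε
      · have h1 : IsRot h fun x => x i := ⟨b, hb, j, e, fun x => by rw [hS]; simp⟩
        rw [h1.unique (isRot_tg i)]
      · have h1 : IsRot h fun x => x i + 1 := ⟨b, hb, j, e, hS⟩
        have h2 : IsRot _ fun x : Fin n → Fin 2 => x i + 1 :=
          ⟨on i i.2 gX, on_gX_mem_aff _, i, rfl, fun x => by rw [act_on, dif_pos (by simp)]; rfl⟩
        rw [h1.unique h2, gX_conj_tg]
        exact (wg_comm _).symm.mul_right ((Commute.refl _).pow_right 7)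

/-! ### Parity phase gates and the relations between them -/

/-- The gate that multiplies a basis state by `ω` if the parity of the bits in `S` is odd. -/
noncomputable def rot {n : ℕ} (S : Finset (Fin n)) : CircuitClass n :=
  -- The default value is taken only for `S = ∅`, where the zero function is no coordinate of a
  -- bijection and the identity is the right gate.
  open Classical in if h : ∃ g, IsRot g fun x => ∑ k ∈ S, x k then h.choose else 1

lemma IsRot.eq_rot {n : ℕ} {g : CircuitClass n} {S : Finset (Fin n)}
    (h : IsRot g fun x => ∑ k ∈ S, x k) : g = rot S := by
  have h' : ∃ g, IsRot g fun x => ∑ k ∈ S, x k := ⟨g, h⟩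
  rw [rot, dif_pos h']
  exact h.unique h'.choose_spec

lemma isRot_rot {n : ℕ} {S : Finset (Fin n)} (hS : S.Nonempty) :
    IsRot (rot S) fun x => ∑ k ∈ S, x k := by
  obtain ⟨k, hk⟩ := hS
  obtain ⟨c, hc, ac⟩ := exists_add k (S.erase k) (Finset.notMem_erase k S) 0
  have h : IsRot (c * tg k * c⁻¹) fun x => ∑ k ∈ S, x k :=
    ⟨c, hc, k, rfl, fun x => by
      rw [ac, Function.update_self, Finset.add_sum_erase S x hk, add_zero]⟩
  rwa [← h.eq_rot]

lemma rot_empty {n : ℕ} : rot (∅ : Finset (Fin n)) = 1 := by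
  rw [rot, dif_neg]
  rintro ⟨g, a, ha, i, -, h⟩
  obtain ⟨x, hx⟩ := (act_bijective a).2 fun _ => 1
  have := h x
  rw [hx] at this
  simp at this

lemma rot_singleton {n : ℕ} (i : Fin n) : rot {i} = tg i := by
  refine (IsRot.eq_rot ?_).symm
  simpa using isRot_tg i

lemma rot_commute {n : ℕ} (S S' : Finset (Fin n)) : Commute (rot S) (rot S') := by
  rcases S.eq_empty_or_nonempty with rfl | hS
  · rw [rot_empty]; exact Commute.one_left _
  rcases S'.eq_empty_or_nonempty with rfl | hS'
  · rw [rot_empty]; exact Commute.one_right _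
  exact (isRot_rot hS).commute (isRot_rot hS')

lemma conj_rot {n : ℕ} {S S' : Finset (Fin n)} (hS : S.Nonempty) {a : CircuitClass n}
    (ha : a ∈ Aff n) (h : ∀ x, ∑ k ∈ S, act a x k = ∑ k ∈ S', x k) :
    a * rot S * a⁻¹ = rot S' := by
  have := (isRot_rot hS).conj ha
  simp only [h] at this
  exact this.eq_rot

lemma rot_pow_eight {n : ℕ} (S : Finset (Fin n)) : rot S ^ 8 = 1 := by
  rcases S.eq_empty_or_nonempty with rfl | hS
  · rw [rot_empty, one_pow]
  obtain ⟨a, -, i, e, -⟩ := isRot_rot hS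
  rw [e, conj_pow, tg, ← map_pow, gT_pow, map_one, mul_one, mul_inv_cancel]

lemma wg_pow_eight (n : ℕ) : wg n ^ 8 = 1 := by
  rw [wg, ← map_pow, w_pow, map_one]

/-- Relations between parity phase gates can be transported along injections of wires. -/
lemma exists_transport {k n : ℕ} (ι : Fin k ↪ Fin n) :
    ∃ φ : CircuitClass k →* CircuitClass n, ∀ S, φ (rot S) = rot (S.map ι) := by
  have hk : k ≤ n := by simpa using Fintype.card_le_of_embedding ι
  obtain ⟨σ, hσ⟩ := Equiv.Perm.exists_extending_pair (Fin.castLE hk) ι (Fin.castLE_injective hk)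
    ι.injective
  obtain ⟨P, hP, aP, -⟩ := exists_perm σ
  refine ⟨(MulAut.conj P).toMonoidHom.comp (on 0 (by omega)), fun S => ?_⟩
  rcases S.eq_empty_or_nonempty with rfl | hS
  · rw [rot_empty, map_one, Finset.map_empty, rot_empty]
  change P * on 0 _ (rot S) * P⁻¹ = _
  have h := ((isRot_rot hS).map_on (show 0 + k ≤ n by omega)).conj (lin_le_aff _ hP)
  apply IsRot.eq_rot
  convert h using 2 with x
  rw [Finset.sum_map, aP]
  refine Finset.sum_congr rfl fun j _ => ?_
  rw [← hσ]
  refine congrArg (x ∘ σ) ?_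
  ext; simp

lemma on_sym_inv {n i a b : ℕ} (h : i + (a + b) ≤ n) (h' : i + (b + a) ≤ n) :
    on i h' (sym b a) = (on i h (sym a b))⁻¹ := by
  rw [eq_comm, inv_eq_iff_mul_eq_one]
  have := congrArg (on i h) (sym_sym a b)
  rwa [map_mul, castHom_eq_on, on_on, map_one] at this

lemma act_sym {m n : ℕ} (x : Fin (m + n) → Fin 2) (i : Fin (m + n)) :
    act (sym m n) x i =
      if h : (i : ℕ) < n then x ⟨m + i, by omega⟩ else x ⟨i - n, by omega⟩ := act_symm x i

lemma mk_U : mk U = rot {0, 1} := by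
  refine IsRot.eq_rot ⟨gC, ?_, 1, ?_, fun x => ?_⟩
  · rw [← on_self (by omega) gC]; exact lin_le_aff _ (on_mem_lin _ (Or.inr rfl))
  · rw [inv_eq_of_mul_eq_one_right gC_sq, U, mk_seq, mk_seq, mk_tensor, mk_wires, one_ten_eq_on]
    rfl
  · rw [act_gC]; simp

lemma mk_V : mk V = rot {0, 1, 2} := by
  refine IsRot.eq_rot ⟨on 0 (by omega) gC * on 1 (by omega) gC, ?_, 2, ?_, fun x => ?_⟩
  · exact lin_le_aff _ (mul_mem (on_mem_lin _ (Or.inr rfl)) (on_mem_lin _ (Or.inr rfl)))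
  · rw [mul_inv_rev, ← map_inv, ← map_inv, inv_eq_of_mul_eq_one_right gC_sq]
    simp only [V, mk_seq, mk_tensor, mk_wires, one_ten_eq_on, ten_one_eq_on]
    simp only [mul_assoc]
    rfl
  · rw [act_mul, act_on_two, act_gC]
    simp only [act_on_two, act_gC]
    simp [Finset.sum_insert, add_assoc]

/-- The rearrangement of wires is conjugation by an affine circuit, so by uniqueness only the parity
that controls the phase has to be computed. -/
lemma mk_onPair_pow {n : ℕ} (i j : Fin n) (h : i < j) (b : ℕ) :
    mk (onPair i j h (Circuit.pow U b)) = rot {i, j} ^ b := by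
  have hm : i + 1 + (j - i - 1 + 1) ≤ n := by have := j.2; have := Fin.lt_def.1 h; omega
  rw [mk_onPair, mk_pow, mk_U, on_sym_inv hm, map_pow, ← conj_pow]
  congr 1
  have hi : (i : ℕ) + 2 ≤ n := by have := j.2; have := Fin.lt_def.1 h; omega
  have := ((isRot_rot (n := 2) (S := {0, 1}) ⟨0, by simp⟩).map_on hi).conj
    (lin_le_aff _ (on_lin hm (sym_mem_lin _ _)))
  apply IsRot.eq_rot
  convert this using 2 with x
  rw [Finset.sum_pair h.ne, Finset.sum_pair (by decide), act_on, dif_neg (by simp), act_on,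
    dif_pos (by simp), act_sym, dif_pos (by simp)]
  congr 2
  ext; simp; have := Fin.lt_def.1 h; omega

lemma mk_onTriple_pow {n : ℕ} (i j k : Fin n) (h : i < j ∧ j < k) (b : ℕ) :
    mk (onTriple i j k h (Circuit.pow V b)) = rot {i, j, k} ^ b := by
  have h1 := Fin.lt_def.1 h.1
  have h2 := Fin.lt_def.1 h.2
  have hk := k.2
  have hm : i + 1 + (j - i - 1 + 1) ≤ n := by omega
  have hm' : i + 2 + (k - i - 2 + 1) ≤ n := by omega
  have hi : (i : ℕ) + 3 ≤ n := by omega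
  have e : mk (onTriple i j k h (Circuit.pow V b)) =
      (on (i + 1) hm (sym (j - i - 1) 1) * on (i + 2) hm' (sym (k - i - 2) 1)) *
      on i hi (rot {0, 1, 2}) ^ b *
      (on (i + 1) hm (sym (j - i - 1) 1) * on (i + 2) hm' (sym (k - i - 2) 1))⁻¹ := by
    rw [onTriple, mk_seq, mk_seq, mk_seq, mk_seq, mk_place, mk_place, mk_place, mk_place, mk_place,
      mk_pow, mk_V, map_pow, mul_inv_rev, ← on_sym_inv hm (by omega), ← on_sym_inv hm' (by omega)]
    simp only [mul_assoc]
    rfl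
  rw [e, ← conj_pow]
  congr 1
  have := ((isRot_rot (n := 3) (S := {0, 1, 2}) ⟨0, by simp⟩).map_on hi).conj
    (lin_le_aff _ (mul_mem (on_lin hm (sym_mem_lin _ _)) (on_lin hm' (sym_mem_lin _ _))))
  apply IsRot.eq_rot
  convert this using 2 with x
  rw [Finset.sum_insert (by simp [h.1.ne, (h.1.trans h.2).ne]), Finset.sum_pair h.2.ne,
    Finset.sum_insert (by decide), Finset.sum_pair (by decide)]
  simp only [act_mul]
  congr 1
  · rw [act_on, dif_neg (by simp), act_on, dif_neg (by simp)]; rfl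
  · congr 1
    · rw [act_on, dif_neg (by simp), act_on, dif_pos (by simp), act_sym, dif_pos (by simp)]
      congr 1; ext; simp; omega
    · rw [act_on, dif_pos (by simp), act_sym, dif_pos (by simp), act_on, dif_neg (by simp; omega)]
      congr 1; ext; simp; omega

/-- The products of parity phase gates on at most `c` wires. -/
noncomputable def LowRot (n c : ℕ) : Submonoid (CircuitClass n) :=
  Submonoid.closure {g | ∃ S : Finset (Fin n), S.card ≤ c ∧ g = rot S}

lemma rot_mem_lowRot {n c : ℕ} {S : Finset (Fin n)} (h : S.card ≤ c) : rot S ∈ LowRot n c :=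
  Submonoid.subset_closure ⟨S, h, rfl⟩

/-- Transport along the increasing enumeration of `S` reduces a relation for an arbitrary set of
wires to the given relation on adjacent wires. -/
lemma rot_pow_mem_of_univ {n c m : ℕ} {S : Finset (Fin n)}
    (h : rot (Finset.univ : Finset (Fin S.card)) ^ m ∈ LowRot S.card c) :
    rot S ^ m ∈ LowRot n c := by
  obtain ⟨φ, hφ⟩ := exists_transport (S.orderEmbOfFin rfl).toEmbedding
  have e : φ (rot Finset.univ) = rot S := by
    rw [hφ]; congr 1; exact S.map_orderEmbOfFin_univ rfl
  rw [← e, ← map_pow]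
  suffices key : ∀ g ∈ LowRot S.card c, φ g ∈ LowRot n c from key _ h
  intro g hg
  induction hg using Submonoid.closure_induction with
  | mem x hx =>
    obtain ⟨S, hS, rfl⟩ := hx
    rw [hφ]; exact rot_mem_lowRot (by rwa [Finset.card_map])
  | one => rw [map_one]; exact one_mem _
  | mul x y _ _ hx hy => rw [map_mul]; exact mul_mem hx hy

lemma rot_two_pow : rot (Finset.univ : Finset (Fin 2)) ^ 4 ∈ LowRot 2 1 := by
  have := mk_eq_mk.2 (Derivable.rel .R8)
  rw [mk_pow, mk_U, mk_tensor, mk_pow, ten_eq_on, map_pow, map_pow] at this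
  rw [show (Finset.univ : Finset (Fin 2)) = {0, 1} from rfl, this]
  have h : ∀ i : Fin 2, tg i ∈ LowRot 2 1 := fun i => by
    rw [← rot_singleton]; exact rot_mem_lowRot (by simp)
  exact mul_mem (pow_mem (h 0) 4) (pow_mem (h 1) 4)

lemma rot_three_pow : rot (Finset.univ : Finset (Fin 3)) ^ 2 ∈ LowRot 3 2 := by
  have := mk_eq_mk.2 (Derivable.rel .R9)
  rw [mk_pow, mk_V] at this
  rw [show (Finset.univ : Finset (Fin 3)) = {0, 1, 2} from rfl, this]
  have h : ∀ i : Fin 3, tg i ∈ LowRot 3 2 := fun i => by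
    rw [← rot_singleton]; exact rot_mem_lowRot (by simp)
  have h2 : ∀ i j : Fin 3, rot {i, j} ∈ LowRot 3 2 := fun i j =>
    rot_mem_lowRot (Finset.card_le_two)
  simp only [mk_seq, mk_onPair_pow]
  refine mul_mem (mul_mem (mul_mem ?_ (pow_mem (h2 _ _) _)) (pow_mem (h2 _ _) _))
    (pow_mem (h2 _ _) _)
  rw [mk_tensor, mk_tensor, mk_pow, ten_eq_on, ten_eq_on, map_mul, on_on, on_on, map_pow, map_pow,
    map_pow]
  exact mul_mem (mul_mem (pow_mem (h 0) _) (pow_mem (h 1) _)) (pow_mem (h 2) _)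

/-- On the left of `R13` a CNOT on the top two wires conjugates `V` on the lower three, which adds
the top bit to the parity. The exponent 1 gives the statement the shape needed by
`rot_pow_mem_of_univ`. -/
lemma rot_four_mem : rot (Finset.univ : Finset (Fin 4)) ^ 1 ∈ LowRot 4 3 := by
  have := mk_eq_mk.2 (Derivable.rel .R13)
  have hV : mk V = mk (Circuit.pow V 1) := by rw [mk_pow, pow_one]
  have e : mk ((CNOT ⊠ wires 2) ⨾ (wires 1 ⊠ V :) ⨾ (CNOT ⊠ wires 2)) =
      rot (Finset.univ : Finset (Fin 4)) ^ 1 := by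
    have hinv : on (n := 4) 0 (by omega) gC = (on 0 (by omega) gC)⁻¹ := by
      rw [← map_inv, inv_eq_of_mul_eq_one_right gC_sq]
    have h := ((isRot_rot (n := 3) (S := {0, 1, 2}) ⟨0, by simp⟩).map_on (n := 4) (i := 1)
      (by omega)).conj (lin_le_aff _ (on_mem_lin (n := 4) (i := 0) (by omega) (Or.inr rfl)))
    have e0 : mk ((CNOT ⊠ wires 2) ⨾ (wires 1 ⊠ V :) ⨾ (CNOT ⊠ wires 2)) =
        on 0 (by omega) gC * on (k := 3) 1 (by omega) (rot {0, 1, 2}) * on 0 (by omega) gC := by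
      simp only [mk_seq, mk_tensor, mk_wires, mk_V, one_ten_eq_on, ten_one_eq_on]
      rfl
    rw [pow_one, e0]
    refine IsRot.eq_rot ?_
    rw [← hinv] at h
    convert h using 2 with x
    rw [Finset.sum_insert (by decide), Finset.sum_pair (by decide)]
    simp only [act_on_two, act_gC]
    simp [Fin.sum_univ_succ, add_assoc]
  rw [← e, this]
  have h : ∀ i : Fin 4, tg i ∈ LowRot 4 3 := fun i => by
    rw [← rot_singleton]; exact rot_mem_lowRot (by simp)
  have h2 : ∀ (i j : Fin 4) (k : ℕ), rot {i, j} ^ k ∈ LowRot 4 3 := fun i j k =>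
    pow_mem (rot_mem_lowRot (Finset.card_le_two.trans (by omega))) k
  have h3 : ∀ (i j k : Fin 4) (h : i < j ∧ j < k), mk (onTriple i j k h V) ∈ LowRot 4 3 :=
    fun i j k h => by
      have := mk_onTriple_pow i j k h 1
      rw [pow_one] at this
      have e : mk (onTriple i j k h V) = mk (onTriple i j k h (Circuit.pow V 1)) := by
        simp only [onTriple, mk_seq, mk_place, hV]
      rw [e, this]
      exact rot_mem_lowRot Finset.card_le_three
  simp only [mk_seq, mk_onPair_pow]
  refine mul_mem (mul_mem (mul_mem (mul_mem (mul_mem (mul_mem (mul_mem (mul_mem (mul_mem (mul_mem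
    ?_ (h2 _ _ _)) (h2 _ _ _)) (h2 _ _ _)) (h2 _ _ _)) (h2 _ _ _)) (h2 _ _ _)) (h3 _ _ _ _))
    (h3 _ _ _ _)) (h3 _ _ _ _)) (h3 _ _ _ _)
  rw [mk_tensor, mk_tensor, mk_tensor, mk_pow, ten_eq_on, ten_eq_on, ten_eq_on, map_mul, map_mul,
    map_mul, on_on, on_on, on_on, on_on, on_on, map_pow, map_pow, map_pow, map_pow]
  exact mul_mem (mul_mem (mul_mem (pow_mem (h 0) _) (pow_mem (h 1) _)) (pow_mem (h 2) _))
    (pow_mem (h 3) _)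

lemma rot_pow_four_mem {n : ℕ} {S : Finset (Fin n)} (h : S.card = 2) : rot S ^ 4 ∈ LowRot n 1 :=
  rot_pow_mem_of_univ (by rw [h]; exact rot_two_pow)

lemma rot_pow_two_mem {n : ℕ} {S : Finset (Fin n)} (h : S.card = 3) : rot S ^ 2 ∈ LowRot n 2 :=
  rot_pow_mem_of_univ (by rw [h]; exact rot_three_pow)

lemma rot_mem_lowRot_three {n : ℕ} {S : Finset (Fin n)} (h : S.card ≤ 4) : rot S ∈ LowRot n 3 := by
  rcases h.lt_or_eq with h | h
  · exact rot_mem_lowRot (by omega)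
  · have : rot S ^ 1 ∈ LowRot n 3 := rot_pow_mem_of_univ (by rw [h]; exact rot_four_mem)
    rwa [pow_one] at this

/-! ### Diagonal circuits are normalised by affine circuits -/

/-- The classes of diagonal circuits. -/
noncomputable def Diag (n : ℕ) : Submonoid (CircuitClass n) :=
  Submonoid.closure ({wg n} ∪ {g | ∃ S : Finset (Fin n), S.card ≤ 3 ∧ g = rot S})

lemma lowRot_le_diag (n : ℕ) : LowRot n 3 ≤ Diag n := Submonoid.closure_mono Set.subset_union_right

lemma wg_mem_diag (n : ℕ) : wg n ∈ Diag n := Submonoid.subset_closure (Or.inl rfl)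

/-- SWAP permutes the wires of `S`. CNOT changes nothing unless its target lies in `S`, in which
case it toggles the membership of the control. The set may then grow to four wires, which is where
`R13` enters through `rot_mem_lowRot_three`. -/
lemma conj_gate_mem_diag {n i : ℕ} (h : i + 2 ≤ n) {g : CircuitClass 2} (hg : g ∈ linGates)
    {S : Finset (Fin n)} (hS : S.Nonempty) (hS' : S.card ≤ 3) :
    on i h g * rot S * (on i h g)⁻¹ ∈ Diag n := by
  have hA : on i h g ∈ Aff n := lin_le_aff _ (on_mem_lin h hg)
  rcases hg with rfl | rfl
  · rw [conj_rot hS hA (S' := S.map (Equiv.swap ⟨i, by omega⟩ ⟨i + 1, by omega⟩).toEmbedding)]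
    · exact lowRot_le_diag n (rot_mem_lowRot (by rwa [Finset.card_map]))
    · intro x
      rw [Finset.sum_map, act_on_gS]; rfl
  · have act_C : ∀ x, act (on i h gC) x = Function.update x ⟨i + 1, by omega⟩
        (x ⟨i + 1, by omega⟩ + x ⟨i, by omega⟩) := by
      intro x
      ext j : 1
      rw [act_on_two, act_gC]
      split_ifs with h1 h2
      · rw [Function.update_of_ne (by simp [Fin.ext_iff]; omega)]
        exact congrArg x (Fin.ext h1.symm)
      · rw [show j = ⟨i + 1, by omega⟩ from Fin.ext h2, Function.update_self]
        exact add_comm _ _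
      · rw [Function.update_of_ne (by simpa [Fin.ext_iff])]
    by_cases h1 : (⟨i + 1, by omega⟩ : Fin n) ∈ S
    · have sum_C : ∀ x, ∑ k ∈ S, act (on i h gC) x k = (∑ k ∈ S, x k) + x ⟨i, by omega⟩ := by
        intro x
        rw [act_C, Finset.sum_update_of_mem h1, ← Finset.erase_eq, ← Finset.add_sum_erase S x h1]
        ring
      by_cases h0 : (⟨i, by omega⟩ : Fin n) ∈ S
      · rw [conj_rot hS hA (S' := S.erase ⟨i, by omega⟩)]
        · exact lowRot_le_diag n (rot_mem_lowRot ((Finset.card_erase_le).trans hS'))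
        · intro x
          rw [sum_C, ← Finset.add_sum_erase S x h0]
          generalize x ⟨i, _⟩ = c
          generalize ∑ k ∈ S.erase ⟨i, _⟩, x k = d
          fin_cases c <;> fin_cases d <;> rfl
      · rw [conj_rot hS hA (S' := insert ⟨i, by omega⟩ S)]
        · exact lowRot_le_diag n (rot_mem_lowRot_three
            ((Finset.card_insert_le _ _).trans (by omega)))
        · intro x
          rw [sum_C, Finset.sum_insert h0, add_comm]
    · rw [conj_rot hS hA (S' := S)]
      · exact lowRot_le_diag n (rot_mem_lowRot hS')
      · intro x
        refine Finset.sum_congr rfl fun k hk => ?_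
        rw [act_C, Function.update_of_ne (ne_of_mem_of_not_mem hk h1)]

/-- If wire `i` lies in `S`, the parity is collected on that wire by a circuit `c` that commutes
with the X gate by `aff_ext`. Relation `R11` then gives `wg n * rot S ^ 7`. If wire `i` is not in
`S`, the parity is unchanged. -/
lemma conj_gX_mem_diag {n i : ℕ} (h : i + 1 ≤ n) {S : Finset (Fin n)} (hS : S.Nonempty)
    (hS' : S.card ≤ 3) : on i h gX * rot S * (on i h gX)⁻¹ ∈ Diag n := by
  have hA : on i h gX ∈ Aff n := on_gX_mem_aff h
  have act_X : ∀ x, act (on i h gX) x = Function.update x ⟨i, h⟩ (x ⟨i, h⟩ + 1) := by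
    intro x
    ext j : 1
    rw [act_on]
    split_ifs with h1
    · obtain rfl : j = ⟨i, h⟩ := Fin.ext (by simp; omega)
      rw [Function.update_self]; rfl
    · rw [Function.update_of_ne (by rintro rfl; exact h1 ⟨le_rfl, by simp⟩)]
  by_cases h1 : (⟨i, h⟩ : Fin n) ∈ S
  · obtain ⟨c, hc, ac⟩ := exists_add ⟨i, h⟩ (S.erase ⟨i, h⟩) (Finset.notMem_erase _ S) 0
    have hr : IsRot (c * tg ⟨i, h⟩ * c⁻¹) fun x => ∑ k ∈ S, x k :=
      ⟨c, hc, _, rfl, fun x => by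
        rw [ac, Function.update_self, Finset.add_sum_erase S x h1, add_zero]⟩
    have comm : on i h gX * c = c * on i h gX := by
      refine aff_ext (mul_mem hA hc) (mul_mem hc hA) fun x => ?_
      rw [act_mul, act_mul, act_X, act_X, ac, ac, Function.update_idem, Function.update_idem,
        Function.update_self, Function.update_self,
        Finset.sum_congr rfl fun j hj => Function.update_of_ne (Finset.ne_of_mem_erase hj) _ x]
      congr 1; ring
    have e : on i h gX * rot S * (on i h gX)⁻¹ = wg n * rot S ^ 7 := by
      have hT : on i h gX * tg ⟨i, h⟩ * (on i h gX)⁻¹ = wg n * tg ⟨i, h⟩ ^ 7 := gX_conj_tg _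
      rw [← hr.eq_rot, conj_pow]
      calc on i h gX * (c * tg ⟨i, h⟩ * c⁻¹) * (on i h gX)⁻¹
          = on i h gX * c * tg ⟨i, h⟩ * (on i h gX * c)⁻¹ := by group
        _ = c * (on i h gX * tg ⟨i, h⟩ * (on i h gX)⁻¹) * c⁻¹ := by rw [comm]; group
        _ = c * wg n * tg ⟨i, h⟩ ^ 7 * c⁻¹ := by rw [hT]; simp only [mul_assoc]
        _ = _ := by rw [← (wg_comm c).eq]; simp only [mul_assoc]
    rw [e]
    exact mul_mem (wg_mem_diag n) (pow_mem (lowRot_le_diag n (rot_mem_lowRot hS')) 7)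
  · rw [conj_rot hS hA (S' := S)]
    · exact lowRot_le_diag n (rot_mem_lowRot hS')
    · intro x
      refine Finset.sum_congr rfl fun k hk => ?_
      rw [act_X, Function.update_of_ne (ne_of_mem_of_not_mem hk h1)]

lemma conj_mem_diag {n : ℕ} {a : CircuitClass n} (ha : a ∈ Aff n) {d : CircuitClass n}
    (hd : d ∈ Diag n) : a * d * a⁻¹ ∈ Diag n := by
  induction ha using Submonoid.closure_induction generalizing d with
  | mem a ha =>
    induction hd using Submonoid.closure_induction with
    | mem d hd =>
      rcases hd with rfl | ⟨S, hS', rfl⟩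
      · rw [← (wg_comm a).eq, mul_inv_cancel_right]; exact wg_mem_diag n
      · rcases S.eq_empty_or_nonempty with rfl | hS
        · rw [rot_empty, mul_one, mul_inv_cancel]; exact one_mem _
        · rcases ha with ⟨i, h, g, hg, rfl⟩ | ⟨i, h, rfl⟩
          · exact conj_gate_mem_diag h hg hS hS'
          · exact conj_gX_mem_diag h hS hS'
    | one => rw [mul_one, mul_inv_cancel]; exact one_mem _
    | mul x y _ _ hx hy =>
      have : a * (x * y) * a⁻¹ = (a * x * a⁻¹) * (a * y * a⁻¹) := by group
      rw [this]; exact mul_mem hx hy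
  | one => rwa [one_mul, inv_one, mul_one]
  | mul x y _ _ hx hy =>
    have : x * y * d * (x * y)⁻¹ = x * (y * d * y⁻¹) * x⁻¹ := by group
    rw [this]; exact hx (hy hd)

/-- The classes of circuits generated by gates on adjacent wires. -/
noncomputable def Gen (n : ℕ) : Submonoid (CircuitClass n) :=
  Submonoid.closure ((Aff n : Set (CircuitClass n)) ∪ ({wg n} ∪ Set.range tg))

lemma aff_le_gen (n : ℕ) : Aff n ≤ Gen n := fun _ h => Submonoid.subset_closure (Or.inl h)

lemma on_gen {k n i : ℕ} (h : i + k ≤ n) {a : CircuitClass k} (ha : a ∈ Gen k) :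
    on i h a ∈ Gen n := by
  induction ha using Submonoid.closure_induction with
  | mem x hx =>
    rcases hx with hx | rfl | ⟨j, rfl⟩
    · exact aff_le_gen _ (on_aff h hx)
    · rw [on_wg]; exact Submonoid.subset_closure (Or.inr (Or.inl rfl))
    · rw [tg, on_on]
      exact Submonoid.subset_closure (Or.inr (Or.inr ⟨⟨i + j, by omega⟩, rfl⟩))
  | one => rw [map_one]; exact one_mem _
  | mul x y _ _ hx hy => rw [map_mul]; exact mul_mem hx hy

lemma mem_gen {n : ℕ} (a : CircuitClass n) : a ∈ Gen n := by
  obtain ⟨C, rfl⟩ := mk_surjective a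
  induction C with
  | wires n => exact one_mem _
  | seq C D hC hD => exact mul_mem hC hD
  | tensor C D hC hD => rw [mk_tensor, ten_eq_on]; exact mul_mem (on_gen _ hC) (on_gen _ hD)
  | symm m n => exact aff_le_gen _ (lin_le_aff _ (sym_mem_lin m n))
  | omega =>
    have : mk omega = wg 0 := (on_self _ _).symm
    rw [this]; exact Submonoid.subset_closure (Or.inr (Or.inl rfl))
  | X =>
    have : mk X = on 0 (by omega) gX := (on_self _ _).symm
    rw [this]; exact aff_le_gen _ (on_gX_mem_aff _)
  | T =>
    have : mk T = tg 0 := (on_self _ _).symm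
    rw [this]; exact Submonoid.subset_closure (Or.inr (Or.inr ⟨0, rfl⟩))
  | CNOT =>
    have : mk CNOT = on 0 (by omega) gC := (on_self _ _).symm
    rw [this]; exact aff_le_gen _ (lin_le_aff _ (on_mem_lin _ (Or.inr rfl)))

/-- Every circuit is a diagonal circuit followed by a circuit of SWAP, CNOT and X gates. -/
theorem exists_diag_mul_aff {n : ℕ} (a : CircuitClass n) :
    ∃ d ∈ Diag n, ∃ b ∈ Aff n, a = d * b := by
  have ha := mem_gen a
  induction ha using Submonoid.closure_induction_right with
  | one => exact ⟨1, one_mem _, 1, one_mem _, (mul_one 1).symm⟩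
  | mul_right a _ y hy ih =>
    obtain ⟨d, hd, b, hb, rfl⟩ := ih
    have key : ∀ y ∈ Diag n, ∃ d' ∈ Diag n, ∃ b' ∈ Aff n, d * b * y = d' * b' := fun y hy =>
      ⟨d * (b * y * b⁻¹), mul_mem hd (conj_mem_diag hb hy), b, hb, by group⟩
    rcases hy with hy | rfl | ⟨j, rfl⟩
    · exact ⟨d, hd, b * y, mul_mem hb hy, mul_assoc _ _ _⟩
    · exact key _ (wg_mem_diag n)
    · refine key _ (lowRot_le_diag n ?_)
      rw [← rot_singleton]; exact rot_mem_lowRot (by simp)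

end CircuitClass

/-! ### Existence of diagonal normal forms -/

/-- In a commutative monoid, exponents of generators `v i` can be reduced modulo `m` if the powers
`v i ^ m` lie in a submonoid of the other factors. -/
lemma exists_reduced_exponents {Q ι : Type*} [CommMonoid Q] [Fintype ι] (v : ι → Q) (m : ℕ)
    [NeZero m] (N : Submonoid Q) (hv : ∀ i, v i ^ m ∈ N) {x : Q}
    (hx : x ∈ N ⊔ Submonoid.closure (Set.range v)) :
    ∃ g ∈ N, ∃ c : ι → Fin m, x = g * ∏ i, v i ^ (c i : ℕ) := by
  obtain ⟨g, hg, h, hh, rfl⟩ := Submonoid.mem_sup.1 hx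
  obtain ⟨a, rfl⟩ := Submonoid.exists_of_mem_closure_range v h hh
  refine ⟨g * ∏ i, (v i ^ m) ^ (a i / m), mul_mem hg (prod_mem fun i _ => pow_mem (hv i) _),
    fun i => Fin.ofNat m (a i), ?_⟩
  rw [mul_assoc, ← Finset.prod_mul_distrib]
  congr 1
  refine Finset.prod_congr rfl fun i _ => ?_
  rw [← pow_mul, ← pow_add, Fin.val_ofNat, Nat.div_add_mod]

/-- Turns products over increasing pairs or triples into iterated products over all indices,
matching the lists in `uTriangle` and `vTriangle`, to which the other indices contribute nothing. -/
lemma prod_subtype_eq_prod_dite {M ι : Type*} [CommMonoid M] [Fintype ι] (p : ι → Prop)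
    [DecidablePred p] (f : {i // p i} → M) :
    ∏ i, f i = ∏ i, if h : p i then f ⟨i, h⟩ else 1 := by
  rw [← Fintype.prod_subtype_mul_prod_subtype p]
  have e : ∀ i : {i // ¬ p i}, (if h : p i then f ⟨i, h⟩ else 1) = 1 := fun i => dif_neg i.2
  rw [Finset.prod_eq_one fun i _ => e i, mul_one]
  exact Finset.prod_congr rfl fun i _ => by rw [dif_pos i.2]

namespace CircuitClass

noncomputable instance diagCommMonoid (n : ℕ) : CommMonoid (Diag n) where
  mul_comm := by
    have h : ∀ a ∈ ({wg n} ∪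
        {g | ∃ S : Finset (Fin n), S.card ≤ 3 ∧ g = rot S} : Set (CircuitClass n)),
        ∀ b ∈ ({wg n} ∪ {g | ∃ S : Finset (Fin n), S.card ≤ 3 ∧ g = rot S} : Set (CircuitClass n)),
        a * b = b * a := by
      rintro a (rfl | ⟨S, -, rfl⟩) b (rfl | ⟨S', -, rfl⟩)
      · rfl
      · exact wg_comm _
      · exact (wg_comm _).symm
      · exact rot_commute _ _
    have : IsMulCommutative (Diag n) := Submonoid.isMulCommutative_closure _ h
    intro a b
    exact Subtype.ext (setLike_mul_comm (s := Diag n) a.2 b.2)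

variable {n : ℕ}

/-- The scalar `ω` as a diagonal circuit. -/
noncomputable def dw (n : ℕ) : Diag n := ⟨wg n, wg_mem_diag n⟩

/-- A parity phase gate on at most three wires as a diagonal circuit. -/
noncomputable def drot (S : Finset (Fin n)) (h : S.card ≤ 3) : Diag n :=
  ⟨rot S, lowRot_le_diag n (rot_mem_lowRot h)⟩

/-- The `T` gates as diagonal circuits. -/
noncomputable def dt (i : Fin n) : Diag n := drot {i} (by simp)

/-- The `U` gates as diagonal circuits. -/
noncomputable def du (p : {p : Fin n × Fin n // p.1 < p.2}) : Diag n :=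
  drot {p.1.1, p.1.2} (Finset.card_le_two.trans (by omega))

/-- The `V` gates as diagonal circuits. -/
noncomputable def dv (p : {p : Fin n × Fin n × Fin n // p.1 < p.2.1 ∧ p.2.1 < p.2.2}) : Diag n :=
  drot {p.1.1, p.1.2.1, p.1.2.2} Finset.card_le_three

/-- The diagonal circuit with given exponents. -/
noncomputable def diagProd (N : DiagonalNF n) : Diag n :=
  ((dw n ^ (N.omegaDeg : ℕ) * ∏ i, dt i ^ (N.tDeg i : ℕ)) * ∏ p, du p ^ (N.uDeg p : ℕ)) *
    ∏ p, dv p ^ (N.vDeg p : ℕ)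

lemma coe_prod (f : Fin n → Diag n) :
    ((∏ i, f i : Diag n) : CircuitClass n) =
      ((List.finRange n).map fun i => (f i : CircuitClass n)).prod := by
  rw [Fin.prod_univ_def]
  exact (map_list_prod (Diag n).subtype _).trans (by rw [List.map_map]; rfl)

lemma mk_seqList_flatMap {ι : Type*} {k : ℕ} (l : List ι) (f : ι → List (Circuit k)) :
    mk (seqList (l.flatMap f)) = (l.map fun i => mk (seqList (f i))).prod := by
  induction l with
  | nil => rfl
  | cons a l ih =>
    rw [List.flatMap_cons, mk_seqList, List.map_append, List.prod_append, ← mk_seqList,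
      ← mk_seqList, ih, List.map_cons, List.prod_cons]

lemma mk_uTriangle (b : {p : Fin n × Fin n // p.1 < p.2} → Fin 4) :
    mk (uTriangle b) = (∏ p, du p ^ (b p : ℕ) : Diag n) := by
  have e : ∏ p, du p ^ (b p : ℕ) =
      ∏ i : Fin n, ∏ j : Fin n, if h : i < j then du ⟨(i, j), h⟩ ^ (b ⟨(i, j), h⟩ : ℕ) else 1 := by
    rw [prod_subtype_eq_prod_dite, Fintype.prod_prod_type]
  rw [e, coe_prod, uTriangle, mk_seqList_flatMap]
  congr 2
  ext i : 1
  rw [coe_prod, mk_seqList_flatMap]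
  congr 2
  ext j : 1
  split_ifs with h
  · rw [mk_seqList, List.map_cons, List.map_nil, List.prod_cons, List.prod_nil, mul_one,
      mk_onPair_pow]; rfl
  · rfl

lemma mk_vTriangle (c : {p : Fin n × Fin n × Fin n // p.1 < p.2.1 ∧ p.2.1 < p.2.2} → Fin 2) :
    mk (vTriangle c) = (∏ p, dv p ^ (c p : ℕ) : Diag n) := by
  have e : ∏ p, dv p ^ (c p : ℕ) =
      ∏ i : Fin n, ∏ j : Fin n, ∏ k : Fin n, if h : i < j ∧ j < k then
        dv ⟨(i, j, k), h⟩ ^ (c ⟨(i, j, k), h⟩ : ℕ) else 1 := by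
    rw [prod_subtype_eq_prod_dite, Fintype.prod_prod_type]
    exact Finset.prod_congr rfl fun i _ => Fintype.prod_prod_type _
  rw [e, coe_prod, vTriangle, mk_seqList_flatMap]
  congr 2
  ext i : 1
  rw [coe_prod, mk_seqList_flatMap]
  congr 2
  ext j : 1
  rw [coe_prod, mk_seqList_flatMap]
  congr 2
  ext k : 1
  split_ifs with h
  · rw [mk_seqList, List.map_cons, List.map_nil, List.prod_cons, List.prod_nil, mul_one,
      mk_onTriple_pow]; rfl
  · rfl

lemma mk_diagonalNF (N : DiagonalNF n) : mk N.circuit = (diagProd N : CircuitClass n) := by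
  rw [DiagonalNF.circuit, scalar, mk_cast, mk_tensor, ten_eq_on, map_mul, castHom_on, castHom_on,
    on_self, mk_seq, mk_seq, mk_uTriangle, mk_vTriangle, mk_layer, lay_eq_prod, mk_pow, map_pow,
    diagProd, Submonoid.coe_mul, Submonoid.coe_mul, Submonoid.coe_mul, coe_prod]
  simp only [← mul_assoc]
  congr 3
  congr 2
  ext i : 1
  exact congrArg (· ^ (N.tDeg i : ℕ)) (rot_singleton i).symm

end CircuitClass

lemma exists_lt_lt_of_card_eq_three {ι : Type*} [LinearOrder ι] {S : Finset ι} (h : S.card = 3) :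
    ∃ i j k, (i < j ∧ j < k) ∧ S = {i, j, k} := by
  let f := S.orderEmbOfFin h
  refine ⟨f 0, f 1, f 2, ⟨f.strictMono (by decide), f.strictMono (by decide)⟩, ?_⟩
  ext x
  have hx : x ∈ S ↔ ∃ t, f t = x := by
    rw [← Finset.mem_coe, ← S.range_orderEmbOfFin h]; rfl
  rw [hx]
  simp [Fin.exists_fin_succ, eq_comm (b := x)]

namespace CircuitClass

variable {n : ℕ}

/-- The submonoid of diagonal circuits generated by `ω` and the `T` gates. -/
noncomputable def diagT (n : ℕ) : Submonoid (Diag n) :=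
  -- The scalar is treated as a family indexed by `Unit` over the trivial submonoid, so that
  -- `exists_reduced_exponents` applies to it as well.
  (⊥ ⊔ Submonoid.closure (Set.range fun _ : Unit => dw n)) ⊔ Submonoid.closure (Set.range dt)

/-- The submonoid of diagonal circuits generated by `ω`, the `T` gates and the `U` gates. -/
noncomputable def diagU (n : ℕ) : Submonoid (Diag n) :=
  diagT n ⊔ Submonoid.closure (Set.range du)

/-- The submonoid of diagonal circuits generated by `ω` and the `T`, `U` and `V` gates. -/
noncomputable def diagV (n : ℕ) : Submonoid (Diag n) :=
  diagU n ⊔ Submonoid.closure (Set.range dv)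

lemma drot_mem_diagT {S : Finset (Fin n)} (h : S.card ≤ 3) (hS : S.card ≤ 1) :
    drot S h ∈ diagT n := by
  rcases Nat.le_one_iff_eq_zero_or_eq_one.1 hS with h0 | h1
  · obtain rfl := Finset.card_eq_zero.1 h0
    have : drot (∅ : Finset (Fin n)) h = 1 := Subtype.ext rot_empty
    rw [this]; exact one_mem _
  · obtain ⟨i, rfl⟩ := Finset.card_eq_one.1 h1
    exact Submonoid.mem_sup_right (Submonoid.subset_closure ⟨i, rfl⟩)

lemma drot_mem_diagU {S : Finset (Fin n)} (h : S.card ≤ 3) (hS : S.card ≤ 2) :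
    drot S h ∈ diagU n := by
  rcases Nat.le_or_eq_of_le_succ hS with h1 | h2
  · exact Submonoid.mem_sup_left (drot_mem_diagT h h1)
  · obtain ⟨i, j, hij, rfl⟩ := Finset.card_eq_two.1 h2
    refine Submonoid.mem_sup_right (Submonoid.subset_closure ?_)
    rcases lt_or_gt_of_ne hij with h' | h'
    · exact ⟨⟨(i, j), h'⟩, rfl⟩
    · exact ⟨⟨(j, i), h'⟩, Subtype.ext (congrArg rot (Finset.pair_comm j i))⟩

lemma drot_mem_diagV {S : Finset (Fin n)} (h : S.card ≤ 3) : drot S h ∈ diagV n := by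
  rcases Nat.le_or_eq_of_le_succ h with h2 | h3
  · exact Submonoid.mem_sup_left (drot_mem_diagU h h2)
  · obtain ⟨i, j, k, hijk, rfl⟩ := exists_lt_lt_of_card_eq_three h3
    exact Submonoid.mem_sup_right (Submonoid.subset_closure ⟨⟨(i, j, k), hijk⟩, rfl⟩)

lemma mem_diagV (d : Diag n) : d ∈ diagV n := by
  obtain ⟨d, hd⟩ := d
  induction hd using Submonoid.closure_induction with
  | mem d hd =>
    rcases hd with rfl | ⟨S, hS, rfl⟩
    · exact Submonoid.mem_sup_left (Submonoid.mem_sup_left (Submonoid.mem_sup_left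
        (Submonoid.mem_sup_right (Submonoid.subset_closure ⟨(), rfl⟩))))
    · exact drot_mem_diagV hS
  | one => exact one_mem _
  | mul x y hx hy ihx ihy => exact mul_mem ihx ihy

/-- Brings the memberships derived from `R8` and `R9` in the full circuit group back into the
commutative monoid `Diag n`. -/
lemma mem_of_coe_mem_lowRot {c : ℕ} (N : Submonoid (Diag n))
    (hN : ∀ (S : Finset (Fin n)) (h : S.card ≤ 3), S.card ≤ c → drot S h ∈ N) (hc : c ≤ 3)
    {d : Diag n} (hd : (d : CircuitClass n) ∈ LowRot n c) : d ∈ N := by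
  have key : LowRot n c ≤ N.map (Diag n).subtype := by
    refine Submonoid.closure_le.2 ?_
    rintro _ ⟨S, hS, rfl⟩
    exact ⟨drot S (hS.trans hc), hN S _ hS, rfl⟩
  obtain ⟨e, he, h⟩ := key hd
  rwa [← Subtype.ext h]

lemma coe_drot_pow (S : Finset (Fin n)) (h : S.card ≤ 3) (m : ℕ) :
    ((drot S h ^ m : Diag n) : CircuitClass n) = rot S ^ m := SubmonoidClass.coe_pow _ _

lemma dv_pow_two_mem (p : {p : Fin n × Fin n × Fin n // p.1 < p.2.1 ∧ p.2.1 < p.2.2}) :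
    dv p ^ 2 ∈ diagU n := by
  refine mem_of_coe_mem_lowRot (c := 2) _ (fun S h => drot_mem_diagU h) (by omega) ?_
  rw [dv, coe_drot_pow]
  exact rot_pow_two_mem (Finset.card_eq_three.2
    ⟨_, _, _, p.2.1.ne, (p.2.1.trans p.2.2).ne, p.2.2.ne, rfl⟩)

lemma du_pow_four_mem (p : {p : Fin n × Fin n // p.1 < p.2}) : du p ^ 4 ∈ diagT n := by
  refine mem_of_coe_mem_lowRot (c := 1) _ (fun S h => drot_mem_diagT h) (by omega) ?_
  rw [du, coe_drot_pow]
  exact rot_pow_four_mem (Finset.card_pair p.2.ne)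

lemma dt_pow_eight (i : Fin n) : dt i ^ 8 = 1 := by
  refine Subtype.ext ?_
  rw [dt, coe_drot_pow, rot_pow_eight]; rfl

lemma dw_pow_eight : dw n ^ 8 = 1 := by
  refine Subtype.ext ?_
  rw [SubmonoidClass.coe_pow]
  exact wg_pow_eight n

/-- Every diagonal circuit has a diagonal normal form. -/
theorem exists_diagonalNF (d : Diag n) : ∃ N : DiagonalNF n, d = diagProd N := by
  -- Reducing the exponents of one kind of gate only affects the kinds treated later, so the order
  -- `V`, `U`, `T`, `ω` needs a single pass.
  obtain ⟨d₂, h₂, c, ec⟩ := exists_reduced_exponents dv 2 (diagU n) dv_pow_two_mem (mem_diagV d)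
  obtain ⟨d₁, h₁, b, eb⟩ := exists_reduced_exponents du 4 (diagT n) du_pow_four_mem h₂
  obtain ⟨d₀, h₀, a, ea⟩ := exists_reduced_exponents dt 8 _ (fun i => by
    rw [dt_pow_eight]; exact one_mem _) h₁
  obtain ⟨d', h', k, ek⟩ := exists_reduced_exponents (fun _ : Unit => dw n) 8 ⊥ (fun i => by
    rw [dw_pow_eight]; exact one_mem _) h₀
  rw [Submonoid.mem_bot.1 h', one_mul, Fintype.prod_unique] at ek
  refine ⟨⟨k default, a, b, c⟩, ?_⟩
  rw [ec, eb, ea, ek, diagProd]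

/-! ### Uniqueness of diagonal normal forms through phase polynomials -/

lemma phase_aff {a : CircuitClass n} (ha : a ∈ Aff n) (x : Fin n → Fin 2) : phase a x = 0 := by
  induction ha using Submonoid.closure_induction generalizing x with
  | mem a ha =>
    rcases ha with ⟨i, h, g, rfl | rfl, rfl⟩ | ⟨i, h, rfl⟩ <;> rw [phase_on] <;> rfl
  | one => rfl
  | mul a b _ _ iha ihb => rw [phase_mul, iha, ihb, add_zero]

/-- The parity of the bits in `S`, as an exponent of `ω`. -/
def parity (S : Finset (Fin n)) (x : Fin n → Fin 2) : ZMod 8 := ((∑ k ∈ S, x k : Fin 2) : ℕ)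

lemma act_rot (S : Finset (Fin n)) (x : Fin n → Fin 2) : act (rot S) x = x := by
  rcases S.eq_empty_or_nonempty with rfl | hS
  · rw [rot_empty]; rfl
  · obtain ⟨a, ha, i, e, h⟩ := isRot_rot hS
    have ht : ∀ y, act (tg i) y = y := fun y => by
      ext j
      rw [tg, act_on]
      split_ifs with hj
      · rw [act_gT]; congr 2; ext; simp; omega
      · rfl
    rw [e, act_mul, act_mul, ht, act_inv_act]

lemma phase_rot (S : Finset (Fin n)) (x : Fin n → Fin 2) : phase (rot S) x = parity S x := by
  rcases S.eq_empty_or_nonempty with rfl | hS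
  · rw [rot_empty]; rfl
  · obtain ⟨a, ha, i, e, h⟩ := isRot_rot hS
    rw [e, phase_mul, phase_mul, phase_aff ha, phase_aff (inv_mem_aff ha), zero_add, add_zero,
      parity]
    refine Eq.trans ?_ (congrArg (fun b : Fin 2 => ((b : ℕ) : ZMod 8)) (h x))
    rw [tg, phase_on]
    rfl

lemma act_diag {d : CircuitClass n} (hd : d ∈ Diag n) (x : Fin n → Fin 2) : act d x = x := by
  induction hd using Submonoid.closure_induction with
  | mem d hd =>
    rcases hd with rfl | ⟨S, -, rfl⟩
    · ext j
      rw [wg, act_on, dif_neg (by omega)]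
    · exact act_rot S x
  | one => rfl
  | mul a b _ _ iha ihb => rw [act_mul, iha, ihb]

lemma phase_wg (x : Fin n → Fin 2) : phase (wg n) x = 1 := by
  rw [wg, phase_on]; rfl

/-- The phase that a diagonal circuit applies to the basis state `x`, as a homomorphism. -/
noncomputable def phaseHom (x : Fin n → Fin 2) : Diag n →* Multiplicative (ZMod 8) where
  toFun d := .ofAdd (phase (d : CircuitClass n) x)
  map_one' := rfl
  map_mul' d e := by rw [Submonoid.coe_mul, phase_mul, act_diag d.2]; rfl

/-- The phase polynomial with given coefficients. -/
noncomputable def phasePoly (w : ZMod 8) (t : Fin n → ZMod 8)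
    (u : {p : Fin n × Fin n // p.1 < p.2} → ZMod 8)
    (v : {p : Fin n × Fin n × Fin n // p.1 < p.2.1 ∧ p.2.1 < p.2.2} → ZMod 8) :
    (Fin n → Fin 2) → ZMod 8 :=
  w • 1 + ∑ i, t i • parity {i} + ∑ p, u p • parity {p.1.1, p.1.2} +
    ∑ p, v p • parity {p.1.1, p.1.2.1, p.1.2.2}

lemma phase_diagProd (N : DiagonalNF n) :
    phase (diagProd N : CircuitClass n) = phasePoly (N.omegaDeg : ℕ) (fun i => (N.tDeg i : ℕ))
      (fun p => (N.uDeg p : ℕ)) (fun p => (N.vDeg p : ℕ)) := by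
  ext x
  have h : phase (diagProd N : CircuitClass n) x = (phaseHom x (diagProd N)).toAdd := rfl
  have hr : ∀ (S : Finset (Fin n)) (hS : S.card ≤ 3),
      (phaseHom x (drot S hS)).toAdd = parity S x := fun S hS => phase_rot S x
  have hw : (phaseHom x (dw n)).toAdd = 1 := phase_wg x
  rw [h, diagProd]
  simp only [map_mul, map_prod, map_pow, toAdd_mul, toAdd_prod, toAdd_pow, dt, du, dv, hr, hw,
    phasePoly, Pi.add_apply, Finset.sum_apply, Pi.smul_apply, Pi.one_apply, nsmul_eq_mul,
    smul_eq_mul]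

/-- The basis vectors of the space of bit vectors. -/
def bvec (i : Fin n) : Fin n → Fin 2 := Pi.single i 1

lemma sum_bvec (i : Fin n) (S : Finset (Fin n)) :
    ∑ k ∈ S, bvec i k = if i ∈ S then 1 else 0 := by
  simp [bvec, Pi.single_apply]

/-- Evaluation at a bit vector. -/
def evalAt (x : Fin n → Fin 2) : ((Fin n → Fin 2) → ZMod 8) →ₗ[ZMod 8] ZMod 8 :=
  LinearMap.proj x

lemma evalAt_apply (x : Fin n → Fin 2) (f : (Fin n → Fin 2) → ZMod 8) : evalAt x f = f x := rfl

/-- The first difference at the origin. -/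
def diff₁ (i : Fin n) : ((Fin n → Fin 2) → ZMod 8) →ₗ[ZMod 8] ZMod 8 :=
  evalAt (bvec i) - evalAt 0

/-- The negative of the second difference at the origin. -/
def diff₂ (i j : Fin n) : ((Fin n → Fin 2) → ZMod 8) →ₗ[ZMod 8] ZMod 8 :=
  diff₁ i + evalAt (bvec j) - evalAt (bvec i + bvec j)

/-- The third difference at the origin. -/
def diff₃ (i j k : Fin n) : ((Fin n → Fin 2) → ZMod 8) →ₗ[ZMod 8] ZMod 8 :=
  diff₂ i j + evalAt (bvec k) - evalAt (bvec i + bvec k) -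
    evalAt (bvec j + bvec k) +
    evalAt (bvec i + bvec j + bvec k)

/-- As an integer polynomial in bits, the parity of `a`, `b`, `c` is `a + b + c - 2 * (a * b + a * c
+ b * c) + 4 * a * b * c`. The differences extract the coefficients 1, -2 and 4; the sign convention
of `diff₂` turns -2 into 2. -/
lemma diff₁_parity (i : Fin n) (S : Finset (Fin n)) :
    diff₁ i (parity S) = if i ∈ S then 1 else 0 := by
  simp only [diff₁, LinearMap.sub_apply, evalAt_apply, parity, sum_bvec,
    Pi.zero_apply, Finset.sum_const_zero]
  split_ifs <;> decide

lemma diff₂_parity (i j : Fin n) (S : Finset (Fin n)) :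
    diff₂ i j (parity S) = if i ∈ S ∧ j ∈ S then 2 else 0 := by
  simp only [diff₂, diff₁, LinearMap.sub_apply, LinearMap.add_apply, evalAt_apply, parity,
    Pi.add_apply, Finset.sum_add_distrib, sum_bvec, Pi.zero_apply,
    Finset.sum_const_zero]
  by_cases hi : i ∈ S <;> by_cases hj : j ∈ S <;> simp only [hi, hj] <;> decide

lemma diff₃_parity (i j k : Fin n) (S : Finset (Fin n)) :
    diff₃ i j k (parity S) = if i ∈ S ∧ j ∈ S ∧ k ∈ S then 4 else 0 := by
  simp only [diff₃, diff₂, diff₁, LinearMap.sub_apply, LinearMap.add_apply, evalAt_apply,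
    parity, Pi.add_apply, Finset.sum_add_distrib, sum_bvec, Pi.zero_apply,
    Finset.sum_const_zero]
  by_cases hi : i ∈ S <;> by_cases hj : j ∈ S <;> by_cases hk : k ∈ S <;>
    simp only [hi, hj, hk] <;> decide

lemma diff₁_one (i : Fin n) : diff₁ i 1 = 0 := by simp [diff₁, evalAt_apply]

lemma diff₂_one (i j : Fin n) : diff₂ i j 1 = 0 := by simp [diff₂, diff₁_one, evalAt_apply]

lemma diff₃_one (i j k : Fin n) : diff₃ i j k 1 = 0 := by simp [diff₃, diff₂_one, evalAt_apply]

/-- The difference sees only sets that contain all three wires. Among sets of at most three wires,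
listed increasingly, that is the set of the triple itself. -/
lemma diff₃_phasePoly (w : ZMod 8) (t : Fin n → ZMod 8)
    (u : {p : Fin n × Fin n // p.1 < p.2} → ZMod 8)
    (v : {p : Fin n × Fin n × Fin n // p.1 < p.2.1 ∧ p.2.1 < p.2.2} → ZMod 8)
    (q : {p : Fin n × Fin n × Fin n // p.1 < p.2.1 ∧ p.2.1 < p.2.2}) :
    diff₃ q.1.1 q.1.2.1 q.1.2.2 (phasePoly w t u v) = v q * 4 := by
  obtain ⟨⟨i, j, k⟩, hij, hjk⟩ := q
  dsimp only at hij hjk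
  simp only [phasePoly, map_add, map_sum, map_smul, diff₃_one, diff₃_parity, smul_eq_mul, mul_zero,
    zero_add]
  rw [Finset.sum_eq_zero, Finset.sum_eq_zero, Finset.sum_eq_single ⟨(i, j, k), hij, hjk⟩]
  · simp
  · rintro ⟨⟨i', j', k'⟩, hij', hjk'⟩ - hne
    dsimp only at hij' hjk'
    rw [if_neg, mul_zero]
    simp only [Finset.mem_insert, Finset.mem_singleton]
    intro h
    apply hne
    simp only [Subtype.mk.injEq, Prod.mk.injEq]
    omega
  · simp
  · rintro ⟨⟨i', j'⟩, hij'⟩ -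
    rw [if_neg, mul_zero]
    simp only [Finset.mem_insert, Finset.mem_singleton]
    omega
  · rintro i' -
    rw [if_neg, mul_zero]
    simp only [Finset.mem_singleton]
    omega

lemma diff₂_phasePoly (w : ZMod 8) (t : Fin n → ZMod 8)
    (u : {p : Fin n × Fin n // p.1 < p.2} → ZMod 8) (q : {p : Fin n × Fin n // p.1 < p.2}) :
    diff₂ q.1.1 q.1.2 (phasePoly w t u 0) = u q * 2 := by
  obtain ⟨⟨i, j⟩, hij⟩ := q
  dsimp only at hij
  simp only [phasePoly, map_add, map_sum, map_smul, diff₂_one, diff₂_parity, smul_eq_mul, mul_zero,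
    zero_add, Pi.zero_apply, zero_mul, Finset.sum_const_zero, add_zero]
  rw [Finset.sum_eq_zero, Finset.sum_eq_single ⟨(i, j), hij⟩]
  · simp
  · rintro ⟨⟨i', j'⟩, hij'⟩ - hne
    dsimp only at hij'
    rw [if_neg, mul_zero]
    simp only [Finset.mem_insert, Finset.mem_singleton]
    intro h
    apply hne
    simp only [Subtype.mk.injEq, Prod.mk.injEq]
    omega
  · simp
  · rintro i' -
    rw [if_neg, mul_zero]
    simp only [Finset.mem_singleton]
    omega

lemma diff₁_phasePoly (w : ZMod 8) (t : Fin n → ZMod 8) (i : Fin n) :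
    diff₁ i (phasePoly w t 0 0) = t i := by
  simp [phasePoly, diff₁_one, diff₁_parity]

lemma phasePoly_sub (w w' : ZMod 8) (t t' : Fin n → ZMod 8)
    (u u' : {p : Fin n × Fin n // p.1 < p.2} → ZMod 8)
    (v v' : {p : Fin n × Fin n × Fin n // p.1 < p.2.1 ∧ p.2.1 < p.2.2} → ZMod 8) :
    phasePoly w t u v - phasePoly w' t' u' v' =
      phasePoly (w - w') (t - t') (u - u') (v - v') := by
  simp only [phasePoly, sub_smul, Pi.sub_apply, Finset.sum_sub_distrib]
  abel

/-- Diagonal normal forms are determined by their phases. -/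
theorem phase_diagProd_injective {N N' : DiagonalNF n}
    (h : phase (diagProd N : CircuitClass n) = phase (diagProd N' : CircuitClass n)) :
    N = N' := by
  rw [phase_diagProd, phase_diagProd, ← sub_eq_zero, phasePoly_sub] at h
  obtain ⟨k, a, b, c⟩ := N
  obtain ⟨k', a', b', c'⟩ := N'
  dsimp only at h
  obtain rfl : c = c' := funext fun q => by
    -- The equation `(c q - c' q) * 4 = 0` in ℤ/8 decides degrees below 2. With the cubic part gone,
    -- the second difference gives `(b q - b' q) * 2 = 0`, which decides degrees below 4, and the
    -- first difference then gives the degrees of `T` themselves.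
    have := diff₃_phasePoly _ _ _ _ q ▸ congrArg (diff₃ q.1.1 q.1.2.1 q.1.2.2) h
    rw [map_zero, Pi.sub_apply] at this
    revert this; generalize c q = x; generalize c' q = y; revert x y; decide
  rw [sub_self] at h
  obtain rfl : b = b' := funext fun q => by
    have := diff₂_phasePoly _ _ _ q ▸ congrArg (diff₂ q.1.1 q.1.2) h
    rw [map_zero, Pi.sub_apply] at this
    revert this; generalize b q = x; generalize b' q = y; revert x y; decide
  rw [sub_self] at h
  obtain rfl : a = a' := funext fun q => by
    have := diff₁_phasePoly _ _ q ▸ congrArg (diff₁ q) h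
    rw [map_zero, Pi.sub_apply] at this
    revert this; generalize a q = x; generalize a' q = y; revert x y; decide
  rw [sub_self] at h
  obtain rfl : k = k' := by
    have := congrFun h 0
    simp only [phasePoly, Pi.add_apply, Pi.smul_apply, Pi.one_apply, Pi.zero_apply, zero_smul,
      Finset.sum_const_zero, add_zero, smul_eq_mul, mul_one] at this
    have key : ∀ x y : Fin 8, ((x : ℕ) : ZMod 8) - ((y : ℕ) : ZMod 8) = 0 → x = y := by decide
    exact key _ _ this
  rfl

/-! ### Normal forms of all circuits and completeness -/

lemma mk_affineNF (N : AffineNF n) :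
    mk N.circuit = ladderSeq n N.ladder * xLayer n N.xDeg := by
  rw [AffineNF.circuit, mk_seq, mk_ladders, mk_layer]; rfl

lemma affineNF_mem_aff (N : AffineNF n) : ladderSeq n N.ladder * xLayer n N.xDeg ∈ Aff n := by
  refine mul_mem (lin_le_aff _ (ladderSeq_mem_lin _ _)) ?_
  rw [xLayer, lay_eq_prod]
  refine list_prod_mem fun y hy => ?_
  obtain ⟨i, -, rfl⟩ := List.mem_map.1 hy
  exact pow_mem (on_gX_mem_aff _) _

/-- Normal forms are determined by the operators that they represent. -/
theorem normalForm_injective {N N' : DiagonalNF n × AffineNF n}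
    (ha : act (mk (N.1.circuit ⨾ N.2.circuit)) = act (mk (N'.1.circuit ⨾ N'.2.circuit)))
    (hp : phase (mk (N.1.circuit ⨾ N.2.circuit)) = phase (mk (N'.1.circuit ⨾ N'.2.circuit))) :
    N = N' := by
  obtain ⟨D, A⟩ := N
  obtain ⟨D', A'⟩ := N'
  simp only [mk_seq, mk_diagonalNF, mk_affineNF] at ha hp
  congr 1
  · apply phase_diagProd_injective
    ext x
    have := congrFun hp x
    rwa [phase_mul, phase_aff (affineNF_mem_aff A), phase_mul (diagProd D' : CircuitClass n),
      phase_aff (affineNF_mem_aff A'), add_zero, add_zero] at this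
  · have : act (ladderSeq n A.ladder * xLayer n A.xDeg) =
        act (ladderSeq n A'.ladder * xLayer n A'.xDeg) := by
      ext1 x
      have := congrFun ha x
      rwa [act_mul, act_diag (diagProd D).2, act_mul (diagProd D' : CircuitClass n),
        act_diag (diagProd D').2] at this
    obtain ⟨h1, h2⟩ := act_affine_injective this
    cases A; cases A'; cases h1; cases h2; rfl

theorem exists_normalForm (C : Circuit n) :
    ∃ N : DiagonalNF n × AffineNF n, mk C = mk (N.1.circuit ⨾ N.2.circuit) := by
  obtain ⟨d, hd, b, hb, e⟩ := exists_diag_mul_aff (mk C)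
  obtain ⟨D, hD⟩ := exists_diagonalNF ⟨d, hd⟩
  obtain ⟨L, f, rfl⟩ := exists_affineNF hb
  refine ⟨⟨D, ⟨L, f⟩⟩, ?_⟩
  rw [e, mk_seq, mk_diagonalNF, mk_affineNF, ← hD]

end CircuitClass
end CNOTDihedral

/-- Every CNOT-dihedral circuit is derivably equal to exactly one normal form `DA`, with `D` a
diagonal and `A` an affine normal form; consequently the generators and the thirteen relations
present the symmetric monoidal groupoid of CNOT-dihedral operators: every circuit is invertible up
to derivability, and two circuits are derivably equal exactly if they represent the same
operator. -/
theorem mainTheorem1 :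
    (∀ (n : ℕ) (C : CNOTDihedral.Circuit n),
      ∃! N : CNOTDihedral.DiagonalNF n × CNOTDihedral.AffineNF n,
        CNOTDihedral.Derivable C (N.1.circuit ⨾ N.2.circuit)) ∧
    (∀ (n : ℕ) (C : CNOTDihedral.Circuit n), ∃ C' : CNOTDihedral.Circuit n,
      CNOTDihedral.Derivable (C ⨾ C') (CNOTDihedral.Circuit.wires n) ∧
        CNOTDihedral.Derivable (C' ⨾ C) (CNOTDihedral.Circuit.wires n)) ∧
    (∀ (n : ℕ) (C C' : CNOTDihedral.Circuit n),
      CNOTDihedral.Derivable C C' ↔ C.operator = C'.operator) := by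
  have normal : ∀ (n : ℕ) (C : CNOTDihedral.Circuit n),
      ∃ N : CNOTDihedral.DiagonalNF n × CNOTDihedral.AffineNF n,
        CNOTDihedral.Derivable C (N.1.circuit ⨾ N.2.circuit) := fun n C => by
    obtain ⟨N, hN⟩ := CNOTDihedral.CircuitClass.exists_normalForm C
    exact ⟨N, CNOTDihedral.CircuitClass.mk_eq_mk.1 hN⟩
  have injective : ∀ {n : ℕ} {N N' : CNOTDihedral.DiagonalNF n × CNOTDihedral.AffineNF n},
      (N.1.circuit ⨾ N.2.circuit).operator = (N'.1.circuit ⨾ N'.2.circuit).operator → N = N' :=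
    fun h => CNOTDihedral.CircuitClass.normalForm_injective
      ((CNOTDihedral.Circuit.operator_eq_iff _ _).1 h).1
      ((CNOTDihedral.Circuit.operator_eq_iff _ _).1 h).2
  have sound : ∀ {n : ℕ} {C C' : CNOTDihedral.Circuit n}, CNOTDihedral.Derivable C C' →
      C.operator = C'.operator := fun h =>
    (CNOTDihedral.Circuit.operator_eq_iff _ _).2
      ⟨funext fun x => (h.sound x).1, funext fun x => (h.sound x).2⟩
  refine ⟨fun n C => ?_, fun n C => ?_, fun n C C' => ⟨sound, fun h => ?_⟩⟩
  · obtain ⟨N, hN⟩ := normal n C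
    exact ⟨N, hN, fun N' hN' => injective (sound (hN'.symm.trans hN))⟩
  · obtain ⟨b, h1, h2⟩ := CNOTDihedral.CircuitClass.exists_inverse (CNOTDihedral.CircuitClass.mk C)
    obtain ⟨C', rfl⟩ := CNOTDihedral.CircuitClass.mk_surjective b
    exact ⟨C', CNOTDihedral.CircuitClass.mk_eq_mk.1 h1, CNOTDihedral.CircuitClass.mk_eq_mk.1 h2⟩
  · obtain ⟨N, hN⟩ := normal n C
    obtain ⟨N', hN'⟩ := normal n C'
    -- Soundness carries the equality of operators to the two normal forms, which then coincide and
    -- link the circuits by a derivation.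
    obtain rfl : N = N' := injective (((sound hN).symm.trans h).trans (sound hN'))
    exact hN.trans hN'.symm
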